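/- Let $0\le\alpha\le 1$ and $n_0\ge 1$ an integer. Let $Z^i=(Z^i(s))_{s\ge 0}$, $i\ge 0$, be independent càdlàg continuous-time Markov chains on $\{0,1,2,\ldots\}$, with $Z^0(0)=n_0$ and $Z^i(0)=1$ for $i\ge 1$, each jumping from $m\ge 1$ to $m+1$ at rate $m-\alpha$ and to $m-1$ at rate $m$, and absorbed in $0$. Let $\zeta_i=\inf\{s\ge 0: Z^i(s)=0\}$. Let $(J_t)_{t\ge 0}$ be a Poisson process of rate $\alpha$, independent of $(Z^i)_{i\ge 0}$, and let $$X_t=-t+\sum_{i=0}^{J_t}\zeta_i,\quad t\ge 0,\qquad T=\inf\{t\ge 0: X_t=0\}.$$ Then almost surely all $\zeta_i$ and $T$ are finite. Let $U_0=0$, let $U_i$, $i\ge 1$, be the successive jump times of $J$, and set $B_i=X_{U_i-}$ (with $X_{0-}:=0$) and $D_i=X_{U_i}$. For $y\ge 0$ let $I^y_1<\cdots<I^y_{K^y}$ be the indices $0\le i\le J_T$ with $B_i\le y<D_i$, and let $$\mathcal S^y=\big(Z^{I^y_1}(y-B_{I^y_1}),\ldots,Z^{I^y_{K^y}}(y-B_{I^y_{K^y}})\big)$$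 be the skewer at level $y$, the empty vector if $K^y=0$. Then $(\mathcal S^y)_{y\ge 0}$ is an up-down ordered Chinese Restaurant Process with parameters $(\alpha,0)$ starting from $(n_0)$, that is, a continuous-time Markov chain with almost surely càdlàg paths and initial state $(n_0)$ in the space of integer compositions $\{(n_1,\ldots,n_k): k\ge 0,\ n_1,\ldots,n_k\ge 1\}$, which from state $(n_1,\ldots,n_k)$ makes, for each $1\le i\le k$, the following transitions (the rates of transitions that lead to the same state add up): - at rate $n_i-\alpha$, to $(n_1,\ldots,n_{i-1},n_i+1,n_{i+1},\ldots,n_k)$; - at rate $\alpha$, to $(n_1,\ldots,n_i,1,n_{i+1},\ldots,n_k)$; - at rate $n_i$, to $(n_1,\ldots,n_{i-1},n_i-1,n_{i+1},\ldots,n_k)$ if $n_i\ge 2$, and to $(n_1,\ldots,n_{i-1},n_{i+1},\ldots,n_k)$ if $n_i=1$. -/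

import Mathlib

open MeasureTheory ProbabilityTheory Filter Topology
open scoped NNReal ENNReal

noncomputable section

namespace Skewer

/-! ## Continuous-time Markov chains given by jump rates -/

/-- A path in a discrete state space `S` is càdlàg: it is right-continuous and has left limits
with respect to the discrete topology. -/
def IsCadlagPath {S : Type*} (f : ℝ≥0 → S) : Prop :=
  ∀ t, (∀ᶠ s in 𝓝[>] t, f s = f t) ∧ ∃ x, ∀ᶠ s in 𝓝[<] t, f s = x

/-- The successive jump times of a path: time `0`, then the first time at which the path has left
the state that it had at the previous jump time (`∞` if there is no such time). -/
def jumpTime {S : Type*} (f : ℝ≥0 → S) : ℕ → ℝ≥0∞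
  | 0 => 0
  | n + 1 =>
    sInf ((fun t : ℝ≥0 => (t : ℝ≥0∞)) ''
      {t : ℝ≥0 | jumpTime f n ≤ t ∧ f t ≠ f (jumpTime f n).toNNReal})

/-- The state entered at the `n`-th jump time (meaningful when that time is finite). -/
def jumpState {S : Type*} (f : ℝ≥0 → S) (n : ℕ) : S := f (jumpTime f n).toNNReal

/-- The holding time in the state entered at the `n`-th jump time. -/
def holdingTime {S : Type*} (f : ℝ≥0 → S) (n : ℕ) : ℝ≥0∞ := jumpTime f (n + 1) - jumpTime f n

/-- Total rate of leaving `x`, where `q x y` is the jump rate from `x` to `y ≠ x`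
(the diagonal of `q` is zero, so that the Q-matrix has diagonal entries `-totalRate q x`). -/
def totalRate {S : Type*} (q : S → S → ℝ) (x : S) : ℝ := ∑' y, q x y

/-- `Y` is a continuous-time Markov chain with jump rates `q` started from `x₀`
(jump-chain/holding-time description): its paths are almost surely càdlàg, the successive states
form a Markov chain from `x₀` with transition probabilities `q x y / totalRate q x`, and given
these states the holding times are independent, exponential of rate `totalRate q x` in state `x`
(infinite if this rate is zero). -/
structure IsMarkovChain {Ω S : Type*} [MeasurableSpace Ω] (q : S → S → ℝ) (x₀ : S)
    (Y : ℝ≥0 → Ω → S) (μ : Measure Ω) : Prop where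
  measurable : ∀ t x, NullMeasurableSet {ω | Y t ω = x} μ
  cadlag : ∀ᵐ ω ∂μ, IsCadlagPath (fun t => Y t ω)
  law : ∀ (n : ℕ) (x : ℕ → S) (t : ℕ → ℝ≥0), x 0 = x₀ →
    μ {ω | ∀ k ≤ n, jumpTime (fun s => Y s ω) k < ⊤ ∧ jumpState (fun s => Y s ω) k = x k ∧
        (t k : ℝ≥0∞) < holdingTime (fun s => Y s ω) k} =
      ENNReal.ofReal ((∏ k ∈ Finset.range n, q (x k) (x (k + 1)) / totalRate q (x k)) *
        ∏ k ∈ Finset.range (n + 1), Real.exp (-totalRate q (x k) * t k))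
  start : ∀ᵐ ω ∂μ, Y 0 ω = x₀

/-! ## The three chains -/

/-- Jump rates of a Poisson process of rate `α`. -/
def poissonRate (α : ℝ) (m m' : ℕ) : ℝ := if m' = m + 1 then α else 0

/-- A Poisson process of rate `α`: a càdlàg counting process from `0` with unit jumps, whose
inter-arrival times are independent and exponential of rate `α`. -/
def IsPoissonProcess {Ω : Type*} [MeasurableSpace Ω] (α : ℝ) (J : ℝ≥0 → Ω → ℕ)
    (μ : Measure Ω) : Prop :=
  IsMarkovChain (poissonRate α) 0 J μ

/-- The off-diagonal entries of `Q_α`: up-rate `m - α` and down-rate `m` from `m ≥ 1`;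
the state `0` is absorbing. -/
def tableRate (α : ℝ) (m m' : ℕ) : ℝ :=
  if m = 0 then 0 else if m' = m + 1 then m - α else if m' + 1 = m then m else 0

/-- `Z` is a `Q_α`-Markov chain started from `m₀`. -/
def IsTableChain {Ω : Type*} [MeasurableSpace Ω] (α : ℝ) (m₀ : ℕ) (Z : ℝ≥0 → Ω → ℕ)
    (μ : Measure Ω) : Prop :=
  IsMarkovChain (tableRate α) m₀ Z μ

/-- Integer compositions `(n₁, …, n_k)` with `k ≥ 0` and all `n_i ≥ 1`. -/
abbrev Comp : Type := List ℕ+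

/-- One customer leaves table `i` (counted from `0`); the table is removed if it becomes empty. -/
def leaveTable (c : Comp) (i : Fin c.length) : Comp :=
  if c.get i = 1 then c.eraseIdx i else c.set i (c.get i - 1)

/-- Jump rates of the up-down oCRP`(α, θ)`. Different moves that lead to the same
composition add up. -/
def ocrpRate (α θ : ℝ) (c c' : Comp) : ℝ :=
  (if c' = 1 :: c then θ else 0) +
    ∑ i : Fin c.length,
      ((if c' = c.set i (c.get i + 1) then ((c.get i : ℕ) : ℝ) - α else 0) +
        (if c' = c.insertIdx ((i : ℕ) + 1) 1 then α else 0) +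
        (if c' = leaveTable c i then ((c.get i : ℕ) : ℝ) else 0))

/-- `S` is an up-down ordered Chinese Restaurant Process with parameters `(α, θ)`
started from the composition `c`. -/
def IsUpDownOCRP {Ω : Type*} [MeasurableSpace Ω] (α θ : ℝ) (c : Comp)
    (S : ℝ≥0 → Ω → Comp) (μ : Measure Ω) : Prop :=
  IsMarkovChain (ocrpRate α θ) c S μ

/-! ## The marked process and its skewer -/

/-- Absorption time `inf {s ≥ 0 : z s = 0}` of a path that does reach `0`. -/
def absorptionTime (z : ℝ≥0 → ℕ) : ℝ≥0 := sInf {s | z s = 0}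

/-- `X_t = -t + ∑_{i = 0}^{J_t} ζ_i`, where `ζ_i` is the absorption time of `z i`. -/
def contour (j : ℝ≥0 → ℕ) (z : ℕ → ℝ≥0 → ℕ) (t : ℝ≥0) : ℝ :=
  -(t : ℝ) + ∑ i ∈ Finset.range (j t + 1), (absorptionTime (z i) : ℝ)

/-- `inf {t ≥ 0 : X_t = 0}` for a path `X` that does reach `0`. -/
def hitZero (X : ℝ≥0 → ℝ) : ℝ≥0 := sInf {t | X t = 0}

/-- The time of the `i`-th jump: the initial jump is at time `0`, and the `i`-th one after it is
the `i`-th arrival of the counting path `j`. -/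
def arrivalTime (j : ℝ≥0 → ℕ) (i : ℕ) : ℝ≥0 := sInf {t | i ≤ j t}

/-- The left limit `X_{u-}`, with the convention `X_{0-} = 0`. -/
def preJump (X : ℝ≥0 → ℝ) (u : ℝ≥0) : ℝ := if u = 0 then 0 else Function.leftLim X u

open Classical in
/-- The skewer at level `y` of a path `X` with jumps at times `U 0, …, U N`, the `i`-th jump being
marked by the path `z i`: list in increasing order the indices `i ≤ N` of those jumps that cross
level `y`, that is `B_i ≤ y < D_i` for the pre- and post-jump heights `B_i = X_{U_i-}`,
`D_i = X_{U_i}`, and read off the mark `z i` at `y - B_i`. (If the mark is positive up to time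
`D_i - B_i`, as for the marked process below, the value is a positive integer and `Nat.toPNat'`
only changes its type.) -/
def skewer (X : ℝ≥0 → ℝ) (U : ℕ → ℝ≥0) (N : ℕ) (z : ℕ → ℝ≥0 → ℕ) (y : ℝ≥0) : Comp :=
  ((List.range (N + 1)).filter fun i => preJump X (U i) ≤ y ∧ (y : ℝ) < X (U i)).map
    fun i => (z i (Real.toNNReal ((y : ℝ) - preJump X (U i)))).toPNat'

/-- The skewer process, indexed by the level `y`, of the process `X` built from `j` and `z`
and stopped at `T = inf {t ≥ 0 : X_t = 0}`, with `z i` as the mark of its `i`-th jump,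
`0 ≤ i ≤ J_T`. -/
def skewerProcess (j : ℝ≥0 → ℕ) (z : ℕ → ℝ≥0 → ℕ) (y : ℝ≥0) : Comp :=
  skewer (contour j z) (arrivalTime j) (j (hitZero (contour j z))) z y

end Skewer

end

/-! The contour is the depth-first exploration of a branching population. A table is an individual
whose lifetime is its absorption time; during its life it gives birth at rate `α` to independent
tables with one customer; the skewer at level `y` lists the individuals alive at `y`. Seen this way,
the theorem is a first-step analysis in the variable `y`. A table of `m` customers grows at rate `m
- α`, shrinks at rate `m` and gives birth at rate `α`, hence has total rate `2 * m`. After a birth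
the future is a concatenation of two independent trees, the one of the parent followed by the one of
the newborn: children born later, hence higher, are visited earlier by the contour and so fit
between the two.

The difficulty is that the contour meets the children of a table from the top down, whereas
evolution in `y` asks for the lowest one. By lack of memory the exploration from height `t + h` can
be cut when it first passes level `t` (`lintegral_childLawAux_add`, `lintegral_childLaw_add`). This
gives a renewal equation that singles out the highest child (`lintegral_childLaw_eq_first`). The
decomposition at the lowest child satisfies the same equation, whose bounded solutions are unique
(`renewal_le`), so it is valid as well (`lintegral_childLaw_eq_last`). Comparing the lowest birth
with the first jump of the parent gives the first-step equation of a tree, `treeLaw_eq_stepMeasure`.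

Finiteness is proved along the way. The laws `tableLaw` and `treeLaw` are sums over the number of
jumps, or of explored tables, and a priori have mass at most one. Their mass defects obey a
recursion, and a bounded harmonic function of the table chain that vanishes at `0` is zero
(`eq_zero_of_harmonic`). This gives `tableLaw_univ` and `treeLaw_univ`, hence that almost surely all
absorption times and `T` are finite.

A composition is a row of independent trees. Competing exponential clocks (`concatLaw_stepMeasure`)
turn the equation of a tree into that of a forest, whose rates are those of the ordered Chinese
Restaurant Process (`lintegral_forestJumpLaw`, `isChainFamily_forestLaw`). A first-step equation
implies the jump-chain and holding-time description (`IsChainFamily.measure_jumpEvent_eq`), and that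
description together with the start determines the law on path space (`measure_eq_of_jumpEvent`),
which identifies the laws of the given chains. Finally, `skewerProcess_eq` shows path by path that
the skewer is the concatenation of delayed table paths used to define `treeLaw`, and
`map_eq_prod_marksLaw` supplies the joint law of its ingredients. -/

noncomputable section

namespace Skewer

/-! ## The space of càdlàg paths -/

/-- Càdlàg paths in a discrete state space. -/
structure Cadlag (S : Type*) where
  /-- The underlying function. -/
  toFun : ℝ≥0 → S
  isCadlagPath : IsCadlagPath toFun

namespace Cadlag

variable {S S' β : Type*}

instance : CoeFun (Cadlag S) (fun _ => ℝ≥0 → S) := ⟨toFun⟩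

/-- The `σ`-algebra generated by the evaluation maps. -/
instance : MeasurableSpace (Cadlag S) :=
  MeasurableSpace.comap toFun (@MeasurableSpace.pi ℝ≥0 (fun _ => S) fun _ => ⊤)

@[ext] theorem ext {f g : Cadlag S} (h : ∀ t, f t = g t) : f = g := by
  cases f; cases g; congr; exact funext h

theorem measurableSet_eval (t : ℝ≥0) (A : Set S) : MeasurableSet {f : Cadlag S | f t ∈ A} := by
  refine ⟨{g | g t ∈ A}, ?_, rfl⟩
  exact (@measurable_pi_apply ℝ≥0 (fun _ => S) (fun _ => ⊤) t) trivial

theorem measurable_of_eval [Countable S] [MeasurableSpace β] {g : β → Cadlag S}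
    (h : ∀ t x, MeasurableSet {b | g b t = x}) : Measurable g := by
  refine Measurable.of_comap_le ?_
  rw [instMeasurableSpace, MeasurableSpace.comap_comp, ← measurable_iff_comap_le]
  refine @measurable_pi_lambda _ _ _ _ (fun _ => ⊤) _ fun t => ?_
  refine @measurable_to_countable' S β ⊤ _ _ _ fun x => h t x

theorem exists_right_const (f : Cadlag S) (t : ℝ≥0) : ∃ u, t < u ∧ ∀ s, t ≤ s → s < u → f s = f t := by
  obtain ⟨u, hu, h⟩ := (mem_nhdsGT_iff_exists_Ioo_subset' (show t < t + 1 by simp)).1 (f.2 t).1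
  refine ⟨u, hu, fun s h1 h2 => ?_⟩
  rcases h1.eq_or_lt with rfl | h1
  · rfl
  · exact h ⟨h1, h2⟩

/-- Right-continuity reads the value at `t` from a countable dense set. This makes evaluation at a
random time measurable, although the `σ`-algebra only knows fixed times. -/
theorem eval_eq_iff (f : Cadlag S) (t : ℝ≥0) (x : S) :
    f t = x ↔ ∃ n, t < TopologicalSpace.denseSeq ℝ≥0 n ∧ ∀ m, t < TopologicalSpace.denseSeq ℝ≥0 m →
      TopologicalSpace.denseSeq ℝ≥0 m < TopologicalSpace.denseSeq ℝ≥0 n →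
        f (TopologicalSpace.denseSeq ℝ≥0 m) = x := by
  obtain ⟨u, hu, h⟩ := f.exists_right_const t
  have hd := TopologicalSpace.denseRange_denseSeq ℝ≥0
  constructor
  · rintro rfl
    obtain ⟨_, ⟨n, rfl⟩, h1, h2⟩ := hd.exists_between hu
    exact ⟨n, h1, fun m h3 h4 => h _ h3.le (h4.trans h2)⟩
  · rintro ⟨n, h1, h2⟩
    obtain ⟨_, ⟨m, rfl⟩, h3, h4⟩ := hd.exists_between (lt_min hu h1)
    rw [← h _ h3.le (h4.trans_le (min_le_left _ _)), h2 m h3 (h4.trans_le (min_le_right _ _))]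

theorem measurableSet_eval_eq [MeasurableSpace β] {g : β → Cadlag S} {t : β → ℝ≥0}
    (hg : Measurable g) (ht : Measurable t) (x : S) : MeasurableSet {b | g b (t b) = x} := by
  simp_rw +singlePass [eval_eq_iff]
  simp only [Set.ofPred_exists, Set.ofPred_and, Set.ofPred_forall]
  refine MeasurableSet.iUnion fun n => (measurableSet_lt ht measurable_const).inter
    (MeasurableSet.iInter fun m => ?_)
  by_cases hnm : TopologicalSpace.denseSeq ℝ≥0 m < TopologicalSpace.denseSeq ℝ≥0 n
  · have : {b | t b < TopologicalSpace.denseSeq ℝ≥0 m → TopologicalSpace.denseSeq ℝ≥0 m <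
        TopologicalSpace.denseSeq ℝ≥0 n → g b (TopologicalSpace.denseSeq ℝ≥0 m) = x} =
        {b | t b < TopologicalSpace.denseSeq ℝ≥0 m}ᶜ ∪
          {b | g b (TopologicalSpace.denseSeq ℝ≥0 m) ∈ ({x} : Set S)} := by
      ext b
      simp only [hnm, Set.mem_ofPred_eq, Set.mem_union, Set.mem_compl_iff, Set.mem_singleton_iff]
      tauto
    rw [this]
    exact (measurableSet_lt ht measurable_const).compl.union (hg (measurableSet_eval _ _))
  · simp [hnm]

theorem measurableSet_eval_ne [Countable S] [MeasurableSpace β] {g : β → Cadlag S}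
    {t s : β → ℝ≥0} (hg : Measurable g) (ht : Measurable t) (hs : Measurable s) :
    MeasurableSet {b | g b (t b) ≠ g b (s b)} := by
  have : {b | g b (t b) ≠ g b (s b)} = (⋃ x, {b | g b (t b) = x} ∩ {b | g b (s b) = x})ᶜ := by
    ext b
    simp [eq_comm]
  rw [this]
  exact (MeasurableSet.iUnion fun x =>
    (measurableSet_eval_eq hg ht x).inter (measurableSet_eval_eq hg hs x)).compl

/-! ### Operations on paths -/

/-- The constant path. -/
def const (c : S) : Cadlag S := ⟨fun _ => c, fun _ => ⟨by simp, c, by simp⟩⟩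

@[simp] theorem const_apply (c : S) (t : ℝ≥0) : const c t = c := rfl

/-- The image of a path under a map of the state spaces. -/
def map (φ : S → S') (f : Cadlag S) : Cadlag S' :=
  ⟨fun t => φ (f t), fun t => ⟨(f.2 t).1.mono fun _ hs => congrArg φ hs,
    let ⟨x, hx⟩ := (f.2 t).2; ⟨φ x, hx.mono fun _ hs => congrArg φ hs⟩⟩⟩

@[simp] theorem map_apply (φ : S → S') (f : Cadlag S) (t : ℝ≥0) : map φ f t = φ (f t) := rfl

theorem measurable_map [Countable S'] (φ : S → S') : Measurable (map φ) :=
  measurable_of_eval fun t x => measurableSet_eval t (φ ⁻¹' {x})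

/-- The pointwise concatenation of two paths of lists. -/
def append {γ : Type*} (f g : Cadlag (List γ)) : Cadlag (List γ) :=
  ⟨fun t => f t ++ g t, fun t =>
    ⟨by filter_upwards [(f.2 t).1, (g.2 t).1] with s h1 h2; simp only [h1, h2],
     by
      obtain ⟨x, hx⟩ := (f.2 t).2
      obtain ⟨y, hy⟩ := (g.2 t).2
      exact ⟨x ++ y, by filter_upwards [hx, hy] with s h1 h2; rw [h1, h2]⟩⟩⟩

instance {γ : Type*} : Append (Cadlag (List γ)) := ⟨append⟩

@[simp] theorem append_apply {γ : Type*} (f g : Cadlag (List γ)) (t : ℝ≥0) :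
    (f ++ g) t = f t ++ g t := rfl

@[simp] theorem nil_append {γ : Type*} (f : Cadlag (List γ)) : const [] ++ f = f := by
  ext1 t; simp

@[simp] theorem append_nil {γ : Type*} (f : Cadlag (List γ)) : f ++ const [] = f := by
  ext1 t; simp

theorem append_assoc {γ : Type*} (f g h : Cadlag (List γ)) : f ++ g ++ h = f ++ (g ++ h) := by
  ext1 t; simp

@[fun_prop] theorem measurable_append {γ : Type*} [Countable γ] [MeasurableSpace β]
    {f g : β → Cadlag (List γ)} (hf : Measurable f) (hg : Measurable g) :
    Measurable fun b => f b ++ g b := by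
  refine measurable_of_eval fun t x => ?_
  have : {b | (f b ++ g b) t = x} =
      ⋃ y : List γ, ⋃ z : List γ, ⋃ _ : y ++ z = x, {b | f b t = y} ∩ {b | g b t = z} := by
    ext b
    simp
  rw [this]
  exact MeasurableSet.iUnion fun y => MeasurableSet.iUnion fun z => MeasurableSet.iUnion fun _ =>
    (hf (measurableSet_eval t {y})).inter (hg (measurableSet_eval t {z}))

/-- The path that stays in `c` before time `s` and then follows `f`. -/
def delay (c : S) (s : ℝ) (f : Cadlag S) : Cadlag S :=
  ⟨fun t => if (t : ℝ) < s then c else f (t - s).toNNReal, fun t => by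
    have hct : Continuous fun u : ℝ≥0 => ((u : ℝ) - s).toNNReal := by fun_prop
    rcases lt_or_ge (t : ℝ) s with h | h
    · have : ∀ᶠ u : ℝ≥0 in 𝓝 t, (if (u : ℝ) < s then c else f (u - s).toNNReal) = c := by
        filter_upwards [(NNReal.continuous_coe.tendsto t).eventually (gt_mem_nhds h)] with u hu
        rw [if_pos hu]
      refine ⟨?_, c, this.filter_mono nhdsWithin_le_nhds⟩
      simp only [if_pos h]
      exact this.filter_mono nhdsWithin_le_nhds
    · constructor
      · have h1 : Tendsto (fun u : ℝ≥0 => ((u : ℝ) - s).toNNReal) (𝓝[>] t)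
            (𝓝[>] ((t : ℝ) - s).toNNReal) := by
          refine tendsto_nhdsWithin_iff.2 ⟨(hct.tendsto t).mono_left nhdsWithin_le_nhds, ?_⟩
          filter_upwards [self_mem_nhdsWithin] with u hu
          have hu' : (t : ℝ) < u := NNReal.coe_lt_coe.2 hu
          exact (Real.toNNReal_lt_toNNReal_iff (by linarith)).2 (by linarith)
        filter_upwards [h1.eventually (f.2 _).1, self_mem_nhdsWithin] with u hu hu2
        have hu' : (t : ℝ) < u := NNReal.coe_lt_coe.2 hu2
        rw [if_neg (by linarith), if_neg (by linarith), hu]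
      · rcases h.eq_or_lt with h | h
        · refine ⟨c, ?_⟩
          filter_upwards [self_mem_nhdsWithin] with u hu
          have hu' : (u : ℝ) < t := NNReal.coe_lt_coe.2 hu
          rw [if_pos (by linarith)]
        · obtain ⟨x, hx⟩ := (f.2 ((t : ℝ) - s).toNNReal).2
          refine ⟨x, ?_⟩
          have h1 : Tendsto (fun u : ℝ≥0 => ((u : ℝ) - s).toNNReal) (𝓝[<] t)
              (𝓝[<] ((t : ℝ) - s).toNNReal) := by
            refine tendsto_nhdsWithin_iff.2 ⟨(hct.tendsto t).mono_left nhdsWithin_le_nhds, ?_⟩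
            filter_upwards [self_mem_nhdsWithin] with u hu
            have hu' : (u : ℝ) < t := NNReal.coe_lt_coe.2 hu
            exact (Real.toNNReal_lt_toNNReal_iff (by linarith)).2 (by linarith)
          have h2 : ∀ᶠ u : ℝ≥0 in 𝓝[<] t, s < (u : ℝ) :=
            ((NNReal.continuous_coe.tendsto t).eventually (lt_mem_nhds h)).filter_mono
              nhdsWithin_le_nhds
          filter_upwards [h1.eventually hx, h2] with u hu hu2
          rw [if_neg (by linarith), hu]⟩

theorem delay_apply (c : S) (s : ℝ) (f : Cadlag S) (t : ℝ≥0) :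
    delay c s f t = if (t : ℝ) < s then c else f (t - s).toNNReal := rfl

@[fun_prop] theorem measurable_delay [Countable S] [MeasurableSpace β] {c : S} {s : β → ℝ}
    {f : β → Cadlag S} (hs : Measurable s) (hf : Measurable f) :
    Measurable fun b => delay c (s b) (f b) := by
  refine measurable_of_eval fun t x => ?_
  have : {b | delay c (s b) (f b) t = x} = ({b | (t : ℝ) < s b} ∩ {_b | c = x}) ∪
      ({b | (t : ℝ) < s b}ᶜ ∩ {b | f b ((t : ℝ) - s b).toNNReal = x}) := by
    ext b
    by_cases h : (t : ℝ) < s b <;> simp [delay_apply, h]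
  rw [this]
  have h1 : MeasurableSet {b | (t : ℝ) < s b} := measurableSet_lt measurable_const hs
  exact (h1.inter (MeasurableSet.const _)).union
    (h1.compl.inter (measurableSet_eval_eq hf (by fun_prop) x))

theorem delay_const (c : S) (s : ℝ) : delay c s (const c) = const c := by
  ext1 t; simp [delay_apply]

theorem delay_append {γ : Type*} (c d : List γ) (s : ℝ) (f g : Cadlag (List γ)) :
    delay (c ++ d) s (f ++ g) = delay c s f ++ delay d s g := by
  ext1 t; simp only [delay_apply, append_apply]; split_ifs <;> rfl

theorem delay_delay (c : S) (s : ℝ) {r : ℝ} (hr : 0 ≤ r) (f : Cadlag S) :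
    delay c s (delay c r f) = delay c (s + r) f := by
  ext1 t
  simp only [delay_apply]
  by_cases h1 : (t : ℝ) < s
  · rw [if_pos h1, if_pos (by linarith)]
  · rw [if_neg h1, Real.coe_toNNReal _ (by linarith)]
    by_cases h2 : (t : ℝ) - s < r
    · rw [if_pos h2, if_pos (by linarith)]
    · rw [if_neg h2, if_neg (by linarith), sub_sub]

theorem map_delay (φ : S → S') (c : S) (s : ℝ) (f : Cadlag S) :
    map φ (delay c s f) = delay (φ c) s (map φ f) := by
  ext1 t; simp only [delay_apply, map_apply]; split_ifs <;> rfl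

theorem delay_zero_of_pos (c : S) {s : ℝ} (hs : 0 < s) (f : Cadlag S) : delay c s f 0 = c := by
  simp [delay_apply, hs]

end Cadlag

/-! ## Jump times of càdlàg paths -/

section JumpTime

variable {S β : Type*}

theorem jumpTime_zero (f : ℝ≥0 → S) : jumpTime f 0 = 0 := rfl

theorem jumpTime_succ (f : ℝ≥0 → S) (n : ℕ) : jumpTime f (n + 1) =
    sInf ((fun t : ℝ≥0 => (t : ℝ≥0∞)) ''
      {t : ℝ≥0 | jumpTime f n ≤ t ∧ f t ≠ f (jumpTime f n).toNNReal}) := rfl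

theorem jumpTime_le_succ (f : ℝ≥0 → S) (n : ℕ) : jumpTime f n ≤ jumpTime f (n + 1) := by
  rw [jumpTime_succ]
  refine le_sInf ?_
  rintro _ ⟨t, ht, rfl⟩
  exact ht.1

theorem jumpTime_mono (f : ℝ≥0 → S) : Monotone (jumpTime f) :=
  monotone_nat_of_le_succ (jumpTime_le_succ f)

theorem eq_of_mem_jumpInterval {f : ℝ≥0 → S} {n : ℕ} {t : ℝ≥0} (h1 : jumpTime f n ≤ t)
    (h2 : (t : ℝ≥0∞) < jumpTime f (n + 1)) : f t = jumpState f n := by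
  by_contra h
  rw [jumpTime_succ] at h2
  refine absurd (sInf_le (Set.mem_image_of_mem _ ?_)) (not_le.2 h2)
  exact ⟨h1, h⟩

theorem jumpTime_lt_succ (f : Cadlag S) (n : ℕ) (h : jumpTime f n < ⊤) :
    jumpTime f n < jumpTime f (n + 1) := by
  obtain ⟨u, hu, hc⟩ := f.exists_right_const (jumpTime f n).toNNReal
  have h1 : jumpTime f n < u := by
    rw [← ENNReal.coe_toNNReal h.ne]; exact_mod_cast hu
  refine h1.trans_le ?_
  rw [jumpTime_succ]
  refine le_sInf ?_
  rintro _ ⟨t, ht, rfl⟩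
  by_contra hlt
  refine ht.2 (hc t ?_ (ENNReal.coe_lt_coe.1 (not_le.1 hlt)))
  rw [← ENNReal.coe_le_coe, ENNReal.coe_toNNReal h.ne]
  exact ht.1

/-- The infimum defining a finite jump time may only be approached from the right; right-continuity
carries the change of state back to the infimum itself. -/
theorem jumpState_succ_ne (f : Cadlag S) (n : ℕ) (h : jumpTime f (n + 1) < ⊤) :
    jumpState f (n + 1) ≠ jumpState f n := by
  intro heq
  obtain ⟨u, hu, hc⟩ := f.exists_right_const (jumpTime f (n + 1)).toNNReal
  have h1 : jumpTime f (n + 1) < u := by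
    rw [← ENNReal.coe_toNNReal h.ne]; exact_mod_cast hu
  nth_rw 1 [jumpTime_succ] at h1
  obtain ⟨_, ⟨t, ht, rfl⟩, htu⟩ := sInf_lt_iff.1 h1
  refine ht.2 ((hc t ?_ (ENNReal.coe_lt_coe.1 htu)).trans heq)
  rw [← ENNReal.coe_le_coe, ENNReal.coe_toNNReal h.ne]
  nth_rw 1 [jumpTime_succ]
  exact sInf_le ⟨t, ht, rfl⟩

/-- Jump times cannot accumulate: the left limit at an accumulation point would make consecutive
states eventually equal. -/
theorem exists_lt_jumpTime (f : Cadlag S) (t : ℝ≥0) : ∃ n, (t : ℝ≥0∞) < jumpTime f n := by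
  by_contra! hcon
  have hfin : ∀ n, jumpTime f n < ⊤ := fun n => (hcon n).trans_lt ENNReal.coe_lt_top
  set u : ℕ → ℝ≥0 := fun n => (jumpTime f n).toNNReal with hu
  have hcoe : ∀ n, (u n : ℝ≥0∞) = jumpTime f n := fun n => ENNReal.coe_toNNReal (hfin n).ne
  have hmono : StrictMono u := strictMono_nat_of_lt_succ fun n => by
    rw [← ENNReal.coe_lt_coe, hcoe, hcoe]
    exact jumpTime_lt_succ f n (hfin n)
  have hbdd : BddAbove (Set.range u) := ⟨t, by
    rintro _ ⟨n, rfl⟩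
    rw [← ENNReal.coe_le_coe, hcoe]
    exact hcon n⟩
  have hlim := tendsto_atTop_ciSup hmono.monotone hbdd
  have hlim' : Tendsto u atTop (𝓝[<] (⨆ n, u n)) := tendsto_nhdsWithin_iff.2
    ⟨hlim, Eventually.of_forall fun n =>
      (hmono (Nat.lt_succ_self n)).trans_le (le_ciSup hbdd (n + 1))⟩
  obtain ⟨x, hx⟩ := (f.2 (⨆ n, u n)).2
  obtain ⟨N, hN⟩ := eventually_atTop.1 (hlim'.eventually hx)
  exact jumpState_succ_ne f N (hfin _) ((hN (N + 1) (by lia)).trans (hN N le_rfl).symm)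

theorem exists_mem_jumpInterval (f : Cadlag S) (t : ℝ≥0) :
    ∃ n, jumpTime f n ≤ t ∧ (t : ℝ≥0∞) < jumpTime f (n + 1) := by
  classical
  have h := exists_lt_jumpTime f t
  obtain ⟨m, hm⟩ : ∃ m, Nat.find h = m + 1 := Nat.exists_eq_succ_of_ne_zero fun h0 => by
    have := Nat.find_spec h
    rw [h0, jumpTime_zero] at this
    exact absurd this (by simp)
  exact ⟨m, not_lt.1 (Nat.find_min h (by lia)), hm ▸ Nat.find_spec h⟩

theorem measurable_jumpTime [Countable S] (n : ℕ) :
    Measurable fun f : Cadlag S => jumpTime f n := by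
  induction n with
  | zero => exact measurable_const
  | succ n ih =>
    refine measurable_of_Iio fun r => ?_
    -- If the path has left its state at some time, right-continuity shows it also has at a slightly
    -- later time of the dense sequence, so countably many times suffice.
    have : (fun f : Cadlag S => jumpTime f (n + 1)) ⁻¹' Set.Iio r =
        ⋃ k, {f : Cadlag S | jumpTime f n ≤ TopologicalSpace.denseSeq ℝ≥0 k} ∩
          ({f | f (TopologicalSpace.denseSeq ℝ≥0 k) ≠ f (jumpTime f n).toNNReal} ∩
          {_f | (TopologicalSpace.denseSeq ℝ≥0 k : ℝ≥0∞) < r}) := by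
      ext f
      simp only [Set.mem_preimage, Set.mem_Iio, Set.mem_iUnion, Set.mem_inter_iff, Set.mem_ofPred_eq]
      rw [jumpTime_succ, sInf_lt_iff]
      constructor
      · rintro ⟨_, ⟨t, ht, rfl⟩, htr⟩
        obtain ⟨u, hu, hc⟩ := f.exists_right_const t
        obtain ⟨v, hv, hvr⟩ := ENNReal.lt_iff_exists_nnreal_btwn.1 htr
        obtain ⟨_, ⟨k, rfl⟩, h1, h2⟩ := (TopologicalSpace.denseRange_denseSeq ℝ≥0).exists_between
          (lt_min hu (ENNReal.coe_lt_coe.1 hv))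
        refine ⟨k, ht.1.trans (ENNReal.coe_le_coe.2 h1.le), ?_, ?_⟩
        · rw [hc _ h1.le (h2.trans_le (min_le_left _ _))]
          exact ht.2
        · exact (ENNReal.coe_lt_coe.2 (h2.trans_le (min_le_right _ _))).trans hvr
      · rintro ⟨k, h1, h2, h3⟩
        exact ⟨_, ⟨_, ⟨h1, h2⟩, rfl⟩, h3⟩
    rw [this]
    exact MeasurableSet.iUnion fun k => (measurableSet_le ih measurable_const).inter
      ((Cadlag.measurableSet_eval_ne measurable_id measurable_const ih.ennreal_toNNReal).inter
        (MeasurableSet.const _))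

theorem measurable_holdingTime [Countable S] (n : ℕ) :
    Measurable fun f : Cadlag S => holdingTime f n :=
  (measurable_jumpTime (n + 1)).sub (measurable_jumpTime n)

theorem measurableSet_jumpState_eq [Countable S] (n : ℕ) (x : S) :
    MeasurableSet {f : Cadlag S | jumpState f n = x} :=
  Cadlag.measurableSet_eval_eq measurable_id (measurable_jumpTime n).ennreal_toNNReal x

theorem jumpTime_succ_eq_add_holdingTime (f : ℝ≥0 → S) (n : ℕ) :
    jumpTime f (n + 1) = jumpTime f n + holdingTime f n :=
  (add_tsub_cancel_of_le (jumpTime_le_succ f n)).symm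

/-! ### Jump times of delayed paths -/

theorem jumpTime_one_delay (c : S) {s : ℝ≥0} (hs : 0 < s) (f : Cadlag S) (hc : f 0 ≠ c) :
    jumpTime (Cadlag.delay c s f) 1 = s := by
  have h0 : Cadlag.delay c s f 0 = c := Cadlag.delay_zero_of_pos c (by exact_mod_cast hs) f
  rw [jumpTime_succ, jumpTime_zero]
  refine le_antisymm (sInf_le ⟨s, ⟨by simp, ?_⟩, rfl⟩) (le_sInf ?_)
  · simp only [ENNReal.toNNReal_zero, h0]
    simpa [Cadlag.delay_apply] using hc
  · rintro _ ⟨t, ⟨-, ht⟩, rfl⟩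
    simp only [ENNReal.toNNReal_zero, h0, Cadlag.delay_apply, NNReal.coe_lt_coe] at ht
    by_contra hlt
    exact ht (if_pos (by simpa using hlt))

theorem delay_add (c : S) (s t : ℝ≥0) (f : Cadlag S) : Cadlag.delay c s f (s + t) = f t := by
  simp [Cadlag.delay_apply]

/-- The condition `f 0 ≠ c` makes `s` a genuine jump, so that delaying shifts the numbering of jumps
by exactly one. -/
theorem jumpTime_delay (c : S) {s : ℝ≥0} (hs : 0 < s) (f : Cadlag S) (hc : f 0 ≠ c) (n : ℕ) :
    jumpTime (Cadlag.delay c s f) (n + 1) = s + jumpTime f n := by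
  induction n with
  | zero => rw [zero_add, jumpTime_one_delay c hs f hc, jumpTime_zero, add_zero]
  | succ n ih =>
    rw [jumpTime_succ, ih, jumpTime_succ f n, ENNReal.add_sInf, sInf_image, iInf_image]
    refine le_antisymm (le_iInf₂ fun t ht => ?_) (le_iInf₂ fun t ht => ?_)
    · have hfin : jumpTime f n < ⊤ := ht.1.trans_lt ENNReal.coe_lt_top
      refine iInf₂_le_of_le (s + t) ⟨?_, ?_⟩ (by simp)
      · push_cast
        gcongr
        exact ht.1
      · rw [ENNReal.toNNReal_add (by simp) hfin.ne, ENNReal.toNNReal_coe, delay_add, delay_add]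
        exact ht.2
    · have hst : s ≤ t := by
        rw [← ENNReal.coe_le_coe]; exact le_self_add.trans ht.1
      obtain ⟨r, rfl⟩ := exists_add_of_le hst
      have hr : jumpTime f n ≤ r := by
        have := ht.1
        push_cast at this
        exact (ENNReal.add_le_add_iff_left (by simp)).1 this
      have hfin : jumpTime f n < ⊤ := hr.trans_lt ENNReal.coe_lt_top
      refine iInf₂_le_of_le r ⟨hr, ?_⟩ (by simp)
      have := ht.2
      rwa [ENNReal.toNNReal_add (by simp) hfin.ne, ENNReal.toNNReal_coe, delay_add, delay_add]
        at this

theorem jumpState_zero_delay (c : S) {s : ℝ≥0} (hs : 0 < s) (f : Cadlag S) :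
    jumpState (Cadlag.delay c s f) 0 = c := by
  simpa [jumpState, jumpTime_zero] using
    Cadlag.delay_zero_of_pos c (by exact_mod_cast hs) f

theorem jumpState_delay (c : S) {s : ℝ≥0} (hs : 0 < s) (f : Cadlag S) (hc : f 0 ≠ c) (n : ℕ)
    (h : jumpTime f n < ⊤) :
    jumpState (Cadlag.delay c s f) (n + 1) = jumpState f n := by
  rw [jumpState, jumpTime_delay c hs f hc, ENNReal.toNNReal_add (by simp) h.ne,
    ENNReal.toNNReal_coe, delay_add, jumpState]

theorem holdingTime_zero_delay (c : S) {s : ℝ≥0} (hs : 0 < s) (f : Cadlag S) (hc : f 0 ≠ c) :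
    holdingTime (Cadlag.delay c s f) 0 = s := by
  rw [holdingTime, zero_add, jumpTime_one_delay c hs f hc, jumpTime_zero, tsub_zero]

theorem holdingTime_delay (c : S) {s : ℝ≥0} (hs : 0 < s) (f : Cadlag S) (hc : f 0 ≠ c) (n : ℕ) :
    holdingTime (Cadlag.delay c s f) (n + 1) = holdingTime f n := by
  rw [holdingTime, jumpTime_delay c hs f hc, jumpTime_delay c hs f hc, holdingTime]
  exact ENNReal.add_sub_add_eq_sub_left (by simp)

/-- The event that the first states of a path are `x 0, …, x n`, with holding times longer than
`t 0, …, t n`. -/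
def JumpEvent (n : ℕ) (x : ℕ → S) (t : ℕ → ℝ≥0) (f : ℝ≥0 → S) : Prop :=
  ∀ k ≤ n, jumpTime f k < ⊤ ∧ jumpState f k = x k ∧ (t k : ℝ≥0∞) < holdingTime f k

theorem measurableSet_jumpEvent [Countable S] (n : ℕ) (x : ℕ → S) (t : ℕ → ℝ≥0) :
    MeasurableSet {f : Cadlag S | JumpEvent n x t f} := by
  simp only [JumpEvent, Set.ofPred_forall, Set.ofPred_and]
  exact MeasurableSet.iInter fun k => MeasurableSet.iInter fun _ =>
    (measurableSet_lt (measurable_jumpTime k) measurable_const).inter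
      ((measurableSet_jumpState_eq k _).inter
        (measurableSet_lt measurable_const (measurable_holdingTime k)))

theorem jumpEvent_delay_zero (c : S) {s : ℝ≥0} (hs : 0 < s) (f : Cadlag S) (hc : f 0 ≠ c)
    (x : ℕ → S) (t : ℕ → ℝ≥0) :
    JumpEvent 0 x t (Cadlag.delay c s f) ↔ c = x 0 ∧ t 0 < s := by
  simp [JumpEvent, jumpTime_zero, jumpState_zero_delay c hs, holdingTime_zero_delay c hs f hc]

/-- This splits off the first state and holding time, the inductive step that turns first-step
equations into jump-chain laws. -/
theorem jumpEvent_delay_succ (c : S) {s : ℝ≥0} (hs : 0 < s) (f : Cadlag S) (hc : f 0 ≠ c)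
    (n : ℕ) (x : ℕ → S) (t : ℕ → ℝ≥0) :
    JumpEvent (n + 1) x t (Cadlag.delay c s f) ↔
      c = x 0 ∧ t 0 < s ∧ JumpEvent n (fun k => x (k + 1)) (fun k => t (k + 1)) f := by
  have key : ∀ k, (jumpTime (Cadlag.delay c s f) (k + 1) < ⊤ ∧
      jumpState (Cadlag.delay c s f) (k + 1) = x (k + 1) ∧
      (t (k + 1) : ℝ≥0∞) < holdingTime (Cadlag.delay c s f) (k + 1)) ↔
      (jumpTime f k < ⊤ ∧ jumpState f k = x (k + 1) ∧ (t (k + 1) : ℝ≥0∞) < holdingTime f k) := by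
    intro k
    rw [jumpTime_delay c hs f hc, holdingTime_delay c hs f hc]
    have : (s : ℝ≥0∞) + jumpTime f k < ⊤ ↔ jumpTime f k < ⊤ := by simp
    rw [this]
    refine and_congr_right fun h => ?_
    rw [jumpState_delay c hs f hc k h]
  have h0 := jumpEvent_delay_zero c hs f hc x t
  simp only [JumpEvent, nonpos_iff_eq_zero, forall_eq] at h0
  constructor
  · intro h
    obtain ⟨h1, h2⟩ := h0.1 (h 0 (by lia))
    exact ⟨h1, h2, fun k hk => (key k).1 (h (k + 1) (by lia))⟩
  · rintro ⟨h1, h2, h3⟩ k hk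
    rcases k with _ | k
    · exact h0.2 ⟨h1, h2⟩
    · exact (key k).2 (h3 k (by lia))

end JumpTime

/-! ## Uniqueness of the law of a chain -/

section Uniqueness

variable {S : Type*}

theorem isPiSystem_jumpEvent :
    IsPiSystem {A : Set (Cadlag S) | ∃ n x t, A = {f : Cadlag S | JumpEvent n x t f}} := by
  rintro _ ⟨n₁, x₁, t₁, rfl⟩ _ ⟨n₂, x₂, t₂, rfl⟩ ⟨f₀, h₁, h₂⟩
  -- A path in the intersection forces the two state sequences to agree where both are prescribed,
  -- so its own states serve as the common sequence. Thresholds are merged by maximum; `0` imposes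
  -- nothing, because holding times of càdlàg paths at finite jump times are positive.
  refine ⟨max n₁ n₂, fun k => jumpState f₀ k,
    fun k => max (if k ≤ n₁ then t₁ k else 0) (if k ≤ n₂ then t₂ k else 0), ?_⟩
  have h₁' : JumpEvent n₁ x₁ t₁ f₀ := h₁
  have h₂' : JumpEvent n₂ x₂ t₂ f₀ := h₂
  ext f
  simp only [Set.mem_inter_iff, Set.mem_ofPred_eq]
  constructor
  · rintro ⟨h3, h4⟩ k hk
    by_cases hk1 : k ≤ n₁
    · obtain ⟨a, b, c⟩ := h3 k hk1
      refine ⟨a, b.trans (h₁' k hk1).2.1.symm, ?_⟩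
      by_cases hk2 : k ≤ n₂
      · simpa [hk1, hk2] using ⟨c, (h4 k hk2).2.2⟩
      · simpa [hk1, hk2] using c
    · have hk2 : k ≤ n₂ := by lia
      obtain ⟨a, b, c⟩ := h4 k hk2
      exact ⟨a, b.trans (h₂' k hk2).2.1.symm, by simpa [hk1, hk2] using c⟩
  · intro h
    constructor
    · intro k hk
      obtain ⟨a, b, c⟩ := h k (by lia)
      refine ⟨a, b.trans (h₁' k hk).2.1, lt_of_le_of_lt ?_ c⟩
      simp [hk]
    · intro k hk
      obtain ⟨a, b, c⟩ := h k (by lia)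
      refine ⟨a, b.trans (h₂' k hk).2.1, lt_of_le_of_lt ?_ c⟩
      simp [hk]

theorem jumpEvent_zero_iff (f : Cadlag S) (n : ℕ) (x : ℕ → S) :
    JumpEvent n x 0 f ↔ jumpTime f n < ⊤ ∧ ∀ k ≤ n, jumpState f k = x k := by
  constructor
  · exact fun h => ⟨(h n le_rfl).1, fun k hk => (h k hk).2.1⟩
  · rintro ⟨h1, h2⟩ k hk
    have : jumpTime f k < ⊤ := (jumpTime_mono _ hk).trans_lt h1
    exact ⟨this, h2 k hk, by simpa [holdingTime] using jumpTime_lt_succ f k this⟩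

/-- Jump events determine all holding times, hence all jump times, and then the value at any fixed
time is the state of the jump interval that contains it. -/
theorem measurable_of_jumpEvent [Countable S] {β : Type*} [MeasurableSpace β] {g : β → Cadlag S}
    (hgen : ∀ n x t, MeasurableSet {b | JumpEvent n x t (g b)}) : Measurable g := by
  -- Unions must be countable, so they run over finite words of states; `w'` extends a word to a
  -- sequence by repeating its last letter.
  let w' : ∀ n : ℕ, (Fin (n + 1) → S) → ℕ → S := fun n w k => w ⟨min k n, by lia⟩
  have hw' : ∀ (n : ℕ) (f : Cadlag S), ∀ k ≤ n,
      w' n (fun i => jumpState f i) k = jumpState f k := by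
    intro n f k hk
    simp [w', hk]
  have hhold : ∀ n, Measurable fun b => holdingTime (g b) n := by
    intro n
    refine measurable_of_Ioi fun r => ?_
    induction r using ENNReal.recTopCoe with
    | top => simp
    | coe r =>
      have : (fun b => holdingTime (g b) n) ⁻¹' Set.Ioi (r : ℝ≥0∞) =
          ⋃ w : Fin (n + 1) → S, {b | JumpEvent n (w' n w) (Pi.single n r) (g b)} := by
        ext b
        simp only [Set.mem_preimage, Set.mem_Ioi, Set.mem_iUnion, Set.mem_ofPred_eq]
        constructor
        · intro h
          have hn : jumpTime (g b) n < ⊤ := by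
            by_contra hc
            rw [holdingTime, not_lt_top_iff.1 hc] at h
            simp at h
          refine ⟨fun i => jumpState (g b) i, fun k hk => ?_⟩
          obtain ⟨a, b, c⟩ := ((jumpEvent_zero_iff (g b) n _).2
            ⟨hn, fun k hk => (hw' n (g b) k hk).symm⟩) k hk
          refine ⟨a, b, ?_⟩
          by_cases hkn : k = n
          · subst hkn; simpa using h
          · simpa [hkn] using c
        · rintro ⟨w, h⟩
          simpa using (h n le_rfl).2.2
      rw [this]
      exact MeasurableSet.iUnion fun w => hgen _ _ _
  have hjump : ∀ n, Measurable fun b => jumpTime (g b) n := by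
    intro n
    induction n with
    | zero => exact measurable_const
    | succ n ih =>
      simp only [jumpTime_succ_eq_add_holdingTime]
      exact ih.add (hhold n)
  refine Cadlag.measurable_of_eval fun t x => ?_
  have : {b | g b t = x} = ⋃ n : ℕ, ({b | jumpTime (g b) n ≤ t} ∩
      {b | (t : ℝ≥0∞) < jumpTime (g b) (n + 1)}) ∩
      ⋃ w : Fin (n + 1) → S, ⋃ _ : w' n w n = x, {b | JumpEvent n (w' n w) 0 (g b)} := by
    ext b
    simp only [Set.mem_iUnion, Set.mem_inter_iff, Set.mem_ofPred_eq, exists_prop]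
    constructor
    · rintro rfl
      obtain ⟨n, h1, h2⟩ := exists_mem_jumpInterval (g b) t
      refine ⟨n, ⟨h1, h2⟩, fun i => jumpState (g b) i, ?_, (jumpEvent_zero_iff (g b) n _).2
        ⟨h1.trans_lt ENNReal.coe_lt_top, fun k hk => (hw' n (g b) k hk).symm⟩⟩
      rw [hw' n (g b) n le_rfl, eq_of_mem_jumpInterval h1 h2]
    · rintro ⟨n, ⟨h1, h2⟩, w, rfl, h3⟩
      rw [eq_of_mem_jumpInterval h1 h2, (h3 n le_rfl).2.1]
  rw [this]
  exact MeasurableSet.iUnion fun n => ((measurableSet_le (hjump n) measurable_const).inter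
    (measurableSet_lt measurable_const (hjump (n + 1)))).inter
      (MeasurableSet.iUnion fun w => MeasurableSet.iUnion fun _ => hgen _ _ _)

theorem generateFrom_jumpEvent [Countable S] :
    Cadlag.instMeasurableSpace = MeasurableSpace.generateFrom
      {A : Set (Cadlag S) | ∃ n x t, A = {f : Cadlag S | JumpEvent n x t f}} := by
  refine le_antisymm ?_ (MeasurableSpace.generateFrom_le ?_)
  · have h : @Measurable _ _ (MeasurableSpace.generateFrom
        {A : Set (Cadlag S) | ∃ n x t, A = {f : Cadlag S | JumpEvent n x t f}}) _
        (fun f : Cadlag S => f) :=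
      @measurable_of_jumpEvent _ _ _ (_) _ fun n x t =>
        MeasurableSpace.measurableSet_generateFrom ⟨n, x, t, rfl⟩
    exact fun A hA => h hA
  · rintro _ ⟨n, x, t, rfl⟩
    exact measurableSet_jumpEvent n x t

/-- Jump events form a generating `π`-system. Those whose prescribed initial state differs from `c`
are null for both measures, so only `x 0 = c` has to be checked. -/
theorem measure_eq_of_jumpEvent [Countable S] {μ ν : Measure (Cadlag S)} [IsProbabilityMeasure μ]
    [IsProbabilityMeasure ν] {c : S} (hμ : ∀ᵐ f ∂μ, f 0 = c) (hν : ∀ᵐ f ∂ν, f 0 = c)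
    (h : ∀ n x t, x 0 = c → μ {f | JumpEvent n x t f} = ν {f | JumpEvent n x t f}) : μ = ν := by
  refine ext_of_generate_finite _ generateFrom_jumpEvent isPiSystem_jumpEvent ?_ (by simp)
  rintro _ ⟨n, x, t, rfl⟩
  by_cases hx : x 0 = c
  · exact h n x t hx
  · have key : ∀ f : Cadlag S, JumpEvent n x t f → f 0 ≠ c := by
      intro f hf h0
      refine hx ?_
      rw [← (hf 0 (by lia)).2.1, ← h0]
      rfl
    have hsub : {f : Cadlag S | JumpEvent n x t f} ⊆ {f | ¬ f 0 = c} := fun f hf => key f hf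
    rw [measure_mono_null hsub hμ, measure_mono_null hsub hν]

end Uniqueness

/-! ## Families of chains from their first-step equations -/

theorem lintegral_exp_neg_mul_Ioi {a : ℝ} (ha : 0 < a) (c : ℝ) :
    ∫⁻ s in Set.Ioi c, ENNReal.ofReal (Real.exp (-(a * s))) =
      ENNReal.ofReal (Real.exp (-(a * c)) / a) := by
  have h : ∀ s, Real.exp (-(a * s)) = Real.exp (-a * s) := fun s => by ring_nf
  simp only [h]
  rw [← ofReal_integral_eq_lintegral_ofReal (integrableOn_exp_mul_Ioi (by linarith) c)
    (Eventually.of_forall fun _ => (Real.exp_pos _).le), integral_exp_mul_Ioi (by linarith)]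
  congr 1
  rw [neg_div_neg_eq]

section FirstStep

variable {S : Type*}

/-- Rates of a chain: non-negative with finite sums, and zero on the diagonal. -/
structure IsRate (q : S → S → ℝ) : Prop where
  nonneg : ∀ x y, 0 ≤ q x y
  diag : ∀ x, q x x = 0
  summable : ∀ x, Summable (q x)

/-- A family of laws on path space, indexed by the initial state, that satisfies the first-step
equation for the rates `q`. -/
structure IsChainFamily (q : S → S → ℝ) (Q : S → Measure (Cadlag S)) : Prop where
  prob : ∀ c, IsProbabilityMeasure (Q c)
  absorbing : ∀ c, totalRate q c = 0 → Q c = Measure.dirac (Cadlag.const c)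
  step : ∀ c, totalRate q c ≠ 0 → ∀ F : Cadlag S → ℝ≥0∞, Measurable F →
    ∫⁻ f, F f ∂Q c = ∫⁻ s in Set.Ioi (0 : ℝ), ENNReal.ofReal (Real.exp (-(totalRate q c * s))) *
      ∑' c', ENNReal.ofReal (q c c') * ∫⁻ f, F (Cadlag.delay c s f) ∂Q c'

theorem IsRate.totalRate_nonneg {q : S → S → ℝ} (hq : IsRate q) (c : S) : 0 ≤ totalRate q c :=
  tsum_nonneg (hq.nonneg c)

theorem IsRate.tsum_ofReal {q : S → S → ℝ} (hq : IsRate q) (c : S) :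
    ∑' c', ENNReal.ofReal (q c c') = ENNReal.ofReal (totalRate q c) :=
  (ENNReal.ofReal_tsum_of_nonneg (hq.nonneg c) (hq.summable c)).symm

theorem jumpEvent_const_zero (c : S) (x : ℕ → S) (t : ℕ → ℝ≥0) (hx : x 0 = c) :
    JumpEvent 0 x t (Cadlag.const c) := by
  intro k hk
  obtain rfl : k = 0 := by lia
  refine ⟨by simp [jumpTime_zero], by simp [jumpState, hx], ?_⟩
  rw [holdingTime, jumpTime_succ]
  simp [jumpTime_zero]

theorem not_jumpEvent_const_succ (c : S) (n : ℕ) (x : ℕ → S) (t : ℕ → ℝ≥0) :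
    ¬ JumpEvent (n + 1) x t (Cadlag.const c) := by
  intro h
  have := (h 1 (by lia)).1
  rw [jumpTime_succ] at this
  simp at this

namespace IsChainFamily

variable {q : S → S → ℝ} {Q : S → Measure (Cadlag S)}

theorem ae_start [Countable S] (hQ : IsChainFamily q Q) (c : S) : ∀ᵐ f ∂Q c, f 0 = c := by
  by_cases h0 : totalRate q c = 0
  · rw [hQ.absorbing c h0]
    refine (ae_dirac_iff (Cadlag.measurableSet_eval 0 {c})).2 ?_
    simp
  · have hm : MeasurableSet {f : Cadlag S | ¬ f 0 = c} := Cadlag.measurableSet_eval 0 {c}ᶜ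
    rw [ae_iff, ← lintegral_indicator_one hm, hQ.step c h0 _ (measurable_one.indicator hm)]
    refine (setLIntegral_congr_fun measurableSet_Ioi fun s hs => ?_).trans (lintegral_zero)
    have : ∀ f, {f : Cadlag S | ¬ f 0 = c}.indicator (1 : Cadlag S → ℝ≥0∞) (Cadlag.delay c s f)
        = 0 := fun f => by
      simp [Set.indicator, Cadlag.delay_zero_of_pos c hs]
    simp [this]

/-- Each application of the first-step equation integrates the exponential weight over `(t 0, ∞)`,
which produces one factor `exp (-totalRate * t 0) / totalRate`. In the base case every target
contributes and the rates sum to `totalRate`; later only the prescribed target does. -/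
theorem measure_jumpEvent_eq [Countable S] (hq : IsRate q) (hQ : IsChainFamily q Q) (n : ℕ) :
    ∀ (x : ℕ → S) (t : ℕ → ℝ≥0), Q (x 0) {f | JumpEvent n x t f} =
      ENNReal.ofReal ((∏ k ∈ Finset.range n, q (x k) (x (k + 1)) / totalRate q (x k)) *
        ∏ k ∈ Finset.range (n + 1), Real.exp (-totalRate q (x k) * t k)) := by
  induction n with
  | zero =>
    intro x t
    by_cases h0 : totalRate q (x 0) = 0
    · rw [hQ.absorbing _ h0, Measure.dirac_apply' _ (measurableSet_jumpEvent _ _ _)]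
      simp [h0, jumpEvent_const_zero (x 0) x t rfl]
    · have hpos : 0 < totalRate q (x 0) := lt_of_le_of_ne (hq.totalRate_nonneg _) (Ne.symm h0)
      have hm := measurableSet_jumpEvent 0 x t
      rw [← lintegral_indicator_one hm, hQ.step _ h0 _ (measurable_one.indicator hm)]
      have key : ∀ s ∈ Set.Ioi (0 : ℝ), ENNReal.ofReal (Real.exp (-(totalRate q (x 0) * s))) *
          ∑' c', ENNReal.ofReal (q (x 0) c') * ∫⁻ f, {f : Cadlag S | JumpEvent 0 x t f}.indicator 1
            (Cadlag.delay (x 0) s f) ∂Q c' =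
          (Set.Ioi (t 0 : ℝ)).indicator (fun s => ENNReal.ofReal (totalRate q (x 0)) *
            ENNReal.ofReal (Real.exp (-(totalRate q (x 0) * s)))) s := by
        intro s hs
        have hs' : (0 : ℝ) < s := hs
        have : ∀ c', ENNReal.ofReal (q (x 0) c') * ∫⁻ f,
            {f : Cadlag S | JumpEvent 0 x t f}.indicator 1 (Cadlag.delay (x 0) s f) ∂Q c' =
            ENNReal.ofReal (q (x 0) c') * (Set.Ioi (t 0 : ℝ)).indicator 1 s := by
          intro c'
          -- The diagonal has to be treated apart, because a delayed path that continues in the same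
          -- state has no jump at the delay time; its rate is zero.
          by_cases hc : c' = x 0
          · simp [hc, hq.diag]
          congr 1
          have := hQ.prob c'
          calc _ = ∫⁻ f, (Set.Ioi (t 0 : ℝ)).indicator 1 s ∂Q c' := by
                refine lintegral_congr_ae ?_
                filter_upwards [hQ.ae_start c'] with f hf
                have := jumpEvent_delay_zero (x 0) (s := ⟨s, hs'.le⟩) hs' f (hf ▸ hc) x t
                simp only [Set.indicator, Set.mem_ofPred_eq, Set.mem_Ioi]
                congr 1
                rw [eq_iff_iff]
                exact this.trans (and_iff_right rfl)
            _ = _ := by simp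
        simp only [this]
        rw [ENNReal.tsum_mul_right, hq.tsum_ofReal]
        simp only [Set.indicator]
        split_ifs <;> simp [mul_comm]
      rw [setLIntegral_congr_fun measurableSet_Ioi key, setLIntegral_indicator measurableSet_Ioi,
        lintegral_const_mul _ (by fun_prop), Set.inter_eq_left.2 (Set.Ioi_subset_Ioi (NNReal.coe_nonneg _)),
        lintegral_exp_neg_mul_Ioi hpos, ← ENNReal.ofReal_mul hpos.le]
      congr 1
      simp only [Finset.range_zero, Finset.prod_empty, zero_add, Finset.range_one,
        Finset.prod_singleton, one_mul]
      field_simp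
  | succ n ih =>
    intro x t
    by_cases h0 : totalRate q (x 0) = 0
    · rw [hQ.absorbing _ h0, Measure.dirac_apply' _ (measurableSet_jumpEvent _ _ _)]
      rw [Finset.prod_range_succ' _ n]
      simp [h0, not_jumpEvent_const_succ]
    · have hpos : 0 < totalRate q (x 0) := lt_of_le_of_ne (hq.totalRate_nonneg _) (Ne.symm h0)
      have hm := measurableSet_jumpEvent (n + 1) x t
      set p : ℝ := ((∏ k ∈ Finset.range n,
        q (x (k + 1)) (x (k + 1 + 1)) / totalRate q (x (k + 1))) *
        ∏ k ∈ Finset.range (n + 1), Real.exp (-totalRate q (x (k + 1)) * t (k + 1))) with hp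
      have hp0 : 0 ≤ p := mul_nonneg (Finset.prod_nonneg fun k _ =>
        div_nonneg (hq.nonneg _ _) (hq.totalRate_nonneg _))
        (Finset.prod_nonneg fun k _ => (Real.exp_pos _).le)
      have hih := ih (fun k => x (k + 1)) (fun k => t (k + 1))
      rw [zero_add, ← hp] at hih
      rw [← lintegral_indicator_one hm, hQ.step _ h0 _ (measurable_one.indicator hm)]
      have key : ∀ s ∈ Set.Ioi (0 : ℝ), ENNReal.ofReal (Real.exp (-(totalRate q (x 0) * s))) *
          ∑' c', ENNReal.ofReal (q (x 0) c') * ∫⁻ f,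
            {f : Cadlag S | JumpEvent (n + 1) x t f}.indicator 1
            (Cadlag.delay (x 0) s f) ∂Q c' =
          (Set.Ioi (t 0 : ℝ)).indicator (fun s => ENNReal.ofReal (q (x 0) (x 1)) *
            ENNReal.ofReal p * ENNReal.ofReal (Real.exp (-(totalRate q (x 0) * s)))) s := by
        intro s hs
        have hs' : (0 : ℝ) < s := hs
        have hne : ∀ c', c' ≠ x 0 → ∫⁻ f,
            {f : Cadlag S | JumpEvent (n + 1) x t f}.indicator 1 (Cadlag.delay (x 0) s f) ∂Q c' =
            (Set.Ioi (t 0 : ℝ)).indicator 1 s *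
              Q c' {f | JumpEvent n (fun k => x (k + 1)) (fun k => t (k + 1)) f} := by
          intro c' hc
          rw [← lintegral_indicator_one (measurableSet_jumpEvent _ _ _), ← lintegral_const_mul _
            (measurable_one.indicator (measurableSet_jumpEvent _ _ _))]
          refine lintegral_congr_ae ?_
          filter_upwards [hQ.ae_start c'] with f hf
          have := jumpEvent_delay_succ (x 0) (s := ⟨s, hs'.le⟩) hs' f (hf ▸ hc) n x t
          have hlt : t 0 < ⟨s, hs'.le⟩ ↔ (t 0 : ℝ) < s := Iff.rfl
          rw [hlt, and_iff_right rfl] at this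
          change JumpEvent (n + 1) x t (Cadlag.delay (x 0) s f) ↔ _ at this
          simp only [Set.indicator, Set.mem_ofPred_eq, Set.mem_Ioi, Pi.one_apply]
          by_cases hj : JumpEvent (n + 1) x t (Cadlag.delay (x 0) s f)
          · rw [if_pos hj, if_pos (this.1 hj).1, if_pos (this.1 hj).2, mul_one]
          · rw [if_neg hj]
            by_cases a : (t 0 : ℝ) < s
            · rw [if_neg fun h => hj (this.2 ⟨a, h⟩), mul_zero]
            · rw [if_neg a, zero_mul]
        -- A path that starts elsewhere than in `x 1` almost surely violates the event for the
        -- shifted sequence.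
        rw [tsum_eq_single (x 1)]
        · by_cases hc : x 1 = x 0
          · simp [hc, hq.diag, Set.indicator]
          · rw [hne _ hc, hih]
            simp only [Set.indicator]
            split_ifs
            · simp only [Pi.one_apply, one_mul]; ring
            · simp
        · intro c' hc'
          by_cases hc : c' = x 0
          · simp [hc, hq.diag]
          rw [hne _ hc]
          have : Q c' {f | JumpEvent n (fun k => x (k + 1)) (fun k => t (k + 1)) f} = 0 := by
            refine measure_mono_null (fun f hf => ?_) (hQ.ae_start c')
            intro h
            have := (hf 0 (by lia)).2.1
            exact hc' (h.symm.trans this)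
          simp [this]
      rw [setLIntegral_congr_fun measurableSet_Ioi key, setLIntegral_indicator measurableSet_Ioi,
        lintegral_const_mul _ (by fun_prop), Set.inter_eq_left.2 (Set.Ioi_subset_Ioi (NNReal.coe_nonneg _)),
        lintegral_exp_neg_mul_Ioi hpos, ← ENNReal.ofReal_mul (hq.nonneg _ _),
        ← ENNReal.ofReal_mul (mul_nonneg (hq.nonneg _ _) hp0), Finset.prod_range_succ' _ n,
        Finset.prod_range_succ' _ (n + 1)]
      congr 1
      rw [hp]
      simp only [zero_add, neg_mul]
      ring

end IsChainFamily

end FirstStep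

/-! ## Delaying a random path by an independent exponential time -/

section StepMeasure

variable {S : Type*} [Countable S]

/-- The image of `e^{-a s} ds ⊗ ν` under `(s, f) ↦ delay c s f`. -/
def stepMeasure (c : S) (a : ℝ) (ν : Measure (Cadlag S)) : Measure (Cadlag S) :=
  (((volume.restrict (Set.Ioi (0 : ℝ))).withDensity
    fun s => ENNReal.ofReal (Real.exp (-(a * s)))).prod ν).map fun p => Cadlag.delay c p.1 p.2

instance (c : S) (a : ℝ) (ν : Measure (Cadlag S)) [SFinite ν] : SFinite (stepMeasure c a ν) := by
  unfold stepMeasure; infer_instance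

theorem measurable_lintegral_delay (c : S) (ν : Measure (Cadlag S)) [SFinite ν]
    {F : Cadlag S → ℝ≥0∞} (hF : Measurable F) :
    Measurable fun s : ℝ => ∫⁻ f, F (Cadlag.delay c s f) ∂ν :=
  Measurable.lintegral_prod_right' (f := fun p : ℝ × Cadlag S => F (Cadlag.delay c p.1 p.2))
    (by fun_prop)

theorem lintegral_stepMeasure (c : S) (a : ℝ) (ν : Measure (Cadlag S)) [SFinite ν]
    {F : Cadlag S → ℝ≥0∞} (hF : Measurable F) :
    ∫⁻ f, F f ∂stepMeasure c a ν = ∫⁻ s in Set.Ioi (0 : ℝ),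
      ENNReal.ofReal (Real.exp (-(a * s))) * ∫⁻ f, F (Cadlag.delay c s f) ∂ν := by
  rw [stepMeasure, lintegral_map hF (by fun_prop), lintegral_prod _ (by fun_prop),
    lintegral_withDensity_eq_lintegral_mul _ (by fun_prop) (measurable_lintegral_delay c ν hF)]
  rfl

/-- The density in `stepMeasure` is not normalised: `ν` is meant to carry the jump rates, and the
result is a probability when `ν` has mass `a`. -/
theorem stepMeasure_univ (c : S) {a : ℝ} (ha : 0 < a) (ν : Measure (Cadlag S)) [SFinite ν] :
    stepMeasure c a ν Set.univ = ENNReal.ofReal a⁻¹ * ν Set.univ := by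
  rw [← lintegral_one, lintegral_stepMeasure c a ν measurable_const]
  simp only [lintegral_one]
  rw [lintegral_mul_const _ (by fun_prop), lintegral_exp_neg_mul_Ioi ha]
  simp

theorem ae_stepMeasure {c : S} {a : ℝ} {ν : Measure (Cadlag S)} [SFinite ν]
    {A : Set (Cadlag S)} (hA : MeasurableSet A)
    (h : ∀ s : ℝ, 0 < s → ∀ᵐ f ∂ν, Cadlag.delay c s f ∈ A) : ∀ᵐ f ∂stepMeasure c a ν, f ∈ A := by
  rw [ae_iff]
  change stepMeasure c a ν Aᶜ = 0
  rw [← lintegral_indicator_one hA.compl,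
    lintegral_stepMeasure c a ν (measurable_one.indicator hA.compl)]
  refine (setLIntegral_congr_fun measurableSet_Ioi fun s hs => ?_).trans lintegral_zero
  have : ∫⁻ f, Aᶜ.indicator (1 : Cadlag S → ℝ≥0∞) (Cadlag.delay c s f) ∂ν = 0 := by
    have hm : Measurable fun f => Aᶜ.indicator (1 : Cadlag S → ℝ≥0∞) (Cadlag.delay c s f) :=
      (measurable_one.indicator hA.compl).comp
        (Cadlag.measurable_delay measurable_const measurable_id)
    rw [lintegral_eq_zero_iff hm]
    filter_upwards [h s hs] with f hf
    simp [hf]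
  simp [this]

end StepMeasure

/-! ## Absorbed paths -/

/-- A path that is absorbed in `0`. -/
def IsAbsorbed (f : Cadlag ℕ) : Prop := ∃ s : ℝ≥0, ∀ t, f t = 0 ↔ s ≤ t

theorem absorptionTime_eq {f : Cadlag ℕ} {s : ℝ≥0} (h : ∀ t, f t = 0 ↔ s ≤ t) :
    absorptionTime f = s := by
  have : {t | f t = 0} = Set.Ici s := by ext t; exact h t
  rw [absorptionTime, this, csInf_Ici]

theorem IsAbsorbed.eq_zero_iff {f : Cadlag ℕ} (hf : IsAbsorbed f) (t : ℝ≥0) :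
    f t = 0 ↔ absorptionTime f ≤ t := by
  obtain ⟨s, hs⟩ := hf
  rw [absorptionTime_eq hs, hs]

theorem isAbsorbed_const_zero : IsAbsorbed (Cadlag.const 0) := ⟨0, by simp⟩

@[simp] theorem absorptionTime_const_zero : absorptionTime (Cadlag.const 0) = 0 :=
  absorptionTime_eq (by simp)

theorem delay_eq_zero_iff {f : Cadlag ℕ} (hf : IsAbsorbed f) (m : ℕ) (s : ℝ≥0) (t : ℝ≥0) :
    Cadlag.delay (m + 1) s f t = 0 ↔ s + absorptionTime f ≤ t := by
  rw [Cadlag.delay_apply, ← NNReal.coe_le_coe]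
  push_cast
  split_ifs with h
  · have := NNReal.coe_nonneg (absorptionTime f)
    simp only [false_iff, not_le]
    linarith
  · rw [hf.eq_zero_iff, ← NNReal.coe_le_coe, Real.coe_toNNReal _ (by linarith)]
    constructor <;> intro <;> linarith

theorem IsAbsorbed.delay {f : Cadlag ℕ} (hf : IsAbsorbed f) (m : ℕ) {s : ℝ} (hs : 0 ≤ s) :
    IsAbsorbed (Cadlag.delay (m + 1) s f) :=
  ⟨_, delay_eq_zero_iff hf m ⟨s, hs⟩⟩

theorem absorptionTime_delay {f : Cadlag ℕ} (hf : IsAbsorbed f) (m : ℕ) {s : ℝ} (hs : 0 ≤ s) :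
    (absorptionTime (Cadlag.delay (m + 1) s f) : ℝ) = s + absorptionTime f := by
  have := absorptionTime_eq (delay_eq_zero_iff hf m ⟨s, hs⟩)
  exact congrArg NNReal.toReal this

theorem measurable_absorptionTime : Measurable fun f : Cadlag ℕ => absorptionTime f := by
  refine measurable_of_Iio fun r => ?_
  -- The second set accounts for paths that never reach `0`, for which the infimum of the empty set
  -- is `0`.
  have : (fun f : Cadlag ℕ => absorptionTime f) ⁻¹' Set.Iio r =
      (⋃ n, {f : Cadlag ℕ | f (TopologicalSpace.denseSeq ℝ≥0 n) = 0} ∩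
        {_f | TopologicalSpace.denseSeq ℝ≥0 n < r}) ∪
      ((⋂ n, {f : Cadlag ℕ | f (TopologicalSpace.denseSeq ℝ≥0 n) = 0}ᶜ) ∩ {_f | 0 < r}) := by
    ext f
    simp only [Set.mem_preimage, Set.mem_Iio, Set.mem_union, Set.mem_iUnion, Set.mem_inter_iff,
      Set.mem_ofPred_eq, Set.mem_iInter, Set.mem_compl_iff]
    have hd := TopologicalSpace.denseRange_denseSeq ℝ≥0
    have hex : ∀ t, f t = 0 → ∀ v, t < v → ∃ n, f (TopologicalSpace.denseSeq ℝ≥0 n) = 0 ∧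
        TopologicalSpace.denseSeq ℝ≥0 n < v := by
      intro t ht v hv
      obtain ⟨u, hu, hc⟩ := f.exists_right_const t
      obtain ⟨_, ⟨n, rfl⟩, h1, h2⟩ := hd.exists_between (lt_min hu hv)
      exact ⟨n, (hc _ h1.le (h2.trans_le (min_le_left _ _))).trans ht,
        h2.trans_le (min_le_right _ _)⟩
    by_cases hne : ∃ t, f t = 0
    · constructor
      · intro h
        left
        obtain ⟨t, ht, htr⟩ := exists_lt_of_csInf_lt hne h
        exact hex t ht r htr
      · rintro (⟨n, h1, h2⟩ | ⟨h1, -⟩)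
        · exact (csInf_le (OrderBot.bddBelow {t | f t = 0}) h1).trans_lt h2
        · obtain ⟨t, ht⟩ := hne
          obtain ⟨n, hn, -⟩ := hex t ht (t + 1) (by simp)
          exact absurd hn (h1 n)
    · have h0 : absorptionTime f = 0 := by
        have : {t | f t = 0} = ∅ := by
          ext t; simpa using fun h => hne ⟨t, h⟩
        rw [absorptionTime, this, NNReal.sInf_empty]
      rw [h0]
      push Not at hne
      simp [hne]
  rw [this]
  have h0 : ∀ n, MeasurableSet {f : Cadlag ℕ | f (TopologicalSpace.denseSeq ℝ≥0 n) = 0} :=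
    fun n => Cadlag.measurableSet_eval _ {0}
  exact (MeasurableSet.iUnion fun n => (h0 n).inter (MeasurableSet.const _)).union
    ((MeasurableSet.iInter fun n => (h0 n).compl).inter (MeasurableSet.const _))

theorem isAbsorbed_iff (f : Cadlag ℕ) : IsAbsorbed f ↔
    (∃ n, f (TopologicalSpace.denseSeq ℝ≥0 n) = 0) ∧ ∀ n m,
      TopologicalSpace.denseSeq ℝ≥0 n ≤ TopologicalSpace.denseSeq ℝ≥0 m →
        f (TopologicalSpace.denseSeq ℝ≥0 n) = 0 → f (TopologicalSpace.denseSeq ℝ≥0 m) = 0 := by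
  have hd := TopologicalSpace.denseRange_denseSeq ℝ≥0
  constructor
  · rintro ⟨s, hs⟩
    simp only [hs]
    obtain ⟨_, ⟨n, rfl⟩, h1, -⟩ := hd.exists_between (show s < s + 1 by simp)
    exact ⟨⟨n, h1.le⟩, fun n m h1 h2 => h2.trans h1⟩
  · rintro ⟨⟨n, hn⟩, hmono⟩
    have hne : {t | f t = 0}.Nonempty := ⟨_, hn⟩
    set s := sInf {t | f t = 0} with hs
    obtain ⟨u, hu, hc⟩ := f.exists_right_const s
    have hfs : f s = 0 := by
      obtain ⟨t, ht, htu⟩ := exists_lt_of_csInf_lt hne hu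
      rw [← hc t (csInf_le (OrderBot.bddBelow _) ht) htu]
      exact ht
    refine ⟨s, fun t => ⟨fun ht => csInf_le (OrderBot.bddBelow _) ht, fun ht => ?_⟩⟩
    rcases ht.eq_or_lt with rfl | ht
    · exact hfs
    · obtain ⟨v, hv, hcv⟩ := f.exists_right_const t
      obtain ⟨_, ⟨k, rfl⟩, h1, h2⟩ := hd.exists_between (lt_min hu ht)
      obtain ⟨_, ⟨l, rfl⟩, h3, h4⟩ := hd.exists_between hv
      rw [← hcv _ h3.le h4]
      refine hmono k l ((h2.trans_le (min_le_right _ _)).trans h3).le ?_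
      rw [hc _ h1.le (h2.trans_le (min_le_left _ _)), hfs]

theorem measurableSet_isAbsorbed : MeasurableSet {f : Cadlag ℕ | IsAbsorbed f} := by
  simp only [isAbsorbed_iff, Set.ofPred_and, Set.ofPred_exists, Set.ofPred_forall]
  have h0 : ∀ n, MeasurableSet {f : Cadlag ℕ | f (TopologicalSpace.denseSeq ℝ≥0 n) = 0} :=
    fun n => Cadlag.measurableSet_eval _ {0}
  refine (MeasurableSet.iUnion h0).inter (MeasurableSet.iInter fun n => MeasurableSet.iInter
    fun m => MeasurableSet.iInter fun _ => ?_)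
  have : {f : Cadlag ℕ | f (TopologicalSpace.denseSeq ℝ≥0 n) = 0 →
      f (TopologicalSpace.denseSeq ℝ≥0 m) = 0} =
      {f : Cadlag ℕ | f (TopologicalSpace.denseSeq ℝ≥0 n) = 0}ᶜ ∪
        {f : Cadlag ℕ | f (TopologicalSpace.denseSeq ℝ≥0 m) = 0} := by
    ext f; simp [imp_iff_not_or]
  rw [this]
  exact (h0 n).compl.union (h0 m)

/-! ## The law of the table chain -/

/-- The law of the table chain from `m`, restricted to the event that it is absorbed at its `K`-th
jump. -/
def tableLawAux (α : ℝ) : ℕ → ℕ → Measure (Cadlag ℕ)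
  | 0, 0 => Measure.dirac (Cadlag.const 0)
  | 0, _ + 1 => 0
  | _ + 1, 0 => 0
  | K + 1, m + 1 => stepMeasure (m + 1) (2 * (m + 1 : ℝ) - α)
      (ENNReal.ofReal (m + 1 - α) • tableLawAux α K (m + 2) +
        ENNReal.ofReal (m + 1) • tableLawAux α K m)

instance (α : ℝ) (K m : ℕ) : SFinite (tableLawAux α K m) := by
  induction K generalizing m with
  | zero => cases m <;> unfold tableLawAux <;> infer_instance
  | succ K ih => cases m <;> unfold tableLawAux <;> infer_instance

/-- The law of the table chain from `m`. -/
def tableLaw (α : ℝ) (m : ℕ) : Measure (Cadlag ℕ) := Measure.sum fun K => tableLawAux α K m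

theorem tableLaw_zero (α : ℝ) : tableLaw α 0 = Measure.dirac (Cadlag.const 0) := by
  refine Measure.ext fun A hA => ?_
  rw [tableLaw, Measure.sum_apply _ hA, tsum_eq_single 0]
  · rfl
  · intro K hK
    obtain ⟨K, rfl⟩ := Nat.exists_eq_succ_of_ne_zero hK
    rfl

/-- Summing the recursion of `tableLawAux` over the number of jumps gives the first-step equation;
no path from `m + 1` is absorbed after zero jumps, so the first term drops out. -/
theorem lintegral_tableLaw_succ (α : ℝ) (m : ℕ) {F : Cadlag ℕ → ℝ≥0∞} (hF : Measurable F) :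
    ∫⁻ f, F f ∂tableLaw α (m + 1) = ∫⁻ s in Set.Ioi (0 : ℝ),
      ENNReal.ofReal (Real.exp (-((2 * (m + 1 : ℝ) - α) * s))) *
        (ENNReal.ofReal (m + 1 - α) * ∫⁻ f, F (Cadlag.delay (m + 1) s f) ∂tableLaw α (m + 2) +
          ENNReal.ofReal (m + 1) * ∫⁻ f, F (Cadlag.delay (m + 1) s f) ∂tableLaw α m) := by
  simp only [tableLaw, lintegral_sum_measure]
  rw [tsum_eq_zero_add' ENNReal.summable]
  have h0 : ∫⁻ f, F f ∂tableLawAux α 0 (m + 1) = 0 := by simp [tableLawAux]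
  have hm := fun K k => measurable_lintegral_delay (m + 1) (tableLawAux α K k) hF
  have h1 : ∀ K, ∫⁻ f, F f ∂tableLawAux α (K + 1) (m + 1) = ∫⁻ s in Set.Ioi (0 : ℝ),
      ENNReal.ofReal (Real.exp (-((2 * (m + 1 : ℝ) - α) * s))) *
        (ENNReal.ofReal (m + 1 - α) * ∫⁻ f, F (Cadlag.delay (m + 1) s f) ∂tableLawAux α K (m + 2) +
          ENNReal.ofReal (m + 1) * ∫⁻ f, F (Cadlag.delay (m + 1) s f) ∂tableLawAux α K m) := by
    intro K
    rw [tableLawAux, lintegral_stepMeasure _ _ _ hF]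
    simp only [lintegral_add_measure, lintegral_smul_measure, smul_eq_mul]
  simp only [h0, zero_add, h1]
  rw [← lintegral_tsum fun K => by fun_prop]
  simp only [ENNReal.tsum_mul_left, ENNReal.tsum_add]

/-- The partial sum is the probability of absorption in fewer than `K` jumps. In the induction the
two jump rates add up to the holding rate. -/
theorem tableLawAux_sum_univ_le {α : ℝ} (hα : α ≤ 1) (K m : ℕ) :
    ∑ k ∈ Finset.range K, tableLawAux α k m Set.univ ≤ 1 := by
  induction K generalizing m with
  | zero => simp
  | succ K ih =>
    rw [Finset.sum_range_succ']
    rcases m with _ | m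
    · simp [tableLawAux]
    · have hpos : (0 : ℝ) < 2 * (m + 1 : ℝ) - α := by
        have : (0 : ℝ) ≤ m := m.cast_nonneg
        linarith
      have hpos' : (0 : ℝ) ≤ m + 1 - α := by
        have : (0 : ℝ) ≤ m := m.cast_nonneg
        linarith
      simp only [tableLawAux, stepMeasure_univ _ hpos, Measure.coe_add, Measure.coe_smul,
        Pi.add_apply, Pi.smul_apply, smul_eq_mul, Measure.coe_zero, Pi.zero_apply, add_zero]
      rw [← Finset.mul_sum, Finset.sum_add_distrib, ← Finset.mul_sum, ← Finset.mul_sum]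
      calc _ ≤ ENNReal.ofReal (2 * (m + 1 : ℝ) - α)⁻¹ *
            (ENNReal.ofReal (m + 1 - α) * 1 + ENNReal.ofReal (m + 1) * 1) := by
            gcongr
            · exact ih _
            · exact ih _
        _ = 1 := by
            rw [mul_one, mul_one, ← ENNReal.ofReal_add hpos' (by positivity),
              ← ENNReal.ofReal_mul (inv_nonneg.2 hpos.le), ENNReal.ofReal_eq_one]
            rw [inv_mul_eq_one₀ hpos.ne']
            ring

theorem tableLaw_univ_le {α : ℝ} (hα : α ≤ 1) (m : ℕ) : tableLaw α m Set.univ ≤ 1 := by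
  rw [tableLaw, Measure.sum_apply _ MeasurableSet.univ, ENNReal.tsum_eq_iSup_nat]
  exact iSup_le fun K => tableLawAux_sum_univ_le hα K m

/-- A bounded non-negative function that vanishes at `0` and is harmonic for the table chain is
zero. -/
theorem eq_zero_of_harmonic {α : ℝ} (hα0 : 0 ≤ α) (hα1 : α ≤ 1) {b : ℕ → ℝ} (h0 : b 0 = 0)
    (hb0 : ∀ m, 0 ≤ b m) (hb1 : ∀ m, b m ≤ 1)
    (h : ∀ m : ℕ, (2 * (m + 1 : ℝ) - α) * b (m + 1) =
      (m + 1 - α) * b (m + 2) + (m + 1) * b m) (m : ℕ) : b m = 0 := by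
  -- In terms of increments, harmonicity says that they are non-negative and non-decreasing, because
  -- `m + 1 - α ≤ m + 1`. A positive increment would then force linear growth, against boundedness.
  have hd : ∀ m : ℕ, (m + 1 - α) * (b (m + 2) - b (m + 1)) = (m + 1) * (b (m + 1) - b m) :=
    fun m => by linarith [h m]
  have hinc : ∀ m : ℕ, 0 ≤ b (m + 1) - b m ∧ b (m + 1) - b m ≤ b (m + 2) - b (m + 1) := by
    intro m
    induction m with
    | zero =>
      have h1 := hd 0
      have hb := hb0 1
      refine ⟨by linarith [hb0 1], ?_⟩
      simp only [Nat.cast_zero, zero_add, h0, one_mul, sub_zero] at h1 ⊢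
      rcases hα1.eq_or_lt with rfl | hα
      · have := hb0 2
        linarith
      · nlinarith
    | succ m ih =>
      refine ⟨ih.1.trans ih.2, ?_⟩
      have h1 := hd (m + 1)
      push_cast at h1
      have hm : (0 : ℝ) ≤ m := m.cast_nonneg
      have hpos : (0 : ℝ) < m + 1 + 1 - α := by linarith
      have hnn := ih.1.trans ih.2
      refine le_of_mul_le_mul_left ?_ hpos
      rw [h1]
      nlinarith
  have hmono : ∀ k n, b (k + 1) - b k ≤ b (k + n + 1) - b (k + n) := by
    intro k n
    induction n with
    | zero => simp
    | succ n ih => exact ih.trans (hinc (k + n)).2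
  have hgrow : ∀ k n : ℕ, n * (b (k + 1) - b k) ≤ b (k + n) := by
    intro k n
    induction n with
    | zero => simpa using hb0 k
    | succ n ih =>
      have := hmono k n
      push_cast
      rw [← add_assoc]
      linarith
  have hzero : ∀ k, b (k + 1) - b k = 0 := by
    intro k
    refine le_antisymm ?_ (hinc k).1
    by_contra! hpos
    obtain ⟨n, hn⟩ := exists_nat_gt (1 / (b (k + 1) - b k))
    rw [div_lt_iff₀ hpos] at hn
    linarith [hgrow k n, hb1 (k + n)]
  induction m with
  | zero => exact h0
  | succ m ih => linarith [hzero m]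

/-- The missing mass is the probability of never being absorbed; the first-step equation makes it
harmonic, so it is zero. -/
theorem tableLaw_univ {α : ℝ} (hα0 : 0 ≤ α) (hα1 : α ≤ 1) (m : ℕ) :
    tableLaw α m Set.univ = 1 := by
  have hle := tableLaw_univ_le hα1
  have hfin : ∀ m, tableLaw α m Set.univ ≠ ⊤ := fun m => ((hle m).trans_lt (by simp)).ne
  have hle' : ∀ m, (tableLaw α m Set.univ).toReal ≤ 1 := fun m => by
    simpa using ENNReal.toReal_mono (by simp) (hle m)
  have key := eq_zero_of_harmonic (b := fun m => 1 - (tableLaw α m Set.univ).toReal) hα0 hα1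
    (by simp [tableLaw_zero]) (fun m => by linarith [hle' m])
    (fun m => by linarith [ENNReal.toReal_nonneg (a := tableLaw α m Set.univ)]) (fun m => by
      have hm0 : (0 : ℝ) ≤ m := m.cast_nonneg
      have hpos : (0 : ℝ) < 2 * (m + 1 : ℝ) - α := by linarith
      have h := lintegral_tableLaw_succ α m (measurable_const (a := (1 : ℝ≥0∞)))
      simp only [lintegral_one] at h
      rw [lintegral_mul_const _ (by fun_prop), lintegral_exp_neg_mul_Ioi hpos] at h
      have h' := congrArg ENNReal.toReal h
      rw [ENNReal.toReal_mul, ENNReal.toReal_add (ENNReal.mul_ne_top (by simp) (hfin _))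
        (ENNReal.mul_ne_top (by simp) (hfin _)), ENNReal.toReal_mul, ENNReal.toReal_mul,
        ENNReal.toReal_ofReal (by positivity), ENNReal.toReal_ofReal (by linarith),
        ENNReal.toReal_ofReal (by positivity)] at h'
      simp only [mul_zero, neg_zero, Real.exp_zero] at h'
      rw [h']
      field_simp
      ring) m
  rw [← ENNReal.toReal_eq_one_iff]
  linarith [key]

theorem isProbabilityMeasure_tableLaw {α : ℝ} (hα0 : 0 ≤ α) (hα1 : α ≤ 1) (m : ℕ) :
    IsProbabilityMeasure (tableLaw α m) := ⟨tableLaw_univ hα0 hα1 m⟩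

/-- Each summand of `tableLaw` is supported by absorbed paths, since delaying in a positive state
preserves absorption. -/
theorem ae_isAbsorbed (α : ℝ) (m : ℕ) : ∀ᵐ f ∂tableLaw α m, IsAbsorbed f := by
  rw [tableLaw, Measure.ae_sum_iff]
  intro K
  induction K generalizing m with
  | zero =>
    cases m with
    | zero => exact (ae_dirac_iff measurableSet_isAbsorbed).2 isAbsorbed_const_zero
    | succ m => simp [tableLawAux]
  | succ K ih =>
    cases m with
    | zero => simp [tableLawAux]
    | succ m =>
      refine ae_stepMeasure measurableSet_isAbsorbed fun s hs => ?_
      have h : ∀ᵐ f ∂(ENNReal.ofReal (m + 1 - α) • tableLawAux α K (m + 2) +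
          ENNReal.ofReal (m + 1) • tableLawAux α K m), IsAbsorbed f :=
        ae_add_measure_iff.2 ⟨Measure.ae_smul_measure (ih _) _, Measure.ae_smul_measure (ih _) _⟩
      filter_upwards [h] with f hf
      exact hf.delay m hs.le

/-! ### The table chain as a chain family -/

theorem tableRate_succ (α : ℝ) (m m' : ℕ) : tableRate α (m + 1) m' =
    (if m' = m + 2 then (m + 1 - α) else 0) + (if m' = m then (m + 1 : ℝ) else 0) := by
  simp only [tableRate, Nat.add_eq_zero_iff, one_ne_zero, and_false, if_false, Nat.cast_add,
    Nat.cast_one, add_left_inj]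
  split_ifs <;> first | lia | simp

theorem hasSum_tableRate (α : ℝ) (m : ℕ) : HasSum (tableRate α (m + 1)) (2 * (m + 1 : ℝ) - α) := by
  have h := (hasSum_ite_eq (m + 2) (m + 1 - α : ℝ)).add (hasSum_ite_eq m (m + 1 : ℝ))
  convert h using 1
  · ext m'; exact tableRate_succ α m m'
  · ring

theorem tableRate_zero (α : ℝ) : tableRate α 0 = 0 := by
  ext m'; simp [tableRate]

theorem isRate_tableRate {α : ℝ} (hα1 : α ≤ 1) : IsRate (tableRate α) where
  nonneg m m' := by
    rcases m with _ | m
    · simp [tableRate_zero]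
    · rw [tableRate_succ]
      have hm0 : (0 : ℝ) ≤ m := m.cast_nonneg
      refine add_nonneg ?_ ?_ <;> split_ifs <;> linarith
  diag m := by simp [tableRate]
  summable m := by
    rcases m with _ | m
    · rw [tableRate_zero]; exact summable_zero
    · exact (hasSum_tableRate α m).summable

theorem tsum_ofReal_tableRate (α : ℝ) (m : ℕ) (φ : ℕ → ℝ≥0∞) :
    ∑' m', ENNReal.ofReal (tableRate α (m + 1) m') * φ m' =
      ENNReal.ofReal (m + 1 - α) * φ (m + 2) + ENNReal.ofReal (m + 1) * φ m := by
  have hm0 : (0 : ℝ) ≤ m := m.cast_nonneg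
  have : ∀ m', ENNReal.ofReal (tableRate α (m + 1) m') * φ m' =
      (if m' = m + 2 then ENNReal.ofReal (m + 1 - α) * φ (m + 2) else 0) +
        (if m' = m then ENNReal.ofReal (m + 1) * φ m else 0) := by
    intro m'
    rw [tableRate_succ]
    split_ifs with h1 h2 h2
    · lia
    · simp [h1]
    · simp [h2]
    · simp
  simp only [this]
  rw [ENNReal.tsum_add, tsum_ite_eq, tsum_ite_eq]

theorem isChainFamily_tableLaw {α : ℝ} (hα0 : 0 ≤ α) (hα1 : α ≤ 1) :
    IsChainFamily (tableRate α) (tableLaw α) where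
  prob := isProbabilityMeasure_tableLaw hα0 hα1
  absorbing m hm := by
    rcases m with _ | m
    · exact tableLaw_zero α
    · rw [totalRate, (hasSum_tableRate α m).tsum_eq] at hm
      have hm0 : (0 : ℝ) ≤ m := m.cast_nonneg
      linarith
  step m hm F hF := by
    rcases m with _ | m
    · simp [totalRate, tableRate_zero] at hm
    · rw [totalRate, (hasSum_tableRate α m).tsum_eq, lintegral_tableLaw_succ α m hF]
      simp only [tsum_ofReal_tableRate]

/-! ## Integration preliminaries -/

section Integration

theorem setLIntegral_Ioo_sub_left (h : ℝ) (f : ℝ → ℝ≥0∞) :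
    ∫⁻ b in Set.Ioo 0 h, f (h - b) = ∫⁻ b in Set.Ioo 0 h, f b := by
  rw [← lintegral_indicator measurableSet_Ioo, ← lintegral_indicator measurableSet_Ioo,
    ← lintegral_sub_left_eq_self _ h]
  congr 1 with b
  simp only [Set.indicator, Set.mem_Ioo, sub_pos, sub_lt_self_iff, sub_sub_cancel]
  simp only [and_comm]

theorem setLIntegral_Ioo_add_left (t h : ℝ) (f : ℝ → ℝ≥0∞) :
    ∫⁻ b in Set.Ioo t (t + h), f b = ∫⁻ b in Set.Ioo 0 h, f (t + b) := by
  rw [← lintegral_indicator measurableSet_Ioo, ← lintegral_indicator measurableSet_Ioo,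
    ← lintegral_add_left_eq_self _ t]
  congr 1 with b
  simp only [Set.indicator, Set.mem_Ioo, lt_add_iff_pos_right, add_lt_add_iff_left]

theorem setLIntegral_Ioi_add_left (t : ℝ) (f : ℝ → ℝ≥0∞) :
    ∫⁻ b in Set.Ioi t, f b = ∫⁻ b in Set.Ioi 0, f (t + b) := by
  rw [← lintegral_indicator measurableSet_Ioi, ← lintegral_indicator measurableSet_Ioi,
    ← lintegral_add_left_eq_self _ t]
  congr 1 with b
  simp only [Set.indicator, Set.mem_Ioi, lt_add_iff_pos_right]

theorem setLIntegral_exp_Ioo {α : ℝ} (hα : 0 ≤ α) {h : ℝ} (hh : 0 ≤ h) :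
    ∫⁻ b in Set.Ioo 0 h, ENNReal.ofReal (α * Real.exp (-(α * b))) =
      ENNReal.ofReal (1 - Real.exp (-(α * h))) := by
  have hint : IntervalIntegrable (fun b => α * Real.exp (-(α * b))) volume 0 h :=
    Continuous.intervalIntegrable (by fun_prop) _ _
  have hderiv : ∀ b ∈ Set.uIcc 0 h,
      HasDerivAt (fun b => -Real.exp (-(α * b))) (α * Real.exp (-(α * b))) b := by
    intro b _
    have h1 : HasDerivAt (fun b : ℝ => -(α * b)) (-α) b := by
      have h2 := ((hasDerivAt_id b).const_mul (-α))
      simp only [mul_one, neg_mul] at h2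
      exact h2
    have h3 := h1.exp.fun_neg
    have h4 : -(Real.exp (-(α * b)) * -α) = α * Real.exp (-(α * b)) := by ring
    rwa [h4] at h3
  rw [setLIntegral_congr Ioo_ae_eq_Ioc, ← ofReal_integral_eq_lintegral_ofReal
    ((intervalIntegrable_iff_integrableOn_Ioc_of_le hh).1 hint)
    (Eventually.of_forall fun b => mul_nonneg hα (Real.exp_pos _).le),
    ← intervalIntegral.integral_of_le hh, intervalIntegral.integral_eq_sub_of_hasDerivAt hderiv hint]
  congr 1
  simp
  ring

/-- Splitting off the first coordinate is what makes the exploration regenerate after its first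
mark. -/
theorem infinitePi_eq_map_cons {X : Type*} [MeasurableSpace X] (μ : ℕ → Measure X)
    [∀ i, IsProbabilityMeasure (μ i)] :
    Measure.infinitePi μ = ((μ 0).prod (Measure.infinitePi fun i => μ (i + 1))).map
      fun p => fun n : ℕ => Nat.casesOn n p.1 p.2 := by
  have hmeas : Measurable fun p : X × (ℕ → X) => fun n : ℕ =>
      (Nat.casesOn n p.1 p.2 : X) := by
    refine measurable_pi_lambda _ fun n => ?_
    cases n with
    | zero => exact measurable_fst
    | succ n => exact (measurable_pi_apply n).comp measurable_snd
  symm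
  refine Measure.eq_infinitePi μ fun s t ht => ?_
  classical
  obtain ⟨n, hn⟩ := s.exists_nat_subset_range
  let t' : ℕ → Set X := fun i => if i ∈ s then t i else Set.univ
  have ht' : ∀ i, MeasurableSet (t' i) := fun i => by
    simp only [t']; split_ifs; exacts [ht i, MeasurableSet.univ]
  have h1 : (fun p : X × (ℕ → X) => fun n : ℕ => (Nat.casesOn n p.1 p.2 : X)) ⁻¹' Set.pi s t =
      t' 0 ×ˢ Set.pi (Finset.range n) fun i => t' (i + 1) := by
    ext p
    simp only [Set.mem_preimage, Set.mem_pi, Finset.mem_coe, Set.mem_prod, Finset.mem_range, t']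
    constructor
    · intro h
      refine ⟨?_, fun i _ => ?_⟩
      · split_ifs with h0
        exacts [h 0 h0, trivial]
      · split_ifs with h0
        exacts [h (i + 1) h0, trivial]
    · rintro ⟨h2, h3⟩ i hi
      cases i with
      | zero => simpa [hi] using h2
      | succ i =>
        have := hn hi
        simp only [Finset.mem_range] at this
        simpa [hi] using h3 i (by lia)
  rw [Measure.map_apply hmeas (MeasurableSet.pi s.countable_toSet fun i _ => ht i), h1,
    Measure.prod_prod, Measure.infinitePi_pi _ fun i _ => ht' (i + 1)]
  have h2 : ∏ i ∈ s, μ i (t i) = ∏ i ∈ Finset.range (n + 1), μ i (t' i) := by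
    rw [← Finset.prod_subset (s₁ := s) (hn.trans (Finset.range_subset_range.2 (by lia)))]
    · exact Finset.prod_congr rfl fun i hi => by simp [t', hi]
    · intro i _ hi
      simp [t', hi]
  rw [h2, Finset.prod_range_succ', mul_comm]

theorem lintegral_infinitePi_eq {X : Type*} [MeasurableSpace X] (μ : ℕ → Measure X)
    [∀ i, IsProbabilityMeasure (μ i)] {F : X → (ℕ → X) → ℝ≥0∞}
    (hF : Measurable fun p : X × (ℕ → X) => F p.1 p.2) :
    ∫⁻ x, F (x 0) (fun i => x (i + 1)) ∂Measure.infinitePi μ =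
      ∫⁻ x, ∫⁻ y, F x y ∂(Measure.infinitePi fun i => μ (i + 1)) ∂μ 0 := by
  have hmeas : Measurable fun p : X × (ℕ → X) => fun n : ℕ =>
      (Nat.casesOn n p.1 p.2 : X) := by
    refine measurable_pi_lambda _ fun n => ?_
    cases n with
    | zero => exact measurable_fst
    | succ n => exact (measurable_pi_apply n).comp measurable_snd
  have hm : Measurable fun x : ℕ → X => F (x 0) fun i => x (i + 1) :=
    hF.comp (f := fun x : ℕ → X => (x 0, fun i => x (i + 1))) (by fun_prop)
  rw [infinitePi_eq_map_cons, lintegral_map hm hmeas]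
  exact lintegral_prod _ hF.aemeasurable

end Integration

/-! ## The children of a table, explored along the contour -/

/-- The path of compositions of a single table. -/
def tablePath (f : Cadlag ℕ) : Cadlag Comp := f.map fun n => if n = 0 then [] else [n.toPNat']

@[fun_prop] theorem measurable_tablePath : Measurable tablePath := Cadlag.measurable_map _

theorem tablePath_apply (f : Cadlag ℕ) (t : ℝ≥0) :
    tablePath f t = if f t = 0 then [] else [(f t).toPNat'] := rfl

theorem tablePath_delay (m : ℕ) (s : ℝ) (f : Cadlag ℕ) :
    tablePath (f.delay (m + 1) s) = (tablePath f).delay [(m + 1).toPNat'] s := by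
  rw [tablePath, Cadlag.map_delay]
  rfl

theorem tablePath_const_zero : tablePath (Cadlag.const 0) = Cadlag.const [] := by
  ext1 t; simp [tablePath_apply]

/-- Inter-arrival times and table paths. -/
abbrev Marks : Type := (ℕ → ℝ≥0∞) × (ℕ → Cadlag ℕ)

/-- The marks after the first one. -/
def Marks.shift (d : Marks) : Marks := (fun i => d.1 (i + 1), fun i => d.2 (i + 1))

@[fun_prop] theorem Marks.measurable_shift : Measurable Marks.shift := by
  unfold Marks.shift; fun_prop

/-- The height of the contour after the first arrival, when it starts from `h`. -/
def nextHeight (h : ℝ) (d : Marks) : ℝ := h - (d.1 0).toReal + absorptionTime (d.2 0)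

/-- Exactly `N` arrivals occur before the contour started from `h` reaches `0`. -/
def Explored : ℕ → ℝ → Marks → Prop
  | 0, h, d => ENNReal.ofReal h < d.1 0
  | N + 1, h, d => d.1 0 < ENNReal.ofReal h ∧ Explored N (nextHeight h d) d.shift

/-- The path of compositions formed by the first `N` tables that the contour started from `h`
meets. -/
def childPath : ℕ → ℝ → Marks → Cadlag Comp
  | 0, _, _ => Cadlag.const []
  | N + 1, h, d => (tablePath (d.2 0)).delay [] (h - (d.1 0).toReal) ++
      childPath N (nextHeight h d) d.shift

@[fun_prop] theorem measurable_nextHeight :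
    Measurable fun p : ℝ × Marks => nextHeight p.1 p.2 := by
  have : Measurable fun p : ℝ × Marks => (absorptionTime (p.2.2 0) : ℝ) :=
    (measurable_absorptionTime.comp
      ((measurable_pi_apply 0).comp (measurable_snd.comp measurable_snd))).coe_nnreal_real
  unfold nextHeight
  fun_prop

theorem measurableSet_explored (N : ℕ) :
    MeasurableSet {p : ℝ × Marks | Explored N p.1 p.2} := by
  induction N with
  | zero => exact measurableSet_lt (by fun_prop) (by fun_prop)
  | succ N ih =>
    have h1 : MeasurableSet {p : ℝ × Marks | p.2.1 0 < ENNReal.ofReal p.1} :=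
      measurableSet_lt (by fun_prop) (by fun_prop)
    have h2 : Measurable fun p : ℝ × Marks => (nextHeight p.1 p.2, p.2.shift) := by fun_prop
    exact h1.inter (h2 ih)

theorem measurable_childPath (N : ℕ) : Measurable fun p : ℝ × Marks => childPath N p.1 p.2 := by
  induction N with
  | zero => exact measurable_const
  | succ N ih =>
    have h2 : Measurable fun p : ℝ × Marks => (nextHeight p.1 p.2, p.2.shift) := by fun_prop
    have h3 := ih.comp h2
    have h4 : Measurable fun p : ℝ × Marks =>
        (tablePath (p.2.2 0)).delay [] (p.1 - (p.2.1 0).toReal) := by fun_prop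
    exact Cadlag.measurable_append h4 h3

/-- The strict inequalities in `Explored` exclude a tie between an arrival and the passage through
`0`, so that the alternatives are disjoint. -/
theorem explored_unique {N M : ℕ} {h : ℝ} {d : Marks} (hN : Explored N h d) (hM : Explored M h d) :
    N = M := by
  induction N generalizing M h d with
  | zero =>
    cases M with
    | zero => rfl
    | succ M => exact absurd hM.1 (lt_asymm hN)
  | succ N ih =>
    cases M with
    | zero => exact absurd hN.1 (lt_asymm hM)
    | succ M => rw [ih hN.2 hM.2]

/-- The joint law of independent inter-arrival times with law `ε` and table paths with law `P`. -/
def marksLaw (ε : Measure ℝ≥0∞) (P : Measure (Cadlag ℕ)) [IsProbabilityMeasure ε]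
    [IsProbabilityMeasure P] : Measure Marks :=
  (Measure.infinitePi fun _ => ε).prod (Measure.infinitePi fun _ => P)

section ChildLaw

variable (ε : Measure ℝ≥0∞) (P : Measure (Cadlag ℕ)) [IsProbabilityMeasure ε]
  [IsProbabilityMeasure P]

instance : IsProbabilityMeasure (marksLaw ε P) := by unfold marksLaw; infer_instance

/-- Regeneration: the shifted marks are independent of the first mark and have the original law. -/
theorem lintegral_marksLaw {F : ℝ≥0∞ → Cadlag ℕ → Marks → ℝ≥0∞}
    (hF : Measurable fun p : ℝ≥0∞ × Cadlag ℕ × Marks => F p.1 p.2.1 p.2.2) :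
    ∫⁻ d, F (d.1 0) (d.2 0) d.shift ∂marksLaw ε P =
      ∫⁻ e, ∫⁻ z, ∫⁻ d, F e z d ∂marksLaw ε P ∂P ∂ε := by
  have h1 : Measurable fun d : Marks => F (d.1 0) (d.2 0) d.shift :=
    hF.comp (f := fun d : Marks => (d.1 0, d.2 0, d.shift)) (by fun_prop)
  rw [marksLaw, lintegral_prod _ h1.aemeasurable]
  have h2 : ∀ e : ℕ → ℝ≥0∞, ∫⁻ z, F (e 0) (z 0) (Marks.shift (e, z))
      ∂(Measure.infinitePi fun _ => P) = ∫⁻ z, ∫⁻ z', F (e 0) z (fun i => e (i + 1), z')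
        ∂(Measure.infinitePi fun _ => P) ∂P := by
    intro e
    exact lintegral_infinitePi_eq (fun _ => P)
      (F := fun z z' => F (e 0) z (fun i => e (i + 1), z'))
      (hF.comp (f := fun p : Cadlag ℕ × (ℕ → Cadlag ℕ) =>
        (e 0, p.1, ((fun i => e (i + 1), p.2) : Marks))) (by fun_prop))
  simp only [h2]
  have h3 : Measurable fun p : ℝ≥0∞ × (ℕ → ℝ≥0∞) =>
      ∫⁻ z, ∫⁻ z', F p.1 z (p.2, z') ∂(Measure.infinitePi fun _ => P) ∂P := by
    refine Measurable.lintegral_prod_right' (f := fun q : (ℝ≥0∞ × (ℕ → ℝ≥0∞)) × Cadlag ℕ =>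
      ∫⁻ z', F q.1.1 q.2 (q.1.2, z') ∂(Measure.infinitePi fun _ => P)) ?_
    refine Measurable.lintegral_prod_right' (f := fun q : ((ℝ≥0∞ × (ℕ → ℝ≥0∞)) × Cadlag ℕ) ×
      (ℕ → Cadlag ℕ) => F q.1.1.1 q.1.2 (q.1.1.2, q.2)) ?_
    exact hF.comp (f := fun q : ((ℝ≥0∞ × (ℕ → ℝ≥0∞)) × Cadlag ℕ) × (ℕ → Cadlag ℕ) =>
      (q.1.1.1, q.1.2, ((q.1.1.2, q.2) : Marks))) (by fun_prop)
  rw [lintegral_infinitePi_eq (fun _ => ε) (F := fun e e' =>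
    ∫⁻ z, ∫⁻ z', F e z (e', z') ∂(Measure.infinitePi fun _ => P) ∂P) h3]
  refine lintegral_congr fun e => ?_
  have h4 : Measurable fun q : ((ℕ → ℝ≥0∞) × Cadlag ℕ) × (ℕ → Cadlag ℕ) =>
      F e q.1.2 (q.1.1, q.2) := hF.comp (f := fun q : ((ℕ → ℝ≥0∞) × Cadlag ℕ) × (ℕ → Cadlag ℕ) =>
      (e, q.1.2, ((q.1.1, q.2) : Marks))) (by fun_prop)
  rw [lintegral_lintegral_swap (Measurable.lintegral_prod_right' h4).aemeasurable]
  refine lintegral_congr fun z => ?_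
  have h5 : Measurable fun d : Marks => F e z d :=
    hF.comp (f := fun d : Marks => (e, z, d)) (by fun_prop)
  rw [lintegral_prod _ h5.aemeasurable]

/-- The law of the path of compositions formed by the tables that the contour started from `h`
meets before it reaches `0`, restricted to the event that there are `N` of them. -/
def childLawAux (N : ℕ) (h : ℝ) : Measure (Cadlag Comp) :=
  ((marksLaw ε P).restrict {d | Explored N h d}).map (childPath N h)

theorem measurableSet_explored_right (N : ℕ) (h : ℝ) : MeasurableSet {d | Explored N h d} :=
  measurable_prodMk_left (x := h) (measurableSet_explored N)

theorem measurable_childPath_right (N : ℕ) (h : ℝ) : Measurable (childPath N h) :=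
  (measurable_childPath N).comp measurable_prodMk_left

theorem lintegral_childLawAux (N : ℕ) (h : ℝ) {F : Cadlag Comp → ℝ≥0∞} (hF : Measurable F) :
    ∫⁻ f, F f ∂childLawAux ε P N h = ∫⁻ d, {d | Explored N h d}.indicator
      (fun d => F (childPath N h d)) d ∂marksLaw ε P := by
  rw [childLawAux, lintegral_map hF (measurable_childPath_right N h),
    lintegral_indicator (measurableSet_explored_right N h)]

theorem measurable_lintegral_childLawAux {β : Type*} [MeasurableSpace β] (N : ℕ)
    {F : β → Cadlag Comp → ℝ≥0∞} (hF : Measurable fun p : β × Cadlag Comp => F p.1 p.2)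
    {h : β → ℝ} (hh : Measurable h) :
    Measurable fun b => ∫⁻ f, F b f ∂childLawAux ε P N (h b) := by
  have h1 : ∀ b, Measurable (F b) := fun b => hF.comp measurable_prodMk_left
  simp only [lintegral_childLawAux ε P N _ (h1 _)]
  have h2 : Measurable fun q : β × Marks => (h q.1, q.2) := by fun_prop
  have h3 : Measurable fun q : β × Marks => F q.1 (childPath N (h q.1) q.2) :=
    hF.comp (measurable_fst.prodMk ((measurable_childPath N).comp h2))
  exact Measurable.lintegral_prod_right' (f := fun q : β × Marks =>
    {q : β × Marks | Explored N (h q.1) q.2}.indicator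
      (fun q => F q.1 (childPath N (h q.1) q.2)) q) (h3.indicator (h2 (measurableSet_explored N)))

theorem lintegral_childLawAux_zero (h : ℝ) {F : Cadlag Comp → ℝ≥0∞} (hF : Measurable F) :
    ∫⁻ f, F f ∂childLawAux ε P 0 h = ε (Set.Ioi (ENNReal.ofReal h)) * F (Cadlag.const []) := by
  have hm := measurableSet_explored_right 0 h
  rw [lintegral_childLawAux ε P 0 h hF, lintegral_indicator hm]
  simp only [childPath, lintegral_const, Measure.restrict_apply MeasurableSet.univ, Set.univ_inter]
  rw [mul_comm]
  congr 1
  have := lintegral_marksLaw ε P (F := fun e _ _ => (Set.Ioi (ENNReal.ofReal h)).indicator 1 e)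
    ((measurable_one.indicator measurableSet_Ioi).comp measurable_fst)
  simp only [lintegral_const, measure_univ, mul_one] at this
  rw [lintegral_indicator_one measurableSet_Ioi] at this
  rw [← this, ← lintegral_indicator_one hm]
  rfl

theorem lintegral_childLawAux_succ (N : ℕ) (h : ℝ) {F : Cadlag Comp → ℝ≥0∞} (hF : Measurable F) :
    ∫⁻ f, F f ∂childLawAux ε P (N + 1) h = ∫⁻ e in Set.Iio (ENNReal.ofReal h), ∫⁻ z,
      ∫⁻ g, F ((tablePath z).delay [] (h - e.toReal) ++ g)
        ∂childLawAux ε P N (h - e.toReal + absorptionTime z) ∂P ∂ε := by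
  have hζ : Measurable fun p : ℝ≥0∞ × Cadlag ℕ × Marks => (absorptionTime p.2.1 : ℝ) :=
    (measurable_absorptionTime.comp (measurable_fst.comp measurable_snd)).coe_nnreal_real
  have h2 : Measurable fun p : ℝ≥0∞ × Cadlag ℕ × Marks =>
      (h - p.1.toReal + absorptionTime p.2.1, p.2.2) := by fun_prop
  have h1 : Measurable fun p : ℝ≥0∞ × Cadlag ℕ × Marks =>
      (Set.Iio (ENNReal.ofReal h)).indicator (fun e => {d | Explored N
        (h - e.toReal + absorptionTime p.2.1) d}.indicator
        (fun d => F ((tablePath p.2.1).delay [] (h - e.toReal) ++ childPath N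
          (h - e.toReal + absorptionTime p.2.1) d)) p.2.2) p.1 := by
    have h3 : Measurable fun p : ℝ≥0∞ × Cadlag ℕ × Marks =>
        F ((tablePath p.2.1).delay [] (h - p.1.toReal) ++ childPath N
          (h - p.1.toReal + absorptionTime p.2.1) p.2.2) :=
      hF.comp (Cadlag.measurable_append (by fun_prop) ((measurable_childPath N).comp h2))
    have h4 := (h3.indicator (h2 (measurableSet_explored N))).indicator
      (measurable_fst (measurableSet_Iio (a := ENNReal.ofReal h)))
    exact h4
  rw [lintegral_childLawAux ε P (N + 1) h hF]
  have h5 := lintegral_marksLaw ε P (F := fun e z d => (Set.Iio (ENNReal.ofReal h)).indicator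
      (fun e => {d | Explored N (h - e.toReal + absorptionTime z) d}.indicator
        (fun d => F ((tablePath z).delay [] (h - e.toReal) ++ childPath N
          (h - e.toReal + absorptionTime z) d)) d) e) h1
  rw [← lintegral_indicator measurableSet_Iio]
  refine Eq.trans (lintegral_congr fun d => ?_) (h5.trans (lintegral_congr fun e => ?_))
  · by_cases h6 : d.1 0 < ENNReal.ofReal h
    · rw [Set.indicator_of_mem (show d.1 0 ∈ Set.Iio _ from h6)]
      by_cases h7 : Explored N (nextHeight h d) d.shift
      · rw [Set.indicator_of_mem (show d ∈ {d | Explored (N + 1) h d} from ⟨h6, h7⟩)]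
        exact (Set.indicator_of_mem (s := {d' | Explored N (nextHeight h d) d'}) h7 fun d' =>
          F ((tablePath (d.2 0)).delay [] (h - (d.1 0).toReal) ++
            childPath N (nextHeight h d) d')).symm
      · rw [Set.indicator_of_notMem (show d ∉ {d | Explored (N + 1) h d} from fun h8 => h7 h8.2)]
        exact (Set.indicator_of_notMem (s := {d' | Explored N (nextHeight h d) d'}) h7 _).symm
    · rw [Set.indicator_of_notMem (show d ∉ {d | Explored (N + 1) h d} from fun h8 => h6 h8.1),
        Set.indicator_of_notMem (show d.1 0 ∉ Set.Iio _ from h6)]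
  · simp only [Set.indicator, Set.mem_Iio]
    split_ifs with he
    · refine lintegral_congr fun z => ?_
      have h6 : Measurable fun g => F ((tablePath z).delay [] (h - e.toReal) ++ g) :=
        hF.comp (Cadlag.measurable_append measurable_const measurable_id)
      rw [lintegral_childLawAux ε P N _ h6]
      rfl
    · simp

end ChildLaw

/-! ## The renewal equation for the children of a table -/

theorem setLIntegral_Ioo_add {t h : ℝ} (ht : 0 ≤ t) (hh : 0 ≤ h) (f : ℝ → ℝ≥0∞) :
    ∫⁻ b in Set.Ioo 0 (t + h), f b =
      (∫⁻ b in Set.Ioo 0 t, f b) + ∫⁻ b in Set.Ioo 0 h, f (t + b) := by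
  rcases hh.eq_or_lt with rfl | hh
  · simp
  rw [← setLIntegral_Ioo_add_left, ← Set.Ioc_union_Ioo_eq_Ioo ht (by linarith),
    lintegral_union measurableSet_Ioo, setLIntegral_congr (Ioo_ae_eq_Ioc (a := 0))]
  rw [Set.disjoint_left]
  exact fun b hb hb' => absurd hb.2 (not_le.2 hb'.1)

/-- Both iterated integrals run over `0 < b < b' < h`. This exchanges the lowest and the highest
birth as outer variable. -/
theorem setLIntegral_triangle {h : ℝ} {K : ℝ → ℝ → ℝ≥0∞}
    (hK : Measurable fun p : ℝ × ℝ => K p.1 p.2) :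
    ∫⁻ b in Set.Ioo 0 h, ∫⁻ b' in Set.Ioo b h, K b b' =
      ∫⁻ b' in Set.Ioo 0 h, ∫⁻ b in Set.Ioo 0 b', K b b' := by
  simp only [← lintegral_indicator measurableSet_Ioo]
  have h1 : ∀ b, (Set.Ioo 0 h).indicator
      (fun b => ∫⁻ b', (Set.Ioo b h).indicator (fun b' => K b b') b') b =
      ∫⁻ b', {p : ℝ × ℝ | 0 < p.1 ∧ p.1 < p.2 ∧ p.2 < h}.indicator (fun p => K p.1 p.2) (b, b') := by
    intro b
    by_cases hb : b ∈ Set.Ioo 0 h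
    · rw [Set.indicator_of_mem hb]
      refine lintegral_congr fun b' => ?_
      simp [Set.indicator, hb.1]
    · rw [Set.indicator_of_notMem hb]
      refine (lintegral_zero).symm.trans (lintegral_congr fun b' => ?_)
      rw [Set.indicator_of_notMem]
      rintro ⟨h1, h2, h3⟩
      exact hb ⟨h1, h2.trans h3⟩
  have h2 : ∀ b', (Set.Ioo 0 h).indicator
      (fun b' => ∫⁻ b, (Set.Ioo 0 b').indicator (fun b => K b b') b) b' =
      ∫⁻ b, {p : ℝ × ℝ | 0 < p.1 ∧ p.1 < p.2 ∧ p.2 < h}.indicator (fun p => K p.1 p.2) (b, b') := by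
    intro b'
    by_cases hb : b' ∈ Set.Ioo 0 h
    · rw [Set.indicator_of_mem hb]
      refine lintegral_congr fun b => ?_
      simp [Set.indicator, hb.2]
    · rw [Set.indicator_of_notMem hb]
      refine (lintegral_zero).symm.trans (lintegral_congr fun b => ?_)
      rw [Set.indicator_of_notMem]
      rintro ⟨h1, h2, h3⟩
      exact hb ⟨h1.trans h2, h3⟩
  simp only [h1, h2]
  refine lintegral_lintegral_swap (Measurable.aemeasurable (hK.indicator ?_))
  exact (measurableSet_lt measurable_const measurable_fst).inter
    ((measurableSet_lt measurable_fst measurable_snd).inter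
      (measurableSet_lt measurable_snd measurable_const))

theorem tsum_sum_antidiagonal (a : ℕ → ℕ → ℝ≥0∞) :
    ∑' N, ∑ p ∈ Finset.HasAntidiagonal.antidiagonal N, a p.1 p.2 = ∑' i, ∑' j, a i j := by
  rw [← ENNReal.tsum_prod,
    ← Finset.HasAntidiagonal.sigmaAntidiagonalEquivProd.tsum_eq fun p : ℕ × ℕ => a p.1 p.2,
    ENNReal.tsum_sigma']
  refine tsum_congr fun N => ?_
  rw [tsum_fintype]
  exact (Finset.sum_coe_sort (Finset.HasAntidiagonal.antidiagonal N) fun p => a p.1 p.2).symm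

/-- `ε` is the law of an inter-arrival time of a Poisson process of rate `α` (infinite if
`α = 0`). -/
def IsInterarrivalLaw (α : ℝ) (ε : Measure ℝ≥0∞) : Prop :=
  ∀ t : ℝ≥0, ε (Set.Ioi (t : ℝ≥0∞)) = ENNReal.ofReal (Real.exp (-(α * t)))

/-- The restriction removes a possible atom at `∞`, present exactly when `α = 0`; then both sides
vanish, and the exponential density formula needs no case distinction. -/
theorem IsInterarrivalLaw.map_toReal {α : ℝ} (hα : 0 ≤ α) {ε : Measure ℝ≥0∞}
    [IsProbabilityMeasure ε] (hε : IsInterarrivalLaw α ε) :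
    (ε.restrict (Set.Iio ⊤)).map ENNReal.toReal = (volume.restrict (Set.Ioi (0 : ℝ))).withDensity
      fun s => ENNReal.ofReal (α * Real.exp (-(α * s))) := by
  refine Measure.ext_of_Iic _ _ fun x => ?_
  rw [Measure.map_apply ENNReal.measurable_toReal measurableSet_Iic,
    Measure.restrict_apply (ENNReal.measurable_toReal measurableSet_Iic),
    withDensity_apply _ measurableSet_Iic, Measure.restrict_restrict measurableSet_Iic]
  rcases lt_or_ge x 0 with hx | hx
  · have h1 : ENNReal.toReal ⁻¹' Set.Iic x = ∅ := by
      ext e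
      simp only [Set.mem_preimage, Set.mem_Iic, Set.mem_empty_iff_false, iff_false, not_le]
      exact hx.trans_le ENNReal.toReal_nonneg
    have h2 : Set.Iic x ∩ Set.Ioi 0 = ∅ := by
      ext e
      simp only [Set.mem_inter_iff, Set.mem_Iic, Set.mem_Ioi, Set.mem_empty_iff_false, iff_false]
      intro h
      linarith
    simp [h1, h2]
  · have h1 : ENNReal.toReal ⁻¹' Set.Iic x ∩ Set.Iio ⊤ = (Set.Ioi (x.toNNReal : ℝ≥0∞))ᶜ := by
      ext e
      simp only [Set.mem_inter_iff, Set.mem_preimage, Set.mem_Iic, Set.mem_Iio, Set.mem_compl_iff,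
        Set.mem_Ioi, not_lt]
      induction e using ENNReal.recTopCoe with
      | top => simp
      | coe e =>
        simp only [ENNReal.coe_toReal, ENNReal.coe_lt_top, and_true, ENNReal.coe_le_coe]
        rw [← NNReal.coe_le_coe, Real.coe_toNNReal _ hx]
    have h2 : Set.Iic x ∩ Set.Ioi 0 = Set.Ioc 0 x := by
      ext e; simp [and_comm]
    rw [h1, h2, prob_compl_eq_one_sub measurableSet_Ioi, hε, ← setLIntegral_congr Ioo_ae_eq_Ioc,
      setLIntegral_exp_Ioo hα hx, ENNReal.ofReal_sub _ (Real.exp_pos _).le, Real.coe_toNNReal _ hx,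
      ENNReal.ofReal_one]

theorem IsInterarrivalLaw.setLIntegral_Iio {α : ℝ} (hα : 0 ≤ α) {ε : Measure ℝ≥0∞}
    [IsProbabilityMeasure ε] (hε : IsInterarrivalLaw α ε) (h : ℝ) {G : ℝ → ℝ≥0∞}
    (hG : Measurable G) :
    ∫⁻ e in Set.Iio (ENNReal.ofReal h), G e.toReal ∂ε =
      ∫⁻ s in Set.Ioo 0 h, ENNReal.ofReal (α * Real.exp (-(α * s))) * G s := by
  have h1 : ∫⁻ e in Set.Iio (ENNReal.ofReal h), G e.toReal ∂ε =
      ∫⁻ e in Set.Iio ⊤, (Set.Iio h).indicator G e.toReal ∂ε := by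
    have : ∀ e : ℝ≥0∞, (Set.Iio h).indicator G e.toReal =
        (ENNReal.toReal ⁻¹' Set.Iio h).indicator (fun e : ℝ≥0∞ => G e.toReal) e := fun e => rfl
    simp only [this]
    rw [lintegral_indicator (ENNReal.measurable_toReal measurableSet_Iio),
      Measure.restrict_restrict (ENNReal.measurable_toReal measurableSet_Iio)]
    congr 2
    ext e
    simp only [Set.mem_Iio, Set.mem_inter_iff, Set.mem_preimage]
    induction e using ENNReal.recTopCoe with
    | top => simp
    | coe e => simp [ENNReal.lt_ofReal_iff_toReal_lt]
  rw [h1, ← lintegral_map (f := (Set.Iio h).indicator G) (hG.indicator measurableSet_Iio)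
    ENNReal.measurable_toReal, hε.map_toReal hα,
    lintegral_withDensity_eq_lintegral_mul _ (by fun_prop) (hG.indicator measurableSet_Iio)]
  have h2 : Set.Ioo 0 h = Set.Iio h ∩ Set.Ioi 0 := by ext; simp [and_comm]
  rw [h2, ← Measure.restrict_restrict measurableSet_Iio, ← lintegral_indicator measurableSet_Iio]
  congr 1 with s
  simp only [Pi.mul_apply, Set.indicator]
  split_ifs <;> simp

section Renewal

variable {α : ℝ} {ε : Measure ℝ≥0∞} {P : Measure (Cadlag ℕ)} [IsProbabilityMeasure ε]
  [IsProbabilityMeasure P]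

theorem measurable_coe_absorptionTime {β : Type*} [MeasurableSpace β] {f : β → Cadlag ℕ}
    (hf : Measurable f) : Measurable fun b => (absorptionTime (f b) : ℝ) :=
  (measurable_absorptionTime.comp hf).coe_nnreal_real

theorem measurable_comp_append {γ : Type*} [MeasurableSpace γ] {F : Cadlag Comp → ℝ≥0∞}
    (hF : Measurable F) {f g : γ → Cadlag Comp} (hf : Measurable f) (hg : Measurable g) :
    Measurable fun c => F (f c ++ g c) := hF.comp (Cadlag.measurable_append hf hg)

theorem lintegral_childLawAux_zero' (hε : IsInterarrivalLaw α ε) {h : ℝ} (hh : 0 ≤ h)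
    {F : Cadlag Comp → ℝ≥0∞} (hF : Measurable F) :
    ∫⁻ f, F f ∂childLawAux ε P 0 h = ENNReal.ofReal (Real.exp (-(α * h))) * F (.const []) := by
  rw [lintegral_childLawAux_zero ε P h hF, ENNReal.ofReal, hε, Real.coe_toNNReal _ hh]

/-- The waiting time `s` until the first arrival is replaced by the height `b = h - s` at which the
arriving table is born. -/
theorem lintegral_childLawAux_succ' (hα : 0 ≤ α) (hε : IsInterarrivalLaw α ε) (N : ℕ) (h : ℝ)
    {F : Cadlag Comp → ℝ≥0∞} (hF : Measurable F) :
    ∫⁻ f, F f ∂childLawAux ε P (N + 1) h = ∫⁻ b in Set.Ioo 0 h,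
      ENNReal.ofReal (α * Real.exp (-(α * (h - b)))) * ∫⁻ z, ∫⁻ g,
        F ((tablePath z).delay [] b ++ g) ∂childLawAux ε P N (b + absorptionTime z) ∂P := by
  rw [lintegral_childLawAux_succ ε P N h hF]
  have hm : Measurable fun s : ℝ => ∫⁻ z, ∫⁻ g, F ((tablePath z).delay [] (h - s) ++ g)
      ∂childLawAux ε P N (h - s + absorptionTime z) ∂P := by
    refine Measurable.lintegral_prod_right' (f := fun p : ℝ × Cadlag ℕ =>
      ∫⁻ g, F ((tablePath p.2).delay [] (h - p.1) ++ g)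
      ∂childLawAux ε P N (h - p.1 + absorptionTime p.2)) ?_
    have := measurable_coe_absorptionTime (measurable_snd (α := ℝ) (β := Cadlag ℕ))
    exact measurable_lintegral_childLawAux ε P N
      (measurable_comp_append hF (by fun_prop) (by fun_prop)) (by fun_prop)
  rw [hε.setLIntegral_Iio hα h hm, ← setLIntegral_Ioo_sub_left]
  simp only [sub_sub_cancel]

/-- The contour moves down continuously, so from `t + h` it passes through `t` before it reaches
`0`. Above `t` it is a copy of the exploration from `h`, and by lack of memory it then starts afresh
from `t`. The antidiagonal distributes the `N` tables over the two stages. -/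
theorem lintegral_childLawAux_add (hα : 0 ≤ α) (hε : IsInterarrivalLaw α ε) (N : ℕ) :
    ∀ {t h : ℝ}, 0 ≤ t → 0 ≤ h → ∀ {F : Cadlag Comp → ℝ≥0∞}, Measurable F →
      ∫⁻ f, F f ∂childLawAux ε P N (t + h) = ∑ p ∈ Finset.HasAntidiagonal.antidiagonal N,
        ∫⁻ f, ∫⁻ g, F (f.delay [] t ++ g) ∂childLawAux ε P p.2 t ∂childLawAux ε P p.1 h := by
  have hmeas : ∀ {F : Cadlag Comp → ℝ≥0∞}, Measurable F → ∀ (j : ℕ) (t : ℝ), Measurable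
      fun f : Cadlag Comp => ∫⁻ g, F (f.delay [] t ++ g) ∂childLawAux ε P j t := fun hF j t =>
    measurable_lintegral_childLawAux ε P j
      (measurable_comp_append hF (by fun_prop) (by fun_prop)) measurable_const
  have hzero : ∀ {F : Cadlag Comp → ℝ≥0∞}, Measurable F → ∀ (j : ℕ) (t : ℝ) {h : ℝ}, 0 ≤ h →
      ∫⁻ f, ∫⁻ g, F (f.delay [] t ++ g) ∂childLawAux ε P j t ∂childLawAux ε P 0 h =
        ENNReal.ofReal (Real.exp (-(α * h))) * ∫⁻ g, F g ∂childLawAux ε P j t := by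
    intro F hF j t h hh
    rw [lintegral_childLawAux_zero' hε hh (hmeas hF j t)]
    simp only [Cadlag.delay_const, Cadlag.nil_append]
  induction N with
  | zero =>
    intro t h ht hh F hF
    rw [Finset.Nat.antidiagonal_zero, Finset.sum_singleton, hzero hF 0 t hh,
      lintegral_childLawAux_zero' hε ht hF, lintegral_childLawAux_zero' hε (by linarith) hF,
      ← mul_assoc, ← ENNReal.ofReal_mul (Real.exp_pos _).le, ← Real.exp_add]
    congr 4
    ring
  | succ N ih =>
    intro t h ht hh F hF
    -- If the first birth height is below `t`, no table arrives above `t`: this is the term with `0`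
    -- in the first slot. Otherwise the induction hypothesis is applied after that birth, with `h`
    -- replaced by the remaining height above `t`.
    rw [Finset.Nat.sum_antidiagonal_succ, hzero hF (N + 1) t hh,
      lintegral_childLawAux_succ' hα hε N _ hF, setLIntegral_Ioo_add ht hh]
    congr 1
    · rw [lintegral_childLawAux_succ' hα hε N _ hF, ← lintegral_const_mul' _ _ ENNReal.ofReal_ne_top]
      refine lintegral_congr fun b => ?_
      rw [← mul_assoc, ← ENNReal.ofReal_mul (Real.exp_pos _).le, mul_left_comm, ← Real.exp_add]
      congr 4
      ring
    · have h1 : ∀ p : ℕ × ℕ, ∫⁻ f, ∫⁻ g, F (f.delay [] t ++ g) ∂childLawAux ε P p.2 t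
          ∂childLawAux ε P (p.1 + 1) h = ∫⁻ b in Set.Ioo 0 h,
          ENNReal.ofReal (α * Real.exp (-(α * (h - b)))) * ∫⁻ z, ∫⁻ f, ∫⁻ g,
            F ((tablePath z).delay [] (t + b) ++ (f.delay [] t ++ g)) ∂childLawAux ε P p.2 t
              ∂childLawAux ε P p.1 (b + absorptionTime z) ∂P := by
        intro p
        rw [lintegral_childLawAux_succ' hα hε p.1 h (hmeas hF p.2 t)]
        refine setLIntegral_congr_fun measurableSet_Ioo fun b hb => ?_
        congr 1
        refine lintegral_congr fun z => lintegral_congr fun f => lintegral_congr fun g => ?_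
        rw [← Cadlag.delay_delay _ _ hb.1.le, ← Cadlag.append_assoc]
        exact congrArg (fun x => F (x ++ g)) (Cadlag.delay_append [] [] t _ f)
      simp only [h1]
      have hm1 : ∀ p : ℕ × ℕ, Measurable fun q : ℝ × Cadlag ℕ => ∫⁻ f, ∫⁻ g,
          F ((tablePath q.2).delay [] (t + q.1) ++ (f.delay [] t ++ g)) ∂childLawAux ε P p.2 t
              ∂childLawAux ε P p.1 (q.1 + absorptionTime q.2) := by
        intro p
        have hζ := measurable_coe_absorptionTime (measurable_snd (α := ℝ) (β := Cadlag ℕ))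
        refine measurable_lintegral_childLawAux ε P p.1 (F := fun (q : ℝ × Cadlag ℕ) f => ∫⁻ g,
          F ((tablePath q.2).delay [] (t + q.1) ++ (f.delay [] t ++ g)) ∂childLawAux ε P p.2 t)
          ?_ (by fun_prop)
        refine measurable_lintegral_childLawAux ε P p.2 (F := fun (q : (ℝ × Cadlag ℕ) × Cadlag Comp)
          g => F ((tablePath q.1.2).delay [] (t + q.1.1) ++ (q.2.delay [] t ++ g)))
          (measurable_comp_append hF (by fun_prop) (by fun_prop)) measurable_const
      have hm2 : ∀ p : ℕ × ℕ, Measurable fun b : ℝ =>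
          ENNReal.ofReal (α * Real.exp (-(α * (h - b)))) * ∫⁻ z, ∫⁻ f, ∫⁻ g,
            F ((tablePath z).delay [] (t + b) ++ (f.delay [] t ++ g)) ∂childLawAux ε P p.2 t
              ∂childLawAux ε P p.1 (b + absorptionTime z) ∂P := fun p =>
        Measurable.mul (by fun_prop) (Measurable.lintegral_prod_right' (hm1 p))
      rw [← lintegral_finsetSum _ fun p _ => hm2 p]
      refine setLIntegral_congr_fun measurableSet_Ioo fun b hb => ?_
      have hm3 : ∀ p : ℕ × ℕ, Measurable fun z : Cadlag ℕ => ∫⁻ f, ∫⁻ g,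
          F ((tablePath z).delay [] (t + b) ++ (f.delay [] t ++ g)) ∂childLawAux ε P p.2 t
              ∂childLawAux ε P p.1 (b + absorptionTime z) :=
        fun p => (hm1 p).comp measurable_prodMk_left
      rw [← Finset.mul_sum, ← lintegral_finsetSum _ fun p _ => hm3 p]
      congr 1
      · congr 5
        ring
      · refine lintegral_congr fun z => ?_
        rw [add_assoc]
        exact ih ht (add_nonneg hb.1.le (NNReal.coe_nonneg _))
          (measurable_comp_append hF measurable_const measurable_id)

variable (ε P) in
/-- The law of the path of compositions formed by the tables that the contour started from `h`
meets before it reaches `0`, restricted to the event that it does reach `0`. -/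
def childLaw (h : ℝ) : Measure (Cadlag Comp) := Measure.sum fun N => childLawAux ε P N h

/-- The mass is the probability of the disjoint union of the events `Explored N`, that is, that the
exploration stops. That this is one comes only with `treeLaw_univ`. -/
theorem childLaw_univ_le (h : ℝ) : childLaw ε P h Set.univ ≤ 1 := by
  rw [childLaw, Measure.sum_apply _ MeasurableSet.univ]
  simp only [childLawAux, Measure.map_apply (measurable_childPath_right _ h) MeasurableSet.univ,
    Set.preimage_univ, Measure.restrict_apply MeasurableSet.univ, Set.univ_inter]
  rw [← measure_iUnion _ fun N => measurableSet_explored_right N h]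
  · exact prob_le_one
  · intro N M hNM
    rw [Function.onFun, Set.disjoint_left]
    exact fun d h1 h2 => hNM (explored_unique h1 h2)

instance (h : ℝ) : IsFiniteMeasure (childLaw ε P h) :=
  ⟨(childLaw_univ_le h).trans_lt ENNReal.one_lt_top⟩

theorem measurable_lintegral_childLaw {β : Type*} [MeasurableSpace β]
    {F : β → Cadlag Comp → ℝ≥0∞} (hF : Measurable fun p : β × Cadlag Comp => F p.1 p.2)
    {h : β → ℝ} (hh : Measurable h) :
    Measurable fun b => ∫⁻ f, F b f ∂childLaw ε P (h b) := by
  simp only [childLaw, lintegral_sum_measure]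
  exact Measurable.tsum fun N => measurable_lintegral_childLawAux ε P N hF hh

theorem lintegral_childLaw (hα : 0 ≤ α) (hε : IsInterarrivalLaw α ε) {h : ℝ} (hh : 0 ≤ h)
    {F : Cadlag Comp → ℝ≥0∞} (hF : Measurable F) :
    ∫⁻ f, F f ∂childLaw ε P h = ENNReal.ofReal (Real.exp (-(α * h))) * F (.const []) +
      ∫⁻ b in Set.Ioo 0 h, ENNReal.ofReal (α * Real.exp (-(α * (h - b)))) * ∫⁻ z, ∫⁻ g,
        F ((tablePath z).delay [] b ++ g) ∂childLaw ε P (b + absorptionTime z) ∂P := by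
  have hm : ∀ N, Measurable fun q : ℝ × Cadlag ℕ => ∫⁻ g,
      F ((tablePath q.2).delay [] q.1 ++ g) ∂childLawAux ε P N (q.1 + absorptionTime q.2) := by
    intro N
    have hζ := measurable_coe_absorptionTime (measurable_snd (α := ℝ) (β := Cadlag ℕ))
    exact measurable_lintegral_childLawAux ε P N
      (measurable_comp_append hF (by fun_prop) (by fun_prop)) (by fun_prop)
  simp only [childLaw, lintegral_sum_measure]
  rw [tsum_eq_zero_add' ENNReal.summable, lintegral_childLawAux_zero' hε hh hF]
  simp only [lintegral_childLawAux_succ' hα hε _ h hF]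
  have hm' : ∀ N, Measurable fun b : ℝ => ENNReal.ofReal (α * Real.exp (-(α * (h - b)))) *
      ∫⁻ z, ∫⁻ g, F ((tablePath z).delay [] b ++ g)
        ∂childLawAux ε P N (b + absorptionTime z) ∂P := fun N =>
    Measurable.mul (by fun_prop) (Measurable.lintegral_prod_right' (hm N))
  rw [← lintegral_tsum fun N => (hm' N).aemeasurable]
  simp only [ENNReal.tsum_mul_left]
  congr 1
  refine lintegral_congr fun b => ?_
  have hm2 : ∀ N, Measurable fun z : Cadlag ℕ => ∫⁻ g,
      F ((tablePath z).delay [] b ++ g) ∂childLawAux ε P N (b + absorptionTime z) :=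
    fun N => (hm N).comp measurable_prodMk_left
  rw [lintegral_tsum fun N => (hm2 N).aemeasurable]

theorem lintegral_childLaw_add (hα : 0 ≤ α) (hε : IsInterarrivalLaw α ε) {t h : ℝ} (ht : 0 ≤ t)
    (hh : 0 ≤ h) {F : Cadlag Comp → ℝ≥0∞} (hF : Measurable F) :
    ∫⁻ f, F f ∂childLaw ε P (t + h) =
      ∫⁻ f, ∫⁻ g, F (f.delay [] t ++ g) ∂childLaw ε P t ∂childLaw ε P h := by
  simp only [childLaw, lintegral_sum_measure]
  simp only [lintegral_childLawAux_add hα hε _ ht hh hF]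
  rw [tsum_sum_antidiagonal fun i j =>
    ∫⁻ f, ∫⁻ g, F (f.delay [] t ++ g) ∂childLawAux ε P j t ∂childLawAux ε P i h]
  refine tsum_congr fun i => ?_
  rw [lintegral_tsum fun j => (measurable_lintegral_childLawAux ε P j
      (measurable_comp_append hF (by fun_prop) (by fun_prop)) measurable_const).aemeasurable]

end Renewal

/-! ## The law of a table with its descendants -/

attribute [fun_prop] measurable_coe_absorptionTime measurable_lintegral_childLaw

@[fun_prop] theorem measurable_lintegral_right {β X : Type*} [MeasurableSpace β]
    [MeasurableSpace X] (ν : Measure X) [SFinite ν] {F : β → X → ℝ≥0∞}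
    (hF : Measurable fun p : β × X => F p.1 p.2) : Measurable fun b => ∫⁻ x, F b x ∂ν :=
  hF.lintegral_prod_right

section TreeLaw

variable {α : ℝ} {ε : Measure ℝ≥0∞} {P Q : Measure (Cadlag ℕ)} [IsProbabilityMeasure ε]
  [IsProbabilityMeasure P]

variable (ε P Q) in
/-- The law of the path of compositions formed by a table with law `Q` and its descendants. -/
def treeLaw : Measure (Cadlag Comp) := Measure.sum fun N =>
  ((Q.prod (marksLaw ε P)).restrict {p | Explored N (absorptionTime p.1) p.2}).map
    fun p => tablePath p.1 ++ childPath N (absorptionTime p.1) p.2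

theorem measurableSet_explored_absorptionTime (N : ℕ) :
    MeasurableSet {p : Cadlag ℕ × Marks | Explored N (absorptionTime p.1) p.2} := by
  have h2 : Measurable fun q : Cadlag ℕ × Marks => ((absorptionTime q.1 : ℝ), q.2) := by fun_prop
  exact h2 (measurableSet_explored N)

theorem measurable_tablePath_append_childPath (N : ℕ) : Measurable fun p : Cadlag ℕ × Marks =>
    tablePath p.1 ++ childPath N (absorptionTime p.1) p.2 := by
  have h2 : Measurable fun q : Cadlag ℕ × Marks => ((absorptionTime q.1 : ℝ), q.2) := by fun_prop
  exact Cadlag.measurable_append (by fun_prop) ((measurable_childPath N).comp h2)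

theorem lintegral_treeLaw {F : Cadlag Comp → ℝ≥0∞} (hF : Measurable F) :
    ∫⁻ f, F f ∂treeLaw ε P Q =
      ∫⁻ z, ∫⁻ g, F (tablePath z ++ g) ∂childLaw ε P (absorptionTime z) ∂Q := by
  simp only [treeLaw, childLaw, lintegral_sum_measure]
  have hm : ∀ N, Measurable fun z : Cadlag ℕ =>
      ∫⁻ g, F (tablePath z ++ g) ∂childLawAux ε P N (absorptionTime z) := fun N =>
    measurable_lintegral_childLawAux ε P N (by fun_prop) (by fun_prop)
  rw [lintegral_tsum fun N => (hm N).aemeasurable]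
  refine tsum_congr fun N => ?_
  have h3 : Measurable fun p : Cadlag ℕ × Marks =>
      F (tablePath p.1 ++ childPath N (absorptionTime p.1) p.2) :=
    hF.comp (measurable_tablePath_append_childPath N)
  rw [lintegral_map hF (measurable_tablePath_append_childPath N),
    ← lintegral_indicator (measurableSet_explored_absorptionTime N),
    lintegral_prod _ (h3.indicator (measurableSet_explored_absorptionTime N)).aemeasurable]
  refine lintegral_congr fun z => ?_
  rw [lintegral_childLawAux ε P N _ (by fun_prop)]
  rfl

theorem treeLaw_univ_le [IsProbabilityMeasure Q] : treeLaw ε P Q Set.univ ≤ 1 := by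
  rw [← lintegral_one, lintegral_treeLaw measurable_const]
  simp only [lintegral_one]
  exact (lintegral_mono fun z => childLaw_univ_le _).trans (by simp)

instance [IsProbabilityMeasure Q] : IsFiniteMeasure (treeLaw ε P Q) := ⟨treeLaw_univ_le.trans_lt ENNReal.one_lt_top⟩

/-- Cut at the birth height `b` of the first table met, the contour from the top of that table
explores first its descendants, which together with it form a tree, and then whatever is born below
`b`. -/
theorem lintegral_childLaw_eq_first (hα : 0 ≤ α) (hε : IsInterarrivalLaw α ε) {h : ℝ} (hh : 0 ≤ h)
    {F : Cadlag Comp → ℝ≥0∞} (hF : Measurable F) :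
    ∫⁻ f, F f ∂childLaw ε P h = ENNReal.ofReal (Real.exp (-(α * h))) * F (.const []) +
      ∫⁻ b in Set.Ioo 0 h, ENNReal.ofReal (α * Real.exp (-(α * (h - b)))) *
        ∫⁻ f, ∫⁻ g, F (f.delay [] b ++ g) ∂childLaw ε P b ∂treeLaw ε P P := by
  rw [lintegral_childLaw hα hε hh hF]
  congr 1
  refine setLIntegral_congr_fun measurableSet_Ioo fun b hb => ?_
  rw [lintegral_treeLaw (by fun_prop)]
  congr 1
  refine lintegral_congr fun z => ?_
  rw [lintegral_childLaw_add hα hε hb.1.le (NNReal.coe_nonneg _) (by fun_prop)]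
  refine lintegral_congr fun f => lintegral_congr fun g => ?_
  rw [← Cadlag.append_assoc]
  exact congrArg (fun x => F (x ++ g)) (Cadlag.delay_append [] [] b _ f).symm

theorem setLIntegral_pow_div_factorial {α : ℝ} (hα : 0 ≤ α) {h : ℝ} (hh : 0 ≤ h) (k : ℕ) :
    ∫⁻ b in Set.Ioo 0 h, ENNReal.ofReal (α * ((α * b) ^ k / k.factorial)) =
      ENNReal.ofReal ((α * h) ^ (k + 1) / (k + 1).factorial) := by
  have hint : IntervalIntegrable (fun b => α * ((α * b) ^ k / k.factorial)) volume 0 h :=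
    Continuous.intervalIntegrable (by fun_prop) _ _
  rw [setLIntegral_congr Ioo_ae_eq_Ioc, ← ofReal_integral_eq_lintegral_ofReal
    ((intervalIntegrable_iff_integrableOn_Ioc_of_le hh).1 hint), ← intervalIntegral.integral_of_le hh]
  · congr 1
    simp only [mul_pow, mul_div_right_comm]
    simp only [intervalIntegral.integral_const_mul, integral_pow, Nat.factorial_succ]
    push_cast
    field_simp
    ring
  · filter_upwards [ae_restrict_mem measurableSet_Ioc] with b hb
    have := hb.1
    positivity

/-- Comparison for solutions of the renewal equation by Picard iteration: the `k`-th iterate bounds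
the excess of `X` over `Y` by `(α * h) ^ k / k!`. Only `X` has to be bounded; used in both
directions it gives uniqueness. -/
theorem renewal_le {α : ℝ} (hα : 0 ≤ α) {C : Measure (Cadlag Comp)} (hC : C Set.univ ≤ 1)
    {X Y : ℝ → (Cadlag Comp → ℝ≥0∞) → ℝ≥0∞}
    (hX : ∀ {h : ℝ}, 0 ≤ h → ∀ {F : Cadlag Comp → ℝ≥0∞}, Measurable F → (∀ f, F f ≤ 1) →
      X h F ≤ 1 ∧ X h F = ENNReal.ofReal (Real.exp (-(α * h))) * F (.const []) +
        ∫⁻ b in Set.Ioo 0 h, ENNReal.ofReal (α * Real.exp (-(α * (h - b)))) *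
          ∫⁻ f, X b (fun g => F (f.delay [] b ++ g)) ∂C)
    (hY : ∀ {h : ℝ}, 0 ≤ h → ∀ {F : Cadlag Comp → ℝ≥0∞}, Measurable F → (∀ f, F f ≤ 1) →
      Y h F = ENNReal.ofReal (Real.exp (-(α * h))) * F (.const []) +
        ∫⁻ b in Set.Ioo 0 h, ENNReal.ofReal (α * Real.exp (-(α * (h - b)))) *
          ∫⁻ f, Y b (fun g => F (f.delay [] b ++ g)) ∂C)
    {h : ℝ} (hh : 0 ≤ h) {F : Cadlag Comp → ℝ≥0∞} (hF : Measurable F) (hF1 : ∀ f, F f ≤ 1) :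
    X h F ≤ Y h F := by
  have key : ∀ k : ℕ, ∀ {h : ℝ}, 0 ≤ h → ∀ {F : Cadlag Comp → ℝ≥0∞}, Measurable F →
      (∀ f, F f ≤ 1) → X h F ≤ Y h F + ENNReal.ofReal ((α * h) ^ k / k.factorial) := by
    intro k
    induction k with
    | zero =>
      intro h hh F hF hF1
      simpa using (hX hh hF hF1).1.trans le_add_self
    | succ k ih =>
      intro h hh F hF hF1
      rw [(hX hh hF hF1).2, hY hh hF hF1, add_assoc, ← setLIntegral_pow_div_factorial hα hh,
        ← lintegral_add_right _ (by fun_prop)]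
      refine add_le_add_right (setLIntegral_mono' measurableSet_Ioo fun b hb => ?_) _
      have hb0 := hb.1.le
      calc _ ≤ ENNReal.ofReal (α * Real.exp (-(α * (h - b)))) *
            ∫⁻ f, (Y b (fun g => F (f.delay [] b ++ g)) +
              ENNReal.ofReal ((α * b) ^ k / k.factorial)) ∂C := by
            gcongr with f
            exact ih hb0 (by fun_prop) fun g => hF1 _
        _ ≤ ENNReal.ofReal (α * Real.exp (-(α * (h - b)))) *
            ((∫⁻ f, Y b (fun g => F (f.delay [] b ++ g)) ∂C) +
              ENNReal.ofReal ((α * b) ^ k / k.factorial)) := by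
            rw [lintegral_add_right _ measurable_const, lintegral_const]
            gcongr
            exact mul_le_of_le_one_right' hC
        _ ≤ _ := by
            rw [mul_add]
            gcongr
            rw [← ENNReal.ofReal_mul (by positivity)]
            refine ENNReal.ofReal_le_ofReal ?_
            have h1 : Real.exp (-(α * (h - b))) ≤ 1 :=
              Real.exp_le_one_iff.2 (neg_nonpos.2 (mul_nonneg hα (by linarith [hb.2])))
            have h2 : α * Real.exp (-(α * (h - b))) ≤ α := mul_le_of_le_one_right hα h1
            exact mul_le_mul_of_nonneg_right h2 (by positivity)
  refine ge_of_tendsto' (x := atTop) (f := fun k : ℕ => Y h F +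
    ENNReal.ofReal ((α * h) ^ k / k.factorial)) ?_ fun k => key k hh hF hF1
  have h1 := ENNReal.tendsto_ofReal (FloorSemiring.tendsto_pow_div_factorial_atTop (α * h))
  simpa using h1.const_add (Y h F)

/-- The lowest child is the last one to be explored, and not directly accessible. The right-hand
side is shown to solve the equation of `lintegral_childLaw_eq_first` too, and uniqueness concludes.
-/
theorem lintegral_childLaw_eq_last (hα : 0 ≤ α) (hε : IsInterarrivalLaw α ε) {h : ℝ} (hh : 0 ≤ h)
    {F : Cadlag Comp → ℝ≥0∞} (hF : Measurable F) (hF1 : ∀ f, F f ≤ 1) :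
    ∫⁻ f, F f ∂childLaw ε P h = ENNReal.ofReal (Real.exp (-(α * h))) * F (.const []) +
      ∫⁻ b in Set.Ioo 0 h, ENNReal.ofReal (α * Real.exp (-(α * b))) *
        ∫⁻ f, ∫⁻ g, F (f.delay [] b ++ g.delay [] b) ∂treeLaw ε P P ∂childLaw ε P (h - b) := by
  set C := treeLaw ε P P with hCdef
  have hC : C Set.univ ≤ 1 := treeLaw_univ_le
  set G : ℝ → (Cadlag Comp → ℝ≥0∞) → ℝ≥0∞ := fun h F =>
    ENNReal.ofReal (Real.exp (-(α * h))) * F (.const []) +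
      ∫⁻ b in Set.Ioo 0 h, ENNReal.ofReal (α * Real.exp (-(α * b))) *
        ∫⁻ f, ∫⁻ g, F (f.delay [] b ++ g.delay [] b) ∂C ∂childLaw ε P (h - b) with hG
  have hG1 : ∀ {h : ℝ}, 0 ≤ h → ∀ {F : Cadlag Comp → ℝ≥0∞}, (∀ f, F f ≤ 1) → G h F ≤ 1 := by
    intro h hh F hF1
    calc G h F ≤ ENNReal.ofReal (Real.exp (-(α * h))) * 1 +
          ∫⁻ b in Set.Ioo 0 h, ENNReal.ofReal (α * Real.exp (-(α * b))) * 1 := by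
          simp only [hG]
          gcongr with b
          · exact hF1 _
          · refine (lintegral_mono (g := 1) fun f => ?_).trans ?_
            · refine (lintegral_mono (g := 1) fun g => hF1 _).trans ?_
              simpa using hC
            · simpa using childLaw_univ_le (ε := ε) (P := P) (h - b)
      _ = 1 := by
          simp only [mul_one]
          rw [setLIntegral_exp_Ioo hα hh, ← ENNReal.ofReal_add (Real.exp_pos _).le]
          · simp
          · simpa using mul_nonneg hα hh
  have hGeq : ∀ {h : ℝ}, 0 ≤ h → ∀ {F : Cadlag Comp → ℝ≥0∞}, Measurable F → (∀ f, F f ≤ 1) →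
      G h F = ENNReal.ofReal (Real.exp (-(α * h))) * F (.const []) +
        ∫⁻ b in Set.Ioo 0 h, ENNReal.ofReal (α * Real.exp (-(α * (h - b)))) *
          ∫⁻ f, G b (fun g => F (f.delay [] b ++ g)) ∂C := by
    intro h hh F hF hF1
    -- `K b b'` is the contribution of a lowest child at `b` and a different, highest one at `b'`.
    -- Both expansions reduce to the integral of `K` over `b < b'` plus the same term for a single
    -- child, of weight `α * exp (-α * h)`.
    set K : ℝ → ℝ → ℝ≥0∞ := fun b b' => ENNReal.ofReal (α * Real.exp (-(α * b))) *
      (ENNReal.ofReal (α * Real.exp (-(α * (h - b')))) * ∫⁻ f, ∫⁻ g, ∫⁻ k,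
        F (f.delay [] b' ++ (g.delay [] b ++ k.delay [] b)) ∂C ∂childLaw ε P (b' - b) ∂C) with hK
    have hKm : Measurable fun p : ℝ × ℝ => K p.1 p.2 := by
      simp only [hK]
      fun_prop
    have hleft : ∀ b ∈ Set.Ioo 0 h, ENNReal.ofReal (α * Real.exp (-(α * b))) *
        ∫⁻ f, ∫⁻ g, F (f.delay [] b ++ g.delay [] b) ∂C ∂childLaw ε P (h - b) =
        ENNReal.ofReal (α * Real.exp (-(α * h))) * (∫⁻ g, F (g.delay [] b) ∂C) +
          ∫⁻ b' in Set.Ioo b h, K b b' := by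
      intro b hb
      rw [lintegral_childLaw_eq_first hα hε (by linarith [hb.2]) (by fun_prop), mul_add, ← mul_assoc,
        ← ENNReal.ofReal_mul (mul_nonneg hα (Real.exp_pos _).le)]
      congr 1
      · simp only [Cadlag.delay_const, Cadlag.nil_append]
        rw [mul_assoc α, ← Real.exp_add]
        congr 5
        ring
      · have h1 := setLIntegral_Ioo_add_left b (h - b) (K b)
        rw [add_sub_cancel] at h1
        rw [h1, ← lintegral_const_mul' _ _ ENNReal.ofReal_ne_top]
        refine setLIntegral_congr_fun measurableSet_Ioo fun b' hb' => ?_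
        simp only [hK]
        rw [add_sub_cancel_left, sub_sub]
        congr 2
        refine lintegral_congr fun f => lintegral_congr fun g => lintegral_congr fun k => ?_
        rw [← Cadlag.append_assoc, ← Cadlag.delay_delay _ _ hb'.1.le]
        exact congrArg (fun x => F (x ++ k.delay [] b)) (Cadlag.delay_append [] [] b _ g)
    have hright : ∀ b ∈ Set.Ioo 0 h, ENNReal.ofReal (α * Real.exp (-(α * (h - b)))) *
          ∫⁻ f, G b (fun g => F (f.delay [] b ++ g)) ∂C =
        ENNReal.ofReal (α * Real.exp (-(α * h))) * (∫⁻ g, F (g.delay [] b) ∂C) +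
          ∫⁻ b' in Set.Ioo 0 b, K b' b := by
      intro b hb
      simp only [hG, Cadlag.append_nil]
      rw [lintegral_add_left (by fun_prop), mul_add, lintegral_const_mul _ (by fun_prop),
        ← mul_assoc, ← ENNReal.ofReal_mul (mul_nonneg hα (Real.exp_pos _).le)]
      congr 1
      · rw [mul_assoc α, ← Real.exp_add]
        congr 4
        ring
      · rw [lintegral_lintegral_swap (Measurable.aemeasurable (by fun_prop)),
          ← lintegral_const_mul' _ _ ENNReal.ofReal_ne_top]
        refine setLIntegral_congr_fun measurableSet_Ioo fun b' hb' => ?_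
        simp only [hK]
        rw [lintegral_const_mul _ (by fun_prop), mul_left_comm]
    simp only [hG] at hright ⊢
    rw [setLIntegral_congr_fun measurableSet_Ioo hleft,
      setLIntegral_congr_fun measurableSet_Ioo hright,
      lintegral_add_left (by fun_prop), lintegral_add_left (by fun_prop), setLIntegral_triangle hKm]
  have hR1 : ∀ {h : ℝ}, 0 ≤ h → ∀ {F : Cadlag Comp → ℝ≥0∞}, Measurable F → (∀ f, F f ≤ 1) →
      ∫⁻ f, F f ∂childLaw ε P h ≤ 1 := fun {h} hh F hF hF1 =>
    (lintegral_mono (g := 1) hF1).trans (by simpa using childLaw_univ_le (ε := ε) (P := P) h)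
  exact le_antisymm
    (renewal_le hα hC (X := fun h F => ∫⁻ f, F f ∂childLaw ε P h) (Y := G)
      (fun hh F hF hF1 => ⟨hR1 hh hF hF1, lintegral_childLaw_eq_first hα hε hh hF⟩)
      (fun hh F hF hF1 => hGeq hh hF hF1) hh hF hF1)
    (renewal_le hα hC (X := G) (Y := fun h F => ∫⁻ f, F f ∂childLaw ε P h)
      (fun hh F hF hF1 => ⟨hG1 hh hF1, hGeq hh hF hF1⟩)
      (fun hh F hF hF1 => lintegral_childLaw_eq_first hα hε hh hF) hh hF hF1)

end TreeLaw

/-! ## First-step analysis of a table with its descendants -/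

theorem setLIntegral_Ioi_triangle {K : ℝ → ℝ → ℝ≥0∞} (hK : Measurable fun p : ℝ × ℝ => K p.1 p.2) :
    ∫⁻ s in Set.Ioi 0, ∫⁻ b in Set.Ioo 0 s, K s b =
      ∫⁻ b in Set.Ioi 0, ∫⁻ s in Set.Ioi b, K s b := by
  simp only [← lintegral_indicator measurableSet_Ioo, ← lintegral_indicator measurableSet_Ioi]
  have h1 : ∀ s, (Set.Ioi 0).indicator
      (fun s => ∫⁻ b, (Set.Ioo 0 s).indicator (fun b => K s b) b) s =
      ∫⁻ b, {p : ℝ × ℝ | 0 < p.2 ∧ p.2 < p.1}.indicator (fun p => K p.1 p.2) (s, b) := by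
    intro s
    by_cases hs : s ∈ Set.Ioi 0
    · rw [Set.indicator_of_mem hs]
      refine lintegral_congr fun b => ?_
      simp [Set.indicator]
    · rw [Set.indicator_of_notMem hs]
      refine (lintegral_zero).symm.trans (lintegral_congr fun b => ?_)
      rw [Set.indicator_of_notMem]
      rintro ⟨h1, h2⟩
      exact hs (h1.trans h2)
  have h2 : ∀ b, (Set.Ioi 0).indicator
      (fun b => ∫⁻ s, (Set.Ioi b).indicator (fun s => K s b) s) b =
      ∫⁻ s, {p : ℝ × ℝ | 0 < p.2 ∧ p.2 < p.1}.indicator (fun p => K p.1 p.2) (s, b) := by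
    intro b
    by_cases hb : b ∈ Set.Ioi 0
    · rw [Set.indicator_of_mem hb]
      refine lintegral_congr fun s => ?_
      rw [Set.mem_Ioi] at hb
      simp [Set.indicator, hb]
    · rw [Set.indicator_of_notMem hb]
      refine (lintegral_zero).symm.trans (lintegral_congr fun s => ?_)
      rw [Set.indicator_of_notMem]
      rintro ⟨h1, h2⟩
      exact hb h1
  simp only [h1, h2]
  refine lintegral_lintegral_swap (Measurable.aemeasurable (hK.indicator ?_))
  exact (measurableSet_lt measurable_const measurable_snd).inter
    (measurableSet_lt measurable_snd measurable_fst)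

theorem measure_eq_of_lintegral_le_one {X : Type*} [MeasurableSpace X] {μ ν : Measure X}
    (h : ∀ F : X → ℝ≥0∞, Measurable F → (∀ x, F x ≤ 1) → ∫⁻ x, F x ∂μ = ∫⁻ x, F x ∂ν) :
    μ = ν := by
  refine Measure.ext fun A hA => ?_
  rw [← lintegral_indicator_one hA, ← lintegral_indicator_one hA]
  refine h _ (measurable_one.indicator hA) fun x => ?_
  exact Set.indicator_le_self' (by simp) x

/-- The law of the concatenation of independent paths. -/
def concatLaw (A B : Measure (Cadlag Comp)) : Measure (Cadlag Comp) :=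
  (A.prod B).map fun p => p.1 ++ p.2

instance (A B : Measure (Cadlag Comp)) [IsFiniteMeasure A] [IsFiniteMeasure B] :
    IsFiniteMeasure (concatLaw A B) := by unfold concatLaw; infer_instance

theorem lintegral_concatLaw (A B : Measure (Cadlag Comp)) [SFinite B]
    {F : Cadlag Comp → ℝ≥0∞} (hF : Measurable F) :
    ∫⁻ f, F f ∂concatLaw A B = ∫⁻ f, ∫⁻ g, F (f ++ g) ∂B ∂A := by
  rw [concatLaw, lintegral_map hF (by fun_prop), lintegral_prod _ (by fun_prop)]

theorem concatLaw_univ (A B : Measure (Cadlag Comp)) [SFinite B] :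
    concatLaw A B Set.univ = A Set.univ * B Set.univ := by
  rw [← lintegral_one, lintegral_concatLaw A B measurable_const]
  simp [mul_comm]

section TreeStep

variable {α : ℝ} {ε : Measure ℝ≥0∞} [IsProbabilityMeasure ε]
  [∀ n, IsProbabilityMeasure (tableLaw α n)]

theorem treeLaw_zero (hα : 0 ≤ α) (hε : IsInterarrivalLaw α ε) :
    treeLaw ε (tableLaw α 1) (tableLaw α 0) = Measure.dirac (.const []) := by
  refine measure_eq_of_lintegral_le_one fun F hF _ => ?_
  rw [lintegral_treeLaw hF, tableLaw_zero, lintegral_dirac' _ (by fun_prop), lintegral_dirac' _ hF,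
    absorptionTime_const_zero, tablePath_const_zero, NNReal.coe_zero,
    lintegral_childLaw_eq_first hα hε le_rfl (by fun_prop)]
  simp

/-- Cutting the exploration at level `s` separates the children born after the delay, which belong
to the tree of the continued table, from those born before it, which are listed afterwards. -/
theorem lintegral_tableLaw_delay (hα : 0 ≤ α) (hε : IsInterarrivalLaw α ε) (n m : ℕ) {s : ℝ}
    (hs : 0 ≤ s) {F : Cadlag Comp → ℝ≥0∞} (hF : Measurable F) :
    ∫⁻ z, ∫⁻ g, F (tablePath (z.delay (n + 1) s) ++ g)
        ∂childLaw ε (tableLaw α 1) (absorptionTime (z.delay (n + 1) s)) ∂tableLaw α m =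
      ∫⁻ f, ∫⁻ g, F (f.delay [(n + 1).toPNat'] s ++ g) ∂childLaw ε (tableLaw α 1) s
        ∂treeLaw ε (tableLaw α 1) (tableLaw α m) := by
  rw [lintegral_treeLaw (by fun_prop)]
  refine lintegral_congr_ae ?_
  filter_upwards [ae_isAbsorbed α m] with z hz
  rw [absorptionTime_delay hz n hs, lintegral_childLaw_add hα hε hs (NNReal.coe_nonneg _)
    (by fun_prop)]
  refine lintegral_congr fun f => lintegral_congr fun g => ?_
  rw [← Cadlag.append_assoc, tablePath_delay, ← Cadlag.delay_append, List.append_nil]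

variable (α ε) in
/-- Rates times laws after the first jump of a table of `n + 1` customers. -/
def tableJumpLaw (n : ℕ) : Measure (Cadlag Comp) :=
  ENNReal.ofReal (n + 1 - α) • treeLaw ε (tableLaw α 1) (tableLaw α (n + 2)) +
    ENNReal.ofReal (n + 1) • treeLaw ε (tableLaw α 1) (tableLaw α n)

theorem lintegral_tableJumpLaw (n : ℕ) (F : Cadlag Comp → ℝ≥0∞) :
    ∫⁻ f, F f ∂tableJumpLaw α ε n =
      ENNReal.ofReal (n + 1 - α) * ∫⁻ f, F f ∂treeLaw ε (tableLaw α 1) (tableLaw α (n + 2)) +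
        ENNReal.ofReal (n + 1) * ∫⁻ f, F f ∂treeLaw ε (tableLaw α 1) (tableLaw α n) := by
  simp only [tableJumpLaw, lintegral_add_measure, lintegral_smul_measure, smul_eq_mul]

theorem lintegral_treeLaw_eq_parent (hα : 0 ≤ α) (hε : IsInterarrivalLaw α ε) (n : ℕ)
    {F : Cadlag Comp → ℝ≥0∞} (hF : Measurable F) :
    ∫⁻ f, F f ∂treeLaw ε (tableLaw α 1) (tableLaw α (n + 1)) = ∫⁻ s in Set.Ioi (0 : ℝ),
      ENNReal.ofReal (Real.exp (-((2 * (n + 1 : ℝ) - α) * s))) *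
        ∫⁻ f, ∫⁻ g, F (f.delay [(n + 1).toPNat'] s ++ g) ∂childLaw ε (tableLaw α 1) s
          ∂tableJumpLaw α ε n := by
  rw [lintegral_treeLaw hF, lintegral_tableLaw_succ α n (by fun_prop)]
  refine setLIntegral_congr_fun measurableSet_Ioi fun s hs => ?_
  simp only [lintegral_tableJumpLaw]
  rw [← lintegral_tableLaw_delay hα hε n (n + 2) (le_of_lt hs) hF,
    ← lintegral_tableLaw_delay hα hε n n (le_of_lt hs) hF]

instance (n : ℕ) : IsFiniteMeasure (tableJumpLaw α ε n) :=
  ⟨by simp [tableJumpLaw, ENNReal.mul_lt_top]⟩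

variable (α ε) in
/-- Rates times laws after the first jump of the path of a table of `n + 1` customers with its
descendants. -/
def treeJumpLaw (n : ℕ) : Measure (Cadlag Comp) :=
  tableJumpLaw α ε n + ENNReal.ofReal α • concatLaw
    (treeLaw ε (tableLaw α 1) (tableLaw α (n + 1))) (treeLaw ε (tableLaw α 1) (tableLaw α 1))

instance (n : ℕ) : IsFiniteMeasure (treeJumpLaw α ε n) := by
  have := measure_lt_top (concatLaw
    (treeLaw ε (tableLaw α 1) (tableLaw α (n + 1))) (treeLaw ε (tableLaw α 1) (tableLaw α 1)))
    Set.univ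
  exact ⟨by simp [treeJumpLaw, ENNReal.mul_lt_top, this]⟩

/-- The jump of the parent, at rate `2 * (n + 1) - α`, competes with its lowest birth, at rate `α`.
If the birth comes first, the parent starts afresh with `n + 1` customers by lack of memory, and the
newborn starts an independent tree to its right. -/
theorem treeLaw_eq_stepMeasure (hα : 0 ≤ α) (hε : IsInterarrivalLaw α ε) (n : ℕ) :
    treeLaw ε (tableLaw α 1) (tableLaw α (n + 1)) =
      stepMeasure [(n + 1).toPNat'] (2 * (n + 1)) (treeJumpLaw α ε n) := by
  refine measure_eq_of_lintegral_le_one fun F hF hF1 => ?_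
  set c : Comp := [(n + 1).toPNat'] with hc
  set C := treeLaw ε (tableLaw α 1) (tableLaw α 1) with hC
  set a : ℝ := 2 * (n + 1) - α with ha
  -- Here `s` is the time of the parent's first jump: either it has no child before `s`, or its
  -- lowest child is born at `b < s`.
  have hlast : ∀ s ∈ Set.Ioi (0 : ℝ), ENNReal.ofReal (Real.exp (-(a * s))) *
      ∫⁻ f, ∫⁻ g, F (f.delay c s ++ g) ∂childLaw ε (tableLaw α 1) s ∂tableJumpLaw α ε n =
      ENNReal.ofReal (Real.exp (-((2 * (n + 1)) * s))) *
        (∫⁻ f, F (f.delay c s) ∂tableJumpLaw α ε n) +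
      ∫⁻ b in Set.Ioo 0 s, ENNReal.ofReal (Real.exp (-(a * s))) *
        (ENNReal.ofReal (α * Real.exp (-(α * b))) *
        ∫⁻ f, ∫⁻ g, ∫⁻ k, F (f.delay c s ++ (g.delay [] b ++ k.delay [] b)) ∂C
          ∂childLaw ε (tableLaw α 1) (s - b) ∂tableJumpLaw α ε n) := by
    intro s hs
    have h1 : ∀ f : Cadlag Comp, ∫⁻ g, F (f.delay c s ++ g) ∂childLaw ε (tableLaw α 1) s =
        ENNReal.ofReal (Real.exp (-(α * s))) * F (f.delay c s) +
        ∫⁻ b in Set.Ioo 0 s, ENNReal.ofReal (α * Real.exp (-(α * b))) *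
        ∫⁻ g, ∫⁻ k, F (f.delay c s ++ (g.delay [] b ++ k.delay [] b)) ∂C
          ∂childLaw ε (tableLaw α 1) (s - b) := by
      intro f
      rw [lintegral_childLaw_eq_last hα hε (le_of_lt hs) (by fun_prop) fun g => hF1 _,
        Cadlag.append_nil]
    simp only [h1]
    rw [lintegral_add_left (by fun_prop), lintegral_const_mul _ (by fun_prop), mul_add, ← mul_assoc,
      ← ENNReal.ofReal_mul (Real.exp_pos _).le, ← Real.exp_add]
    congr 1
    · congr 4
      rw [ha]
      ring
    · rw [lintegral_lintegral_swap (Measurable.aemeasurable (by fun_prop)),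
        ← lintegral_const_mul' _ _ ENNReal.ofReal_ne_top]
      refine lintegral_congr fun b => ?_
      rw [lintegral_const_mul _ (by fun_prop)]
  rw [lintegral_treeLaw_eq_parent hα hε n hF, setLIntegral_congr_fun measurableSet_Ioi hlast,
    lintegral_add_left (by fun_prop), setLIntegral_Ioi_triangle (by fun_prop),
    lintegral_stepMeasure _ _ _ hF]
  simp only [treeJumpLaw, lintegral_add_measure, lintegral_smul_measure, smul_eq_mul, mul_add]
  rw [lintegral_add_left (by fun_prop)]
  congr 1
  refine setLIntegral_congr_fun measurableSet_Ioi fun b hb => ?_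
  -- With `b` fixed, the residual time `s - b` becomes the variable, and
  -- `lintegral_treeLaw_eq_parent` is read backwards to reassemble the tree of the restarted parent.
  rw [setLIntegral_Ioi_add_left, lintegral_concatLaw _ _ (by fun_prop),
    lintegral_treeLaw_eq_parent hα hε n (by fun_prop), ← lintegral_const_mul' _ _ ENNReal.ofReal_ne_top,
    ← lintegral_const_mul' _ _ ENNReal.ofReal_ne_top]
  refine setLIntegral_congr_fun measurableSet_Ioi fun s hs => ?_
  simp only [add_sub_cancel_left]
  rw [← mul_assoc, ← mul_assoc, ← mul_assoc, ← ENNReal.ofReal_mul (by positivity),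
    ← ENNReal.ofReal_mul (by positivity), ← ENNReal.ofReal_mul (by positivity)]
  congr 1
  · congr 1
    rw [mul_left_comm, mul_comm _ α, mul_assoc α, ← Real.exp_add, ← Real.exp_add]
    congr 2
    rw [ha]
    ring
  · refine lintegral_congr fun f => lintegral_congr fun g => lintegral_congr fun k => ?_
    rw [← Cadlag.append_assoc, ← Cadlag.delay_delay _ _ (le_of_lt hs), ← Cadlag.delay_append,
      ← Cadlag.delay_append]
    simp [hc]

/-- Almost surely, only finitely many tables descend from a given one. -/
theorem treeLaw_univ (hα0 : 0 ≤ α) (hα1 : α ≤ 1) (hε : IsInterarrivalLaw α ε) (n : ℕ) :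
    treeLaw ε (tableLaw α 1) (tableLaw α n) Set.univ = 1 := by
  set t : ℕ → ℝ := fun n => (treeLaw ε (tableLaw α 1) (tableLaw α n) Set.univ).toReal with ht
  have ht1 : ∀ n, t n ≤ 1 := fun n => by
    simpa using ENNReal.toReal_mono (by simp)
      (treeLaw_univ_le (ε := ε) (P := tableLaw α 1) (Q := tableLaw α n))
  have ht0 : ∀ n, 0 ≤ t n := fun n => ENNReal.toReal_nonneg
  have hzero : t 0 = 1 := by simp [ht, treeLaw_zero hα0 hε]
  -- The birth term is a product, since after a birth two independent trees have to be finite.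
  have hstep : ∀ n : ℕ, 2 * (n + 1 : ℝ) * t (n + 1) =
      (n + 1 - α) * t (n + 2) + (n + 1) * t n + α * (t (n + 1) * t 1) := by
    intro n
    have hn : (0 : ℝ) ≤ n := n.cast_nonneg
    have h : t (n + 1) = _ := congrArg ENNReal.toReal
      (congrArg (fun ν : Measure (Cadlag Comp) => ν Set.univ) (treeLaw_eq_stepMeasure hα0 hε n))
    rw [stepMeasure_univ _ (by positivity), ENNReal.toReal_mul, treeJumpLaw, tableJumpLaw,
      Measure.add_apply, Measure.add_apply, Measure.smul_apply, Measure.smul_apply,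
      Measure.smul_apply, concatLaw_univ, smul_eq_mul, smul_eq_mul, smul_eq_mul,
      ENNReal.toReal_add (by finiteness) (by finiteness),
      ENNReal.toReal_add (by finiteness) (by finiteness), ENNReal.toReal_mul, ENNReal.toReal_mul,
      ENNReal.toReal_mul, ENNReal.toReal_mul,
        ENNReal.toReal_ofReal (by positivity), ENNReal.toReal_ofReal (by linarith),
        ENNReal.toReal_ofReal (by positivity), ENNReal.toReal_ofReal hα0] at h
    change t (n + 1) = (2 * ((n : ℝ) + 1))⁻¹ *
      ((n + 1 - α) * t (n + 2) + (n + 1) * t n + α * (t (n + 1) * t 1)) at h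
    rw [← mul_inv_cancel_left₀ (show 2 * ((n : ℝ) + 1) ≠ 0 by positivity)
      ((n + 1 - α) * t (n + 2) + (n + 1) * t n + α * (t (n + 1) * t 1)), ← h]
  have hone : t 1 = 1 := by
    by_contra hne
    have hq : t 1 < 1 := lt_of_le_of_ne (ht1 1) hne
    -- For `α = 1` the recursion at `n = 0` reads `2 * t 1 = 1 + t 1 ^ 2`, whose only root is `1`.
    -- For `α < 1`, a value `t 1 < 1` makes `t` decrease at least linearly and hence become
    -- negative.
    rcases hα1.eq_or_lt with rfl | hα
    · have := hstep 0
      simp only [hzero, Nat.cast_zero] at this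
      nlinarith
    · have hd : ∀ n : ℕ, t (n + 1) - t n ≤ -(1 - t 1) := by
        intro n
        induction n with
        | zero => linarith
        | succ n ih =>
          have hn : (0 : ℝ) ≤ n := n.cast_nonneg
          refine le_of_mul_le_mul_left (a := (n + 1 - α : ℝ)) ?_ (by linarith)
          have h1 := mul_le_mul_of_nonneg_left ih (by linarith : (0 : ℝ) ≤ n + 1)
          have h2 : α * (1 - t 1) * t (n + 1) ≤ α * (1 - t 1) * 1 :=
            mul_le_mul_of_nonneg_left (ht1 _) (mul_nonneg hα0 (by linarith))
          have h3 := hstep n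
          linarith
      have hlin : ∀ n : ℕ, t n ≤ 1 - n * (1 - t 1) := by
        intro n
        induction n with
        | zero => simp [hzero]
        | succ n ih =>
          push_cast
          linarith [hd n]
      obtain ⟨n, hn⟩ := exists_nat_gt (1 / (1 - t 1))
      rw [div_lt_iff₀ (by linarith)] at hn
      linarith [hlin n, ht0 n]
  -- Once `t 1 = 1`, the birth term becomes linear and `1 - t` is harmonic for the table chain.
  have := eq_zero_of_harmonic (b := fun n => 1 - t n) hα0 hα1 (by simp [hzero])
    (fun n => by linarith [ht1 n]) (fun n => by linarith [ht0 n])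
    (fun n => by
      have := hstep n
      rw [hone] at this
      linarith) n
  rw [← ENNReal.toReal_eq_one_iff]
  change t n = 1
  linarith

end TreeStep

/-! ## Forests of tables and the up-down ordered Chinese Restaurant Process -/

/-- Two independent exponential clocks: the first of them to ring has rate `a + b`, and by lack of
memory the path whose clock has not rung is still a fresh delayed path. -/
theorem concatLaw_stepMeasure (A B : Measure (Cadlag Comp)) [SFinite A] [SFinite B] (c d : Comp)
    (a b : ℝ) : concatLaw (stepMeasure c a A) (stepMeasure d b B) =
      stepMeasure (c ++ d) (a + b)
        (concatLaw A (stepMeasure d b B) + concatLaw (stepMeasure c a A) B) := by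
  refine measure_eq_of_lintegral_le_one fun F hF _ => ?_
  have : SFinite (concatLaw A (stepMeasure d b B) + concatLaw (stepMeasure c a A) B) := by
    unfold concatLaw; infer_instance
  rw [lintegral_concatLaw _ _ hF, lintegral_stepMeasure _ _ _ (by fun_prop),
    lintegral_stepMeasure _ _ _ hF]
  simp only [lintegral_add_measure, mul_add]
  have hAB : ∀ s : ℝ, ∫⁻ f, ∫⁻ g, F (f.delay c s ++ g) ∂stepMeasure d b B ∂A =
      ∫⁻ t in Set.Ioi 0, ENNReal.ofReal (Real.exp (-(b * t))) *
        ∫⁻ f, ∫⁻ g, F (f.delay c s ++ g.delay d t) ∂B ∂A := by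
    intro s
    have h1 : ∀ f : Cadlag Comp, ∫⁻ g, F (f.delay c s ++ g) ∂stepMeasure d b B =
      ∫⁻ t in Set.Ioi 0, ENNReal.ofReal (Real.exp (-(b * t))) *
        ∫⁻ g, F (f.delay c s ++ g.delay d t) ∂B := fun f =>
      lintegral_stepMeasure _ _ _ (by fun_prop)
    simp only [h1]
    rw [lintegral_lintegral_swap (Measurable.aemeasurable (by fun_prop))]
    refine lintegral_congr fun t => ?_
    rw [lintegral_const_mul _ (by fun_prop)]
  have hsplit : ∀ s ∈ Set.Ioi (0 : ℝ), ENNReal.ofReal (Real.exp (-(a * s))) *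
      ∫⁻ f, ∫⁻ g, F (f.delay c s ++ g) ∂stepMeasure d b B ∂A =
      (∫⁻ t in Set.Ioi s, ENNReal.ofReal (Real.exp (-(a * s))) *
        (ENNReal.ofReal (Real.exp (-(b * t))) *
          ∫⁻ f, ∫⁻ g, F (f.delay c s ++ g.delay d t) ∂B ∂A)) +
      ∫⁻ t in Set.Ioo 0 s, ENNReal.ofReal (Real.exp (-(a * s))) *
        (ENNReal.ofReal (Real.exp (-(b * t))) *
          ∫⁻ f, ∫⁻ g, F (f.delay c s ++ g.delay d t) ∂B ∂A) := by
    intro s hs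
    rw [hAB, ← lintegral_const_mul' _ _ ENNReal.ofReal_ne_top, setLIntegral_congr Ioo_ae_eq_Ioc,
      add_comm, ← lintegral_union measurableSet_Ioi (Set.Ioc_disjoint_Ioi le_rfl),
      Set.Ioc_union_Ioi_eq_Ioi (le_of_lt hs)]
  rw [setLIntegral_congr_fun measurableSet_Ioi hsplit]
  have hm1 : Measurable fun s : ℝ => ∫⁻ t in Set.Ioo 0 s, ENNReal.ofReal (Real.exp (-(a * s))) *
        (ENNReal.ofReal (Real.exp (-(b * t))) *
          ∫⁻ f, ∫⁻ g, F (f.delay c s ++ g.delay d t) ∂B ∂A) := by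
    simp only [← lintegral_indicator measurableSet_Ioo]
    have h2 : Measurable fun p : ℝ × ℝ => ENNReal.ofReal (Real.exp (-(a * p.1))) *
        (ENNReal.ofReal (Real.exp (-(b * p.2))) *
          ∫⁻ f, ∫⁻ g, F (f.delay c p.1 ++ g.delay d p.2) ∂B ∂A) := by fun_prop
    have h3 : MeasurableSet {p : ℝ × ℝ | 0 < p.2 ∧ p.2 < p.1} :=
      (measurableSet_lt measurable_const measurable_snd).inter
        (measurableSet_lt measurable_snd measurable_fst)
    refine measurable_lintegral_right _ ?_
    exact h2.indicator h3
  rw [lintegral_add_right _ hm1, setLIntegral_Ioi_triangle (by fun_prop),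
    lintegral_add_left]
  · congr 1
    · refine setLIntegral_congr_fun measurableSet_Ioi fun s hs => ?_
      rw [setLIntegral_Ioi_add_left, lintegral_concatLaw _ _ (by fun_prop)]
      have h1 : ∀ f : Cadlag Comp, ∫⁻ g, F ((f ++ g).delay (c ++ d) s) ∂stepMeasure d b B =
        ∫⁻ t in Set.Ioi 0, ENNReal.ofReal (Real.exp (-(b * t))) *
          ∫⁻ g, F ((f ++ g.delay d t).delay (c ++ d) s) ∂B := fun f =>
        lintegral_stepMeasure _ _ _ (by fun_prop)
      simp only [h1]
      rw [lintegral_lintegral_swap (Measurable.aemeasurable (by fun_prop)),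
        ← lintegral_const_mul' _ _ ENNReal.ofReal_ne_top]
      refine setLIntegral_congr_fun measurableSet_Ioi fun t ht => ?_
      rw [lintegral_const_mul _ (by fun_prop), ← mul_assoc, ← mul_assoc,
        ← ENNReal.ofReal_mul (Real.exp_pos _).le, ← ENNReal.ofReal_mul (Real.exp_pos _).le,
        ← Real.exp_add, ← Real.exp_add]
      congr 1
      · congr 2
        ring
      · refine lintegral_congr fun f => lintegral_congr fun g => ?_
        rw [Cadlag.delay_append, Cadlag.delay_delay _ _ (le_of_lt ht)]
    · refine setLIntegral_congr_fun measurableSet_Ioi fun t ht => ?_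
      rw [setLIntegral_Ioi_add_left, lintegral_concatLaw _ _ (by fun_prop),
        lintegral_stepMeasure _ _ _ (by fun_prop), ← lintegral_const_mul' _ _ ENNReal.ofReal_ne_top]
      refine setLIntegral_congr_fun measurableSet_Ioi fun s hs => ?_
      rw [← mul_assoc, ← mul_assoc,
        ← ENNReal.ofReal_mul (Real.exp_pos _).le, ← ENNReal.ofReal_mul (Real.exp_pos _).le,
        ← Real.exp_add, ← Real.exp_add]
      congr 1
      · congr 2
        ring
      · refine lintegral_congr fun f => lintegral_congr fun g => ?_
        rw [Cadlag.delay_append, Cadlag.delay_delay _ _ (le_of_lt hs)]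
  · have : SFinite (concatLaw A (stepMeasure d b B)) := by unfold concatLaw; infer_instance
    fun_prop

theorem concatLaw_assoc (A B C : Measure (Cadlag Comp)) [SFinite B] [SFinite C] :
    concatLaw (concatLaw A B) C = concatLaw A (concatLaw B C) := by
  refine measure_eq_of_lintegral_le_one fun F hF _ => ?_
  have : SFinite (concatLaw B C) := by unfold concatLaw; infer_instance
  rw [lintegral_concatLaw _ _ hF, lintegral_concatLaw _ _ hF, lintegral_concatLaw _ _ (by fun_prop)]
  refine lintegral_congr fun f => ?_
  rw [lintegral_concatLaw _ _ (by fun_prop)]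
  simp only [Cadlag.append_assoc]

theorem concatLaw_dirac_nil (A : Measure (Cadlag Comp)) :
    concatLaw A (Measure.dirac (.const [])) = A := by
  refine measure_eq_of_lintegral_le_one fun F hF _ => ?_
  rw [lintegral_concatLaw _ _ hF]
  refine lintegral_congr fun f => ?_
  rw [lintegral_dirac' _ (by fun_prop), Cadlag.append_nil]

theorem dirac_nil_concatLaw (A : Measure (Cadlag Comp)) [SFinite A] :
    concatLaw (Measure.dirac (.const [])) A = A := by
  refine measure_eq_of_lintegral_le_one fun F hF _ => ?_
  rw [lintegral_concatLaw _ _ hF, lintegral_dirac' _ (by fun_prop)]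
  simp only [Cadlag.nil_append]

theorem concatLaw_add_left (A A' B : Measure (Cadlag Comp)) [SFinite B] :
    concatLaw (A + A') B = concatLaw A B + concatLaw A' B := by
  refine measure_eq_of_lintegral_le_one fun F hF _ => ?_
  simp only [lintegral_concatLaw _ _ hF, lintegral_add_measure]

theorem concatLaw_smul_left (r : ℝ≥0∞) (A B : Measure (Cadlag Comp)) [SFinite B] :
    concatLaw (r • A) B = r • concatLaw A B := by
  refine measure_eq_of_lintegral_le_one fun F hF _ => ?_
  simp only [lintegral_concatLaw _ _ hF, lintegral_smul_measure]

/-! ### Moves of the ordered Chinese Restaurant Process and their rates -/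

/-- The sum over all moves from `c`, weighted by their rates, of the values of `φ`. -/
def moveSum (α : ℝ) (φ : Comp → ℝ≥0∞) (c : Comp) : ℝ≥0∞ :=
  ∑ i : Fin c.length, (ENNReal.ofReal ((c.get i : ℕ) - α) * φ (c.set i (c.get i + 1)) +
    ENNReal.ofReal α * φ (c.insertIdx ((i : ℕ) + 1) 1) +
    ENNReal.ofReal (c.get i : ℕ) * φ (leaveTable c i))

theorem one_le_coe_pnat (n : ℕ+) : (1 : ℝ) ≤ (n : ℕ) := by
  exact_mod_cast n.pos

/-- Summing over moves instead of target states absorbs coincidences between targets; non-negativity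
of each individual rate allows `ENNReal.ofReal` to pass through the sums. -/
theorem tsum_ofReal_ocrpRate {α : ℝ} (hα0 : 0 ≤ α) (hα1 : α ≤ 1) (c : Comp) (φ : Comp → ℝ≥0∞) :
    ∑' c', ENNReal.ofReal (ocrpRate α 0 c c') * φ c' = moveSum α φ c := by
  have h0 : ∀ i : Fin c.length, (0 : ℝ) ≤ (c.get i : ℕ) - α := fun i => by
    linarith [one_le_coe_pnat (c.get i)]
  have h1 : ∀ c', ENNReal.ofReal (ocrpRate α 0 c c') * φ c' = ∑ i : Fin c.length,
      ((if c' = c.set i (c.get i + 1) then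
          ENNReal.ofReal ((c.get i : ℕ) - α) * φ (c.set i (c.get i + 1)) else 0) +
        (if c' = c.insertIdx ((i : ℕ) + 1) 1 then
          ENNReal.ofReal α * φ (c.insertIdx ((i : ℕ) + 1) 1) else 0) +
        (if c' = leaveTable c i then
          ENNReal.ofReal (c.get i : ℕ) * φ (leaveTable c i) else 0)) := by
    intro c'
    have h2 : ∀ i : Fin c.length,
        0 ≤ (if c' = c.set i (c.get i + 1) then ((c.get i : ℕ) : ℝ) - α else 0) := fun i => by
      split_ifs
      exacts [h0 i, le_rfl]
    have h3 : ∀ i : Fin c.length, 0 ≤ (if c' = c.insertIdx ((i : ℕ) + 1) 1 then α else 0) :=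
      fun i => by split_ifs <;> simp [hα0]
    have h4 : ∀ i : Fin c.length,
        0 ≤ (if c' = leaveTable c i then ((c.get i : ℕ) : ℝ) else 0) := fun i => by
      split_ifs <;> simp
    rw [ocrpRate, ite_self, zero_add, ENNReal.ofReal_sum_of_nonneg fun i _ =>
      add_nonneg (add_nonneg (h2 i) (h3 i)) (h4 i), Finset.sum_mul]
    refine Finset.sum_congr rfl fun i _ => ?_
    rw [ENNReal.ofReal_add (add_nonneg (h2 i) (h3 i)) (h4 i), ENNReal.ofReal_add (h2 i) (h3 i),
      add_mul, add_mul]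
    congr 1
    · congr 1
      · split_ifs with h
        exacts [by rw [h], by rw [ENNReal.ofReal_zero, zero_mul]]
      · split_ifs with h
        exacts [by rw [h], by rw [ENNReal.ofReal_zero, zero_mul]]
    · split_ifs with h
      exacts [by rw [h], by rw [ENNReal.ofReal_zero, zero_mul]]
  simp only [h1]
  rw [Summable.tsum_finsetSum fun i _ => ENNReal.summable, moveSum]
  refine Finset.sum_congr rfl fun i _ => ?_
  rw [ENNReal.tsum_add, ENNReal.tsum_add, tsum_ite_eq, tsum_ite_eq, tsum_ite_eq]

/-- The number of customers. -/
def customers (c : Comp) : ℕ := (c.map fun n : ℕ+ => (n : ℕ)).sum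

theorem hasSum_ocrpRate (α : ℝ) (c : Comp) : HasSum (ocrpRate α 0 c) (2 * customers c) := by
  have h : HasSum (ocrpRate α 0 c) (∑ i : Fin c.length,
      ((((c.get i : ℕ) : ℝ) - α) + α + ((c.get i : ℕ) : ℝ))) := by
    unfold ocrpRate
    simp only [ite_self, zero_add]
    exact hasSum_sum fun i _ => ((hasSum_ite_eq _ _).add (hasSum_ite_eq _ _)).add (hasSum_ite_eq _ _)
  have h2 : (customers c : ℝ) = ∑ i : Fin c.length, ((c.get i : ℕ) : ℝ) := by
    rw [customers, ← Nat.cast_sum, ← Fin.sum_univ_fun_getElem]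
    rfl
  rw [h2, Finset.mul_sum]
  convert h using 2 with i
  ring

theorem isRate_ocrpRate {α : ℝ} (hα0 : 0 ≤ α) (hα1 : α ≤ 1) : IsRate (ocrpRate α 0) where
  nonneg c c' := by
    unfold ocrpRate
    simp only [ite_self, zero_add]
    refine Finset.sum_nonneg fun i _ => ?_
    have := one_le_coe_pnat (c.get i)
    refine add_nonneg (add_nonneg ?_ ?_) ?_ <;> split_ifs <;> linarith
  diag c := by
    unfold ocrpRate
    simp only [ite_self, zero_add]
    -- No move fixes `c`: each one changes the length or the `i`-th entry. Subtraction in `ℕ+`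
    -- truncates at `1`, so the decrement needs the entry to exceed `1`.
    refine Finset.sum_eq_zero fun i _ => ?_
    rw [if_neg, if_neg, if_neg]
    · simp
    · intro h
      unfold leaveTable at h
      split_ifs at h with hi
      · have h1 := congrArg List.length h
        rw [List.length_eraseIdx_of_lt i.2] at h1
        have := i.2
        lia
      · have h1 := congrArg (fun l => l[(i : ℕ)]?) h
        simp at h1
        have h2 := PNat.sub_add_of_lt (one_lt_iff_ne_one.2 hi)
        simp only [List.get_eq_getElem] at h2
        rw [← h1] at h2
        exact (PNat.lt_add_right _ _).ne' h2
    · intro h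
      have h1 := congrArg List.length h
      rw [List.length_insertIdx_of_le_length i.2] at h1
      lia
    · intro h
      have h1 := congrArg (fun l => l[(i : ℕ)]?) h
      simp at h1
      exact (PNat.lt_add_right _ _).ne h1
  summable c := (hasSum_ocrpRate α c).summable

theorem leaveTable_cons_zero (n : ℕ+) (c : Comp) : leaveTable (n :: c) (0 : Fin (c.length + 1)) =
    if n = 1 then c else (n - 1) :: c := by
  simp [leaveTable]

theorem leaveTable_cons_succ (n : ℕ+) (c : Comp) (i : Fin c.length) :
    leaveTable (n :: c) i.succ = n :: leaveTable c i := by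
  simp only [leaveTable]
  simp
  split_ifs <;> rfl

/-- The split into moves at the first table and moves at the others mirrors the recursion of
`forestJumpLaw`. -/
theorem moveSum_cons (α : ℝ) (φ : Comp → ℝ≥0∞) (n : ℕ+) (c : Comp) :
    moveSum α φ (n :: c) = ENNReal.ofReal ((n : ℕ) - α) * φ ((n + 1) :: c) +
      ENNReal.ofReal α * φ (n :: 1 :: c) +
      ENNReal.ofReal (n : ℕ) * φ (if n = 1 then c else (n - 1) :: c) +
      moveSum α (fun c' => φ (n :: c')) c := by
  rw [moveSum, moveSum]
  simp only [List.length_cons]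
  rw [Fin.sum_univ_succ, leaveTable_cons_zero]
  simp only [leaveTable_cons_succ]
  simp

section Forest

variable {α : ℝ} {ε : Measure ℝ≥0∞} [IsProbabilityMeasure ε]
  [∀ n, IsProbabilityMeasure (tableLaw α n)]

variable (α ε) in
/-- The law of the path of compositions formed by independent tables with their descendants. -/
def forestLaw : Comp → Measure (Cadlag Comp)
  | [] => Measure.dirac (.const [])
  | n :: c => concatLaw (treeLaw ε (tableLaw α 1) (tableLaw α n)) (forestLaw c)

instance (c : Comp) : IsFiniteMeasure (forestLaw α ε c) := by
  induction c with
  | nil => unfold forestLaw; infer_instance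
  | cons n c ih => unfold forestLaw; infer_instance

variable (α ε) in
/-- Rates times laws after the first jump of the path of a forest. -/
def forestJumpLaw : Comp → Measure (Cadlag Comp)
  | [] => 0
  | n :: c => concatLaw (treeJumpLaw α ε n.natPred) (forestLaw α ε c) +
      concatLaw (treeLaw ε (tableLaw α 1) (tableLaw α n)) (forestJumpLaw c)

instance (c : Comp) : IsFiniteMeasure (forestJumpLaw α ε c) := by
  induction c with
  | nil => unfold forestJumpLaw; infer_instance
  | cons n c ih => unfold forestJumpLaw; infer_instance

theorem treeLaw_eq_stepMeasure_natPred (hα : 0 ≤ α) (hε : IsInterarrivalLaw α ε) (n : ℕ+) :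
    treeLaw ε (tableLaw α 1) (tableLaw α n) =
      stepMeasure [n] (2 * (n : ℕ)) (treeJumpLaw α ε n.natPred) := by
  have h := treeLaw_eq_stepMeasure hα hε n.natPred
  have h1 : ((n.natPred : ℕ) : ℝ) + 1 = (n : ℕ) := by exact_mod_cast n.natPred_add_one
  rw [h1, n.natPred_add_one, PNat.coe_toPNat'] at h
  exact h

/-- Rates add under concatenation. The empty forest is excluded because it is absorbing. -/
theorem forestLaw_eq_stepMeasure (hα : 0 ≤ α) (hε : IsInterarrivalLaw α ε) (n : ℕ+) (c : Comp) :
    forestLaw α ε (n :: c) = stepMeasure (n :: c) (2 * customers (n :: c))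
      (forestJumpLaw α ε (n :: c)) := by
  induction c generalizing n with
  | nil =>
    have : concatLaw (treeLaw ε (tableLaw α 1) (tableLaw α n)) 0 = 0 := by
      simp [concatLaw]
    simp only [forestLaw, forestJumpLaw, concatLaw_dirac_nil, this, add_zero]
    rw [treeLaw_eq_stepMeasure_natPred hα hε]
    simp [customers]
  | cons m c ih =>
    rw [forestLaw, forestJumpLaw, ih, treeLaw_eq_stepMeasure_natPred hα hε, concatLaw_stepMeasure]
    congr 1
    simp [customers]
    ring

/-- Growth and decline replace the first tree; a birth splits it in two, and associativity turns the
result into the forest of `n :: 1 :: c`. The function `F` is general since the induction for the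
tail uses its average over the first tree. -/
theorem lintegral_forestJumpLaw (hα : 0 ≤ α) (hε : IsInterarrivalLaw α ε) (c : Comp)
    {F : Cadlag Comp → ℝ≥0∞} (hF : Measurable F) :
    ∫⁻ f, F f ∂forestJumpLaw α ε c = moveSum α (fun c' => ∫⁻ f, F f ∂forestLaw α ε c') c := by
  induction c generalizing F with
  | nil => simp [forestJumpLaw, moveSum]
  | cons n c ih =>
    have hn : ((n.natPred : ℕ) : ℝ) + 1 = (n : ℕ) := by exact_mod_cast n.natPred_add_one
    have hn1 : n.natPred + 1 = n := n.natPred_add_one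
    rw [moveSum_cons, forestJumpLaw, lintegral_add_measure, treeJumpLaw, tableJumpLaw,
      concatLaw_add_left, concatLaw_add_left, concatLaw_smul_left, concatLaw_smul_left,
      concatLaw_smul_left, concatLaw_assoc, hn, hn1]
    simp only [lintegral_add_measure, lintegral_smul_measure, smul_eq_mul]
    congr 1
    · rw [add_right_comm]
      congr 1
      · congr 1
        · congr 2
          rw [forestLaw, PNat.add_coe, PNat.one_coe, ← hn1]
      · congr 2
        -- A table that loses its only customer leaves the tree of an empty table, which is the
        -- constant empty path and disappears from the concatenation.
        split_ifs with h
        · subst h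
          rw [show PNat.natPred 1 = 0 from rfl, treeLaw_zero hα hε, dirac_nil_concatLaw]
        · rw [forestLaw]
          congr 3
          rw [PNat.sub_coe, if_pos (one_lt_iff_ne_one.2 h)]
          rfl
    · rw [lintegral_concatLaw _ _ hF, lintegral_lintegral_swap (Measurable.aemeasurable
        (by fun_prop)), ih (by fun_prop)]
      congr 1
      ext c'
      rw [forestLaw, lintegral_concatLaw _ _ hF, lintegral_lintegral_swap (Measurable.aemeasurable
        (by fun_prop))]

theorem isChainFamily_forestLaw (hα0 : 0 ≤ α) (hα1 : α ≤ 1) (hε : IsInterarrivalLaw α ε) :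
    IsChainFamily (ocrpRate α 0) (forestLaw α ε) where
  prob c := by
    refine ⟨?_⟩
    induction c with
    | nil => simp [forestLaw]
    | cons n c ih => rw [forestLaw, concatLaw_univ, treeLaw_univ hα0 hα1 hε, ih, one_mul]
  absorbing c hc := by
    rcases c with _ | ⟨n, c⟩
    · rfl
    · rw [totalRate, (hasSum_ocrpRate α _).tsum_eq] at hc
      have h : customers (n :: c) = 0 := by exact_mod_cast (mul_eq_zero_iff_left two_ne_zero).1 hc
      simp [customers] at h
  step c hc F hF := by
    rcases c with _ | ⟨n, c⟩
    · rw [totalRate, (hasSum_ocrpRate α _).tsum_eq] at hc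
      simp [customers] at hc
    · rw [totalRate, (hasSum_ocrpRate α _).tsum_eq, forestLaw_eq_stepMeasure hα0 hε,
        lintegral_stepMeasure _ _ _ hF]
      refine lintegral_congr fun s => ?_
      rw [lintegral_forestJumpLaw hα0 hε _ (by fun_prop), tsum_ofReal_ocrpRate hα0 hα1]

end Forest

/-! ## Random càdlàg paths -/

section RandomPath

variable {Ω S : Type*} [MeasurableSpace Ω] [Countable S] {μ : Measure Ω}

theorem exists_cadlag_modification (x₀ : S) {Y : ℝ≥0 → Ω → S}
    (hm : ∀ t x, MeasurableSet {ω | Y t ω = x}) (hc : ∀ᵐ ω ∂μ, IsCadlagPath fun t => Y t ω) :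
    ∃ Y' : Ω → Cadlag S, Measurable Y' ∧ ∀ᵐ ω ∂μ, (Y' ω).toFun = fun t => Y t ω := by
  classical
  -- The exceptional set is not known to be measurable, so the path is altered on a measurable null
  -- set containing it.
  set N := toMeasurable μ {ω | ¬ IsCadlagPath fun t => Y t ω} with hN
  have hN0 : μ N = 0 := by rw [hN, measure_toMeasurable]; exact hc
  have hNc : ∀ ω, ω ∉ N → IsCadlagPath fun t => Y t ω := fun ω hω => by
    by_contra h
    exact hω (subset_toMeasurable _ _ h)
  refine ⟨fun ω => if h : ω ∈ N then .const x₀ else ⟨_, hNc ω h⟩, ?_, ?_⟩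
  · refine Cadlag.measurable_of_eval fun t x => ?_
    have : {ω | (if h : ω ∈ N then Cadlag.const x₀ else ⟨_, hNc ω h⟩ : Cadlag S) t = x} =
        (N ∩ {_ω | x₀ = x}) ∪ (Nᶜ ∩ {ω | Y t ω = x}) := by
      ext ω
      by_cases h : ω ∈ N <;> simp [h]
    rw [this]
    have hNm : MeasurableSet N := measurableSet_toMeasurable _ _
    exact (hNm.inter (MeasurableSet.const _)).union (hNm.compl.inter (hm t x))
  · filter_upwards [measure_eq_zero_iff_ae_notMem.1 hN0] with ω hω
    simp [hω]

theorem IsMarkovChain.measure_jumpEvent {q : S → S → ℝ} {c : S} {Y : ℝ≥0 → Ω → S}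
    (hY : IsMarkovChain q c Y μ) {Y' : Ω → Cadlag S} (hY' : Measurable Y')
    (h : ∀ᵐ ω ∂μ, (Y' ω).toFun = fun t => Y t ω) (n : ℕ) (x : ℕ → S) (t : ℕ → ℝ≥0)
    (hx : x 0 = c) : μ.map Y' {f | JumpEvent n x t f} =
      ENNReal.ofReal ((∏ k ∈ Finset.range n, q (x k) (x (k + 1)) / totalRate q (x k)) *
        ∏ k ∈ Finset.range (n + 1), Real.exp (-totalRate q (x k) * t k)) := by
  rw [Measure.map_apply hY' (measurableSet_jumpEvent n x t), ← hY.law n x t hx]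
  refine measure_congr ?_
  filter_upwards [h] with ω hω
  change JumpEvent n x t (Y' ω).toFun = JumpEvent n x t fun t => Y t ω
  rw [hω]

theorem IsMarkovChain.map_eq [IsProbabilityMeasure μ] {q : S → S → ℝ} {Q : S → Measure (Cadlag S)}
    (hq : IsRate q) (hQ : IsChainFamily q Q) {c : S} {Y : ℝ≥0 → Ω → S}
    (hY : IsMarkovChain q c Y μ) {Y' : Ω → Cadlag S} (hY' : Measurable Y')
    (h : ∀ᵐ ω ∂μ, (Y' ω).toFun = fun t => Y t ω) : μ.map Y' = Q c := by
  have := hQ.prob c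
  have := Measure.isProbabilityMeasure_map (μ := μ) hY'.aemeasurable
  refine measure_eq_of_jumpEvent ?_ (hQ.ae_start c) fun n x t hx => ?_
  · have hms : MeasurableSet {f : Cadlag S | f 0 = c} := Cadlag.measurableSet_eval 0 {c}
    refine (ae_map_iff hY'.aemeasurable hms).2 ?_
    filter_upwards [h, hY.start] with ω hω h0
    rw [hω]
    exact h0
  · rw [hY.measure_jumpEvent hY' h n x t hx, ← hx, hQ.measure_jumpEvent_eq hq]

theorem isMarkovChain_of_map_eq {q : S → S → ℝ} {Q : S → Measure (Cadlag S)}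
    (hq : IsRate q) (hQ : IsChainFamily q Q) {c : S} {Y : ℝ≥0 → Ω → S}
    {Y' : Ω → Cadlag S} (hY' : Measurable Y') (h : ∀ᵐ ω ∂μ, (Y' ω).toFun = fun t => Y t ω)
    (hlaw : μ.map Y' = Q c) : IsMarkovChain q c Y μ where
  measurable t x := by
    have hm : MeasurableSet {ω | Y' ω t = x} := hY' (Cadlag.measurableSet_eval t {x})
    refine hm.nullMeasurableSet.congr ?_
    filter_upwards [h] with ω hω
    change ((Y' ω).toFun t = x) = (Y t ω = x)
    rw [hω]
  cadlag := by
    filter_upwards [h] with ω hω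
    exact hω ▸ (Y' ω).isCadlagPath
  law n x t hx := by
    rw [← hQ.measure_jumpEvent_eq hq, hx, ← hlaw,
      Measure.map_apply hY' (measurableSet_jumpEvent n x t)]
    refine measure_congr ?_
    filter_upwards [h] with ω hω
    change JumpEvent n x t (fun t => Y t ω) = JumpEvent n x t (Y' ω).toFun
    rw [hω]
  start := by
    have hms : MeasurableSet {f : Cadlag S | f 0 = c} := Cadlag.measurableSet_eval 0 {c}
    have h1 := (ae_map_iff hY'.aemeasurable hms).1 (hlaw ▸ hQ.ae_start c)
    filter_upwards [h, h1] with ω hω h0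
    rw [← h0, hω]

/-- A random càdlàg path carries no more information than its coordinates, so independence of
coordinate processes passes to random elements of path space. -/
theorem measurable_comap_toFun {Ω' : Type*} {m : MeasurableSpace S} [MeasurableSingletonClass S]
    (Y : Ω' → Cadlag S) :
    Measurable[MeasurableSpace.comap (fun ω t => Y ω t) MeasurableSpace.pi] Y := by
  refine @Cadlag.measurable_of_eval _ _ _ (MeasurableSpace.comap _ _) _ fun t x => ?_
  exact ⟨{g | g t = x}, measurable_pi_apply (X := fun _ => S) t (measurableSet_singleton x), rfl⟩

theorem iIndepFun_cadlag {ι : Type*} {m : MeasurableSpace S} [MeasurableSingletonClass S]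
    {Y : ι → ℝ≥0 → Ω → S} {Y' : ι → Ω → Cadlag S}
    (h : ∀ i, ∀ᵐ ω ∂μ, (Y' i ω).toFun = fun t => Y i t ω)
    (hind : iIndepFun (fun i ω t => Y i t ω) μ) : iIndepFun Y' μ := by
  have h1 : iIndepFun (fun i ω t => Y' i ω t) μ := hind.congr fun i => by
    filter_upwards [h i] with ω hω
    exact hω.symm
  rw [iIndepFun_iff_iIndep] at h1 ⊢
  exact iIndep_of_iIndep_of_le h1 fun i => (measurable_comap_toFun (Y' i)).comap_le

theorem indepFun_cadlag {ι : Type*} [Countable ι] {m : MeasurableSpace S}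
    [MeasurableSingletonClass S] {Y : ι → ℝ≥0 → Ω → S} {Y' : ι → Ω → Cadlag S}
    (h : ∀ i, ∀ᵐ ω ∂μ, (Y' i ω).toFun = fun t => Y i t ω)
    {J : ℝ≥0 → Ω → S} {J' : Ω → Cadlag S} (hJ : ∀ᵐ ω ∂μ, (J' ω).toFun = fun t => J t ω)
    (hind : IndepFun (fun ω i t => Y i t ω) (fun ω t => J t ω) μ) :
    IndepFun (fun ω i => Y' i ω) J' μ := by
  have h1 : IndepFun (fun ω i t => Y' i ω t) (fun ω t => J' ω t) μ := by
    refine hind.congr ?_ ?_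
    · filter_upwards [ae_all_iff.2 h] with ω hω
      exact funext fun i => (hω i).symm
    · filter_upwards [hJ] with ω hω
      exact hω.symm
  refine indep_of_indep_of_le h1 ?_ (measurable_comap_toFun J').comap_le
  refine Measurable.comap_le ?_
  refine @measurable_pi_lambda _ _ _ (MeasurableSpace.comap _ _) _ _ fun i => ?_
  refine @Cadlag.measurable_of_eval _ _ _ (MeasurableSpace.comap _ _) _ fun t x => ?_
  refine ⟨{g | g i t = x}, ?_, rfl⟩
  have h2 : Measurable fun g : ι → ℝ≥0 → S => g i t := by fun_prop
  exact h2 (measurableSet_singleton x)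

end RandomPath

/-! ## Inter-arrival times -/

/-- The time between the `k`-th and the `k + 1`-st jump of a path, infinite if the former does not
occur. -/
def interarrival (j : ℝ≥0 → ℕ) (k : ℕ) : ℝ≥0∞ :=
  if jumpTime j k = ⊤ then ⊤ else holdingTime j k

theorem measurable_interarrival (k : ℕ) : Measurable fun f : Cadlag ℕ => interarrival f k :=
  Measurable.ite (measurable_jumpTime k (measurableSet_singleton ⊤)) measurable_const
    (measurable_holdingTime k)

/-- The law of the paths of a Poisson process of rate `α`. -/
def IsPoissonLaw (α : ℝ) (ν : Measure (Cadlag ℕ)) : Prop :=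
  ∀ (n : ℕ) (x : ℕ → ℕ) (t : ℕ → ℝ≥0), x 0 = 0 → ν {f : Cadlag ℕ | JumpEvent n x t f} =
    ENNReal.ofReal ((∏ k ∈ Finset.range n, poissonRate α (x k) (x (k + 1)) /
      totalRate (poissonRate α) (x k)) *
      ∏ k ∈ Finset.range (n + 1), Real.exp (-totalRate (poissonRate α) (x k) * t k))

section Poisson

variable {α : ℝ} {ν : Measure (Cadlag ℕ)}

theorem totalRate_poissonRate (α : ℝ) (m : ℕ) : totalRate (poissonRate α) m = α := by
  simp [totalRate, poissonRate]

theorem IsPoissonLaw.measure_of_ne_zero (hα : α ≠ 0) (hν : IsPoissonLaw α ν) (n : ℕ)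
    (t : ℕ → ℝ≥0) : ν {f : Cadlag ℕ | JumpEvent n id t f} =
      ∏ k ∈ Finset.range (n + 1), ENNReal.ofReal (Real.exp (-(α * t k))) := by
  rw [hν n id t rfl, ← ENNReal.ofReal_prod_of_nonneg fun _ _ => (Real.exp_pos _).le]
  simp [totalRate_poissonRate, poissonRate, hα]

theorem IsPoissonLaw.measure_zero (hν : IsPoissonLaw α ν) (t : ℕ → ℝ≥0) :
    ν {f : Cadlag ℕ | JumpEvent 0 id t f} = ENNReal.ofReal (Real.exp (-(α * t 0))) := by
  rw [hν 0 id t rfl]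
  simp [totalRate_poissonRate]

variable [IsProbabilityMeasure ν]

theorem IsPoissonLaw.ae_jumpTime_lt_top (hα : α ≠ 0) (hν : IsPoissonLaw α ν) :
    ∀ᵐ f : Cadlag ℕ ∂ν, ∀ k, jumpTime f k < ⊤ ∧ jumpState f k = k := by
  refine ae_all_iff.2 fun n => ?_
  have h : ∀ᵐ f : Cadlag ℕ ∂ν, JumpEvent n id 0 f := by
    refine (mem_ae_iff_prob_eq_one (measurableSet_jumpEvent n id 0)).2 ?_
    rw [hν.measure_of_ne_zero hα]
    simp
  filter_upwards [h] with f hf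
  exact ⟨(hf n le_rfl).1, (hf n le_rfl).2.1⟩

theorem IsPoissonLaw.ae_jumpTime_eq_top (hν : IsPoissonLaw 0 ν) :
    ∀ᵐ f : Cadlag ℕ ∂ν, f 0 = 0 ∧ ∀ k, jumpTime f (k + 1) = ⊤ := by
  have h : ∀ᵐ f : Cadlag ℕ ∂ν, ∀ r : ℕ, JumpEvent 0 id (fun _ => r) f := by
    refine ae_all_iff.2 fun r =>
      (mem_ae_iff_prob_eq_one (measurableSet_jumpEvent 0 id fun _ => (r : ℝ≥0))).2 ?_
    rw [hν.measure_zero]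
    simp
  filter_upwards [h] with f hf
  refine ⟨?_, fun k => ?_⟩
  · simpa [jumpState, jumpTime_zero] using (hf 0 0 le_rfl).2.1
  · refine eq_top_mono (jumpTime_mono f (show 1 ≤ k + 1 by lia)) ?_
    refine ENNReal.eq_top_of_forall_nnreal_le fun r => ?_
    obtain ⟨n, hn⟩ := exists_nat_ge r
    have h1 := (hf n 0 le_rfl).2.2
    rw [holdingTime, jumpTime_zero, tsub_zero] at h1
    exact (ENNReal.coe_le_coe.2 hn).trans h1.le

theorem IsPoissonLaw.ae_jumpState (hν : IsPoissonLaw α ν) :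
    ∀ᵐ f : Cadlag ℕ ∂ν, ∀ k, jumpTime f k < ⊤ → jumpState f k = k := by
  by_cases hα : α = 0
  · subst hα
    filter_upwards [hν.ae_jumpTime_eq_top] with f hf k hk
    rcases k with _ | k
    · simpa [jumpState, jumpTime_zero] using hf.1
    · exact absurd (hf.2 k) hk.ne
  · filter_upwards [hν.ae_jumpTime_lt_top hα] with f hf k _
    exact (hf k).2

/-- For `α = 0` the process almost surely never jumps, and the value `∞` for times after a jump that
does not occur keeps the product formula valid. -/
theorem IsPoissonLaw.measure_lt_interarrival (hν : IsPoissonLaw α ν) (n : ℕ) (t : ℕ → ℝ≥0) :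
    ν {f : Cadlag ℕ | ∀ k ≤ n, (t k : ℝ≥0∞) < interarrival f k} =
      ∏ k ∈ Finset.range (n + 1), ENNReal.ofReal (Real.exp (-(α * t k))) := by
  by_cases hα : α = 0
  · subst hα
    have h : ∀ᵐ f : Cadlag ℕ ∂ν, ∀ k ≤ n, (t k : ℝ≥0∞) < interarrival f k := by
      filter_upwards [hν.ae_jumpTime_eq_top] with f hf k _
      have : interarrival f k = ⊤ := by
        rcases k with _ | k
        · simp [interarrival, holdingTime, jumpTime_zero, hf.2 0]
        · simp [interarrival, hf.2 k]
      rw [this]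
      exact ENNReal.coe_lt_top
    simpa using measure_congr (eventuallyEq_univ.2 h)
  · rw [← hν.measure_of_ne_zero hα]
    refine measure_congr ?_
    filter_upwards [hν.ae_jumpTime_lt_top hα] with f hf
    refine propext (forall₂_congr fun k _ => ?_)
    simp [interarrival, (hf k).1.ne, (hf k).1, (hf k).2]

/-- Indices outside `s` receive the threshold `0`, which is harmless because inter-arrival times are
almost surely positive. -/
theorem IsPoissonLaw.measure_lt_interarrival_finset (hν : IsPoissonLaw α ν) (s : Finset ℕ)
    (t : ℕ → ℝ≥0) : ν {f : Cadlag ℕ | ∀ k ∈ s, (t k : ℝ≥0∞) < interarrival f k} =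
      ∏ k ∈ s, ENNReal.ofReal (Real.exp (-(α * t k))) := by
  classical
  obtain ⟨n, hn⟩ := s.exists_nat_subset_range
  have hpos : ∀ᵐ f : Cadlag ℕ ∂ν, ∀ k ≤ n, 0 < interarrival f k := by
    have hms : MeasurableSet {f : Cadlag ℕ | ∀ k ≤ n, 0 < interarrival f k} := by
      simp only [Set.ofPred_forall]
      exact MeasurableSet.iInter fun k => MeasurableSet.iInter fun _ =>
        measurableSet_lt measurable_const (measurable_interarrival k)
    refine (mem_ae_iff_prob_eq_one hms).2 ?_
    simpa using hν.measure_lt_interarrival n 0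
  have h := hν.measure_lt_interarrival n fun k => if k ∈ s then t k else 0
  have h1 : ∏ k ∈ Finset.range (n + 1),
      ENNReal.ofReal (Real.exp (-(α * (if k ∈ s then t k else 0 : ℝ≥0)))) =
      ∏ k ∈ s, ENNReal.ofReal (Real.exp (-(α * t k))) := by
    rw [← Finset.prod_subset (hn.trans (Finset.range_mono n.le_succ))]
    · exact Finset.prod_congr rfl fun k hk => by simp [hk]
    · intro k _ hk
      simp [hk]
  rw [← h1, ← h]
  refine measure_congr ?_
  filter_upwards [hpos] with f hf
  refine propext ⟨fun hs k hk => ?_, fun hs k hk => ?_⟩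
  · by_cases hks : k ∈ s
    · simpa [hks] using hs k hks
    · simpa [hks] using hf k hk
  · simpa [hk] using hs k (Finset.mem_range.1 (hn hk)).le

theorem IsPoissonLaw.measure_Ioi (hν : IsPoissonLaw α ν) (k : ℕ) (t : ℝ≥0) :
    ν {f : Cadlag ℕ | (t : ℝ≥0∞) < interarrival f k} = ENNReal.ofReal (Real.exp (-(α * t))) := by
  simpa using hν.measure_lt_interarrival_finset {k} fun _ => t

theorem borel_ennreal_eq_generateFrom :
    ENNReal.measurableSpace =
      .generateFrom (Set.range fun t : ℝ≥0 => Set.Ioi (t : ℝ≥0∞)) := by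
  rw [BorelSpace.measurable_eq (α := ℝ≥0∞), borel_eq_generateFrom_Ioi]
  refine le_antisymm (MeasurableSpace.generateFrom_le ?_) (MeasurableSpace.generateFrom_mono ?_)
  · rintro _ ⟨t, rfl⟩
    induction t using ENNReal.recTopCoe with
    | top => simp
    | coe t => exact MeasurableSpace.measurableSet_generateFrom ⟨t, rfl⟩
  · rintro _ ⟨t, rfl⟩
    exact ⟨t, rfl⟩

theorem isPiSystem_Ioi_coe : IsPiSystem (Set.range fun t : ℝ≥0 => Set.Ioi (t : ℝ≥0∞)) := by
  rintro _ ⟨s, rfl⟩ _ ⟨t, rfl⟩ _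
  exact ⟨max s t, by simp [Set.Ioi_inter_Ioi]⟩

theorem IsPoissonLaw.map_interarrival_eq (hν : IsPoissonLaw α ν) (k : ℕ) :
    ν.map (fun f : Cadlag ℕ => interarrival f k) = ν.map fun f : Cadlag ℕ => interarrival f 0 := by
  have := Measure.isProbabilityMeasure_map (μ := ν) (measurable_interarrival k).aemeasurable
  have := Measure.isProbabilityMeasure_map (μ := ν) (measurable_interarrival 0).aemeasurable
  refine ext_of_generate_finite _ borel_ennreal_eq_generateFrom isPiSystem_Ioi_coe ?_ (by simp)
  rintro _ ⟨t, rfl⟩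
  rw [Measure.map_apply (measurable_interarrival k) measurableSet_Ioi,
    Measure.map_apply (measurable_interarrival 0) measurableSet_Ioi]
  exact (hν.measure_Ioi k t).trans (hν.measure_Ioi 0 t).symm

theorem IsPoissonLaw.iIndepFun_interarrival (hν : IsPoissonLaw α ν) :
    iIndepFun (fun k (f : Cadlag ℕ) => interarrival f k) ν := by
  rw [iIndepFun_iff_iIndep]
  refine iIndepSets.iIndep (fun k => (measurable_interarrival k).comap_le)
    (fun k => (fun A => (fun f : Cadlag ℕ => interarrival f k) ⁻¹' A) ''
      Set.range fun t : ℝ≥0 => Set.Ioi (t : ℝ≥0∞)) (fun k => ?_) (fun k => ?_) ?_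
  · exact isPiSystem_Ioi_coe.comap _
  · rw [borel_ennreal_eq_generateFrom, MeasurableSpace.comap_generateFrom]
  · rw [iIndepSets_iff]
    intro s A hA
    choose! B hB using hA
    choose! t ht using fun i hi => (hB i hi).1
    have hA' : ∀ i ∈ s, A i = {f : Cadlag ℕ | (t i : ℝ≥0∞) < interarrival f i} := fun i hi => by
      rw [← (hB i hi).2, ← ht i hi]
      rfl
    have h1 : ⋂ i ∈ s, A i = {f : Cadlag ℕ | ∀ i ∈ s, (t i : ℝ≥0∞) < interarrival f i} := by
      ext f
      simp only [Set.mem_iInter, Set.mem_ofPred_eq]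
      refine forall₂_congr fun i hi => ?_
      rw [hA' i hi]
      rfl
    rw [h1, hν.measure_lt_interarrival_finset]
    refine Finset.prod_congr rfl fun i hi => ?_
    rw [hA' i hi, hν.measure_Ioi]

theorem IsPoissonLaw.map_interarrival (hν : IsPoissonLaw α ν) :
    ν.map (fun (f : Cadlag ℕ) k => interarrival f k) =
      Measure.infinitePi fun _ : ℕ => ν.map fun f : Cadlag ℕ => interarrival f 0 := by
  rw [(iIndepFun_iff_map_fun_eq_infinitePi_map measurable_interarrival).1
    hν.iIndepFun_interarrival]
  congr 1
  ext1 k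
  exact hν.map_interarrival_eq k

theorem IsPoissonLaw.isInterarrivalLaw (hν : IsPoissonLaw α ν) :
    IsInterarrivalLaw α (ν.map fun f : Cadlag ℕ => interarrival f 0) := fun t => by
  rw [Measure.map_apply (measurable_interarrival 0) measurableSet_Ioi]
  exact hν.measure_Ioi 0 t

end Poisson

/-! ## The skewer of the explored tables -/

/-- The heights of the contour started from `h` right after its successive arrivals. -/
def heightSeq (h : ℝ) (d : Marks) : ℕ → ℝ
  | 0 => h
  | k + 1 => heightSeq h d k - (d.1 k).toReal + absorptionTime (d.2 k)

theorem heightSeq_shift (h : ℝ) (d : Marks) (k : ℕ) :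
    heightSeq (nextHeight h d) d.shift k = heightSeq h d (k + 1) := by
  induction k with
  | zero => rfl
  | succ k ih => rw [heightSeq, ih]; rfl

theorem explored_iff (N : ℕ) (h : ℝ) (d : Marks) : Explored N h d ↔
    (∀ k < N, d.1 k < ENNReal.ofReal (heightSeq h d k)) ∧
      ENNReal.ofReal (heightSeq h d N) < d.1 N := by
  induction N generalizing h d with
  | zero => simp [Explored, heightSeq]
  | succ N ih =>
    rw [Explored, ih, Nat.forall_lt_succ_left']
    simp only [heightSeq_shift, and_assoc]
    rfl

theorem childPath_apply (N : ℕ) (h : ℝ) (d : Marks) (y : ℝ≥0) :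
    childPath N h d y = (List.range N).flatMap fun k =>
      (tablePath (d.2 k)).delay [] (heightSeq h d k - (d.1 k).toReal) y := by
  induction N generalizing h d with
  | zero => rfl
  | succ N ih =>
    rw [childPath, Cadlag.append_apply, ih, List.range_succ_eq_map, List.flatMap_cons,
      List.flatMap_map]
    simp only [heightSeq_shift]
    rfl

section Contour

variable {j : Cadlag ℕ} {z : ℕ → Cadlag ℕ} {N : ℕ}

/-- The marks of a counting path and of the tables that arrive at its jumps. -/
def marksOf (j : Cadlag ℕ) (z : ℕ → Cadlag ℕ) : Marks :=
  (fun k => interarrival j k, fun k => z (k + 1))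

variable (j z) in
/-- The heights of the contour at its jumps, the first of which is at time `0`. -/
def jumpHeight : ℕ → ℝ := heightSeq (absorptionTime (z 0)) (marksOf j z)

theorem jumpTime_succ_eq_add_interarrival {k : ℕ} (h : jumpTime j k < ⊤) :
    jumpTime j (k + 1) = jumpTime j k + interarrival j k := by
  rw [jumpTime_succ_eq_add_holdingTime, interarrival, if_neg h.ne]

theorem jumpTime_lt_top_of_explored (hE : Explored N (absorptionTime (z 0)) (marksOf j z)) {k : ℕ}
    (hk : k ≤ N) : jumpTime j k < ⊤ := by
  induction k with
  | zero => simp [jumpTime_zero]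
  | succ k ih =>
    rw [jumpTime_succ_eq_add_interarrival (ih (by lia))]
    exact ENNReal.add_lt_top.2 ⟨ih (by lia),
      (((explored_iff _ _ _).1 hE).1 k (by lia)).trans ENNReal.ofReal_lt_top⟩

theorem interarrival_lt_of_explored (hE : Explored N (absorptionTime (z 0)) (marksOf j z)) {k : ℕ}
    (hk : k < N) : (interarrival j k).toReal < jumpHeight j z k :=
  ENNReal.toReal_lt_of_lt_ofReal (((explored_iff _ _ _).1 hE).1 k hk)

theorem toNNReal_jumpTime_succ (hE : Explored N (absorptionTime (z 0)) (marksOf j z)) {k : ℕ}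
    (hk : k < N) : ((jumpTime j (k + 1)).toNNReal : ℝ) =
      (jumpTime j k).toNNReal + (interarrival j k).toReal := by
  have h1 := jumpTime_lt_top_of_explored hE hk.le
  have h2 : interarrival j k < ⊤ :=
    (((explored_iff _ _ _).1 hE).1 k hk).trans ENNReal.ofReal_lt_top
  rw [jumpTime_succ_eq_add_interarrival h1, ENNReal.toNNReal_add h1.ne h2.ne]
  rfl

theorem jumpHeight_nonneg (hE : Explored N (absorptionTime (z 0)) (marksOf j z)) {k : ℕ}
    (hk : k ≤ N) : 0 ≤ jumpHeight j z k := by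
  rcases k with _ | k
  · exact NNReal.coe_nonneg _
  · have h1 := interarrival_lt_of_explored hE hk
    have h2 : jumpHeight j z (k + 1) =
      jumpHeight j z k - (interarrival j k).toReal + absorptionTime (z (k + 1)) := rfl
    have h3 := NNReal.coe_nonneg (absorptionTime (z (k + 1)))
    linarith

theorem jumpHeight_eq (hE : Explored N (absorptionTime (z 0)) (marksOf j z)) {k : ℕ}
    (hk : k ≤ N) : jumpHeight j z k =
      -((jumpTime j k).toNNReal : ℝ) + ∑ i ∈ Finset.range (k + 1), (absorptionTime (z i) : ℝ) := by
  induction k with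
  | zero => simp [jumpTime_zero, jumpHeight, heightSeq]
  | succ k ih =>
    have h2 : jumpHeight j z (k + 1) =
      jumpHeight j z k - (interarrival j k).toReal + absorptionTime (z (k + 1)) := rfl
    rw [h2, ih (by lia), toNNReal_jumpTime_succ hE hk, Finset.sum_range_succ _ (k + 1)]
    ring

theorem apply_of_mem_jumpInterval (hj : ∀ k, jumpTime j k < ⊤ → jumpState j k = k) {k : ℕ} {t : ℝ≥0}
    (h1 : jumpTime j k ≤ t) (h2 : (t : ℝ≥0∞) < jumpTime j (k + 1)) : j t = k := by
  rw [eq_of_mem_jumpInterval h1 h2, hj k (h1.trans_lt ENNReal.coe_lt_top)]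

theorem contour_of_mem_jumpInterval (hj : ∀ k, jumpTime j k < ⊤ → jumpState j k = k)
    (hE : Explored N (absorptionTime (z 0)) (marksOf j z)) {k : ℕ} (hk : k ≤ N) {t : ℝ≥0}
    (h1 : jumpTime j k ≤ t) (h2 : (t : ℝ≥0∞) < jumpTime j (k + 1)) :
    contour j (fun i => z i) t = jumpHeight j z k - (t - (jumpTime j k).toNNReal) := by
  rw [contour, apply_of_mem_jumpInterval hj h1 h2, jumpHeight_eq hE hk]
  ring

theorem le_apply_iff (hj : ∀ k, jumpTime j k < ⊤ → jumpState j k = k) (i : ℕ) (t : ℝ≥0) :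
    i ≤ j t ↔ jumpTime j i ≤ t := by
  obtain ⟨k, h1, h2⟩ := exists_mem_jumpInterval j t
  rw [apply_of_mem_jumpInterval hj h1 h2]
  refine ⟨fun h => (jumpTime_mono j h).trans h1, fun h => ?_⟩
  by_contra hik
  exact absurd (h2.trans_le (jumpTime_mono j (show k + 1 ≤ i by lia))) (not_lt.2 h)

theorem arrivalTime_eq (hj : ∀ k, jumpTime j k < ⊤ → jumpState j k = k) {i : ℕ}
    (hi : jumpTime j i < ⊤) : arrivalTime j i = (jumpTime j i).toNNReal := by
  have : {t | i ≤ j t} = Set.Ici (jumpTime j i).toNNReal := by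
    ext t
    rw [Set.mem_ofPred_eq, le_apply_iff hj, Set.mem_Ici, ← ENNReal.coe_le_coe,
      ENNReal.coe_toNNReal hi.ne]
  rw [arrivalTime, this, csInf_Ici]

theorem contour_jumpTime (hj : ∀ k, jumpTime j k < ⊤ → jumpState j k = k)
    (hE : Explored N (absorptionTime (z 0)) (marksOf j z)) {k : ℕ} (hk : k ≤ N) :
    contour j (fun i => z i) (jumpTime j k).toNNReal = jumpHeight j z k := by
  have h := jumpTime_lt_top_of_explored hE hk
  have h1 := ENNReal.coe_toNNReal h.ne
  rw [contour_of_mem_jumpInterval hj hE hk h1.ge (h1.trans_lt (jumpTime_lt_succ j k h))]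
  ring

theorem preJump_jumpTime_succ (hj : ∀ k, jumpTime j k < ⊤ → jumpState j k = k)
    (hE : Explored N (absorptionTime (z 0)) (marksOf j z)) {k : ℕ} (hk : k < N) :
    preJump (contour j (fun i => z i)) (jumpTime j (k + 1)).toNNReal =
      jumpHeight j z k - (interarrival j k).toReal := by
  have h1 := jumpTime_lt_top_of_explored hE hk.le
  have h2 := jumpTime_lt_top_of_explored hE (Nat.succ_le_of_lt hk)
  have h3 := jumpTime_lt_succ j k h1
  set u := (jumpTime j (k + 1)).toNNReal with hu
  have h4 : (u : ℝ≥0∞) = jumpTime j (k + 1) := ENNReal.coe_toNNReal h2.ne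
  have hlt : (jumpTime j k).toNNReal < u := ENNReal.toNNReal_strict_mono h2.ne h3
  have hu0 : u ≠ 0 := (pos_of_gt hlt).ne'
  rw [preJump, if_neg hu0]
  have hbot : (𝓝[<] u).NeBot := nhdsLT_neBot_of_exists_lt ⟨_, hlt⟩
  refine leftLim_eq_of_tendsto ?_
  have hlim : Tendsto (fun t : ℝ≥0 => jumpHeight j z k - (t - (jumpTime j k).toNNReal : ℝ)) (𝓝[<] u)
      (𝓝 (jumpHeight j z k - (u - (jumpTime j k).toNNReal : ℝ))) := by
    refine Tendsto.mono_left ?_ nhdsWithin_le_nhds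
    exact Continuous.tendsto (by fun_prop) u
  have hval : (u - (jumpTime j k).toNNReal : ℝ) = (interarrival j k).toReal := by
    rw [toNNReal_jumpTime_succ hE hk]
    ring
  rw [hval] at hlim
  refine hlim.congr' ?_
  filter_upwards [Ioo_mem_nhdsLT hlt] with t ht
  refine (contour_of_mem_jumpInterval hj hE hk.le ?_ ?_).symm
  · rw [← ENNReal.coe_toNNReal h1.ne]
    exact ENNReal.coe_le_coe.2 ht.1.le
  · rw [← h4]
    exact ENNReal.coe_lt_coe.2 ht.2

variable (j z N) in
/-- The time at which the contour reaches `0` if it does so before its `N + 1`-st arrival. -/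
def hittingTime : ℝ≥0 := (jumpTime j N).toNNReal + (jumpHeight j z N).toNNReal

theorem hittingTime_mem_jumpInterval (hE : Explored N (absorptionTime (z 0)) (marksOf j z)) :
    jumpTime j N ≤ hittingTime j z N ∧ (hittingTime j z N : ℝ≥0∞) < jumpTime j (N + 1) := by
  have h := jumpTime_lt_top_of_explored hE le_rfl
  rw [jumpTime_succ_eq_add_interarrival h, hittingTime, ENNReal.coe_add, ENNReal.coe_toNNReal h.ne]
  exact ⟨le_self_add, ENNReal.add_lt_add_left h.ne ((explored_iff _ _ _).1 hE).2⟩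

/-- Between arrivals the contour has slope `-1`. For `k < N` the next arrival comes before the
height is used up, so the contour stays positive; after the `N`-th one it has time to reach `0`. -/
theorem isLeast_hittingTime (hj : ∀ k, jumpTime j k < ⊤ → jumpState j k = k)
    (hE : Explored N (absorptionTime (z 0)) (marksOf j z)) :
    IsLeast {t | contour j (fun i => z i) t = 0} (hittingTime j z N) := by
  have hT := hittingTime_mem_jumpInterval hE
  have hN := Real.coe_toNNReal _ (jumpHeight_nonneg hE le_rfl)
  constructor
  · rw [Set.mem_ofPred_eq, contour_of_mem_jumpInterval hj hE le_rfl hT.1 hT.2, hittingTime,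
      NNReal.coe_add, hN]
    ring
  · intro t ht
    by_contra! hlt
    obtain ⟨k, h1, h2⟩ := exists_mem_jumpInterval j t
    have hkN : k ≤ N := by
      by_contra hk
      have h3 := (jumpTime_mono j (show N + 1 ≤ k by lia)).trans h1
      exact absurd (hT.2.trans_le h3) (not_lt.2 (ENNReal.coe_le_coe.2 hlt.le))
    rw [Set.mem_ofPred_eq, contour_of_mem_jumpInterval hj hE hkN h1 h2] at ht
    rcases hkN.eq_or_lt with rfl | hkN
    · have h3 : (t : ℝ) < (jumpTime j k).toNNReal + jumpHeight j z k := by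
        rw [← hN]
        exact_mod_cast hlt
      linarith
    · have h3 : (t : ℝ) < (jumpTime j (k + 1)).toNNReal := by
        rw [← ENNReal.coe_toNNReal (jumpTime_lt_top_of_explored hE hkN).ne] at h2
        exact_mod_cast h2
      rw [toNNReal_jumpTime_succ hE hkN] at h3
      linarith [interarrival_lt_of_explored hE hkN]

theorem map_filter_eq_flatMap {A B : Type*} (p : A → Bool) (f : A → B) (l : List A) :
    (l.filter p).map f = l.flatMap fun a => if p a then [f a] else [] := by
  induction l with
  | nil => rfl
  | cons a l ih =>
    rw [List.filter_cons, List.flatMap_cons, ← ih]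
    split_ifs <;> rfl

/-- Since the mark is absorbed exactly at `D - B`, a jump crosses level `y` precisely when the
delayed table path is non-empty there. -/
theorem crossing_eq_delay {f : Cadlag ℕ} (hf : IsAbsorbed f) {B D : ℝ}
    (hD : D = B + absorptionTime f) (y : ℝ≥0) (p : Bool) (hp : p = true ↔ B ≤ y ∧ (y : ℝ) < D) :
    (if p then [(f (Real.toNNReal ((y : ℝ) - B))).toPNat'] else []) =
      (tablePath f).delay [] B y := by
  rw [Cadlag.delay_apply, tablePath_apply]
  by_cases h1 : (y : ℝ) < B
  · rw [if_pos h1, if_neg]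
    rw [hp]
    exact fun h => absurd h.1 (not_le.2 h1)
  · rw [if_neg h1]
    have h2 : f (Real.toNNReal ((y : ℝ) - B)) = 0 ↔ ¬ p = true := by
      rw [hf.eq_zero_iff, hp, ← NNReal.coe_le_coe, Real.coe_toNNReal _ (by linarith), hD]
      constructor
      · intro h h'
        linarith [h'.2]
      · intro h
        by_contra h'
        exact h ⟨by linarith, by linarith⟩
    by_cases h3 : p = true
    · rw [if_pos h3, if_neg (by rw [h2]; simpa using h3)]
    · rw [if_neg h3, if_pos (h2.2 h3)]

/-- The deterministic half of the theorem: on the event `Explored N`, exactly the tables `0, …, N`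
enter the skewer, and the birth heights in `childPath` are the left limits of the contour. -/
theorem skewerProcess_eq (hj : ∀ k, jumpTime j k < ⊤ → jumpState j k = k)
    (hz : ∀ i, IsAbsorbed (z i)) (hE : Explored N (absorptionTime (z 0)) (marksOf j z)) :
    skewerProcess j (fun i => z i) =
      (tablePath (z 0) ++ childPath N (absorptionTime (z 0)) (marksOf j z) : Cadlag Comp) := by
  funext y
  have hT := hittingTime_mem_jumpInterval hE
  have hJT : j (hitZero (contour j fun i => z i)) = N := by
    rw [hitZero, (isLeast_hittingTime hj hE).csInf_eq]
    exact apply_of_mem_jumpInterval hj hT.1 hT.2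
  rw [skewerProcess, hJT, skewer, map_filter_eq_flatMap, List.range_succ_eq_map, List.flatMap_cons,
    List.flatMap_map, Cadlag.append_apply, childPath_apply]
  have hU : ∀ i ≤ N, arrivalTime j i = (jumpTime j i).toNNReal := fun i hi =>
    arrivalTime_eq hj (jumpTime_lt_top_of_explored hE hi)
  congr 1
  · have h0 : preJump (contour j fun i => z i) (arrivalTime j 0) = 0 := by
      rw [hU 0 (by lia), jumpTime_zero, preJump]
      simp
    have hD : contour j (fun i => z i) (arrivalTime j 0) = 0 + absorptionTime (z 0) := by
      rw [hU 0 (by lia), contour_jumpTime hj hE (by lia), zero_add]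
      rfl
    rw [h0]
    refine (crossing_eq_delay (hz 0) hD y _ (by simp)).trans ?_
    rw [Cadlag.delay_apply, if_neg (not_lt.2 (NNReal.coe_nonneg y)), sub_zero, Real.toNNReal_coe]
  · refine List.flatMap_congr fun i hi => ?_
    have hi' : i < N := List.mem_range.1 hi
    have hB : preJump (contour j fun i => z i) (arrivalTime j (i + 1)) =
        jumpHeight j z i - (interarrival j i).toReal := by
      rw [hU _ hi', preJump_jumpTime_succ hj hE hi']
    have hD : contour j (fun i => z i) (arrivalTime j (i + 1)) =
        jumpHeight j z i - (interarrival j i).toReal + absorptionTime (z (i + 1)) := by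
      rw [hU _ hi', contour_jumpTime hj hE hi']
      rfl
    rw [Nat.succ_eq_add_one, hB]
    exact crossing_eq_delay (hz (i + 1)) hD y _ (by simp)

end Contour

/-! ## The law of the skewer process -/

section TreePath

variable {ε : Measure ℝ≥0∞} {P Q : Measure (Cadlag ℕ)} [IsProbabilityMeasure ε]
  [IsProbabilityMeasure P]

open Classical in
/-- The path of compositions of a table and its descendants. -/
def treePath (p : Cadlag ℕ × Marks) : Cadlag Comp :=
  if h : ∃ N, Explored N (absorptionTime p.1) p.2 then
    tablePath p.1 ++ childPath h.choose (absorptionTime p.1) p.2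
  else .const []

theorem treePath_eq {p : Cadlag ℕ × Marks} {N : ℕ} (h : Explored N (absorptionTime p.1) p.2) :
    treePath p = tablePath p.1 ++ childPath N (absorptionTime p.1) p.2 := by
  have h' : ∃ N, Explored N (absorptionTime p.1) p.2 := ⟨N, h⟩
  rw [treePath, dif_pos h', explored_unique h'.choose_spec h]

theorem measurable_treePath : Measurable treePath := by
  intro A hA
  have : treePath ⁻¹' A =
      (⋃ N, {p : Cadlag ℕ × Marks | Explored N (absorptionTime p.1) p.2} ∩
        (fun p : Cadlag ℕ × Marks =>
          tablePath p.1 ++ childPath N (absorptionTime p.1) p.2) ⁻¹' A) ∪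
      (⋃ N, {p : Cadlag ℕ × Marks | Explored N (absorptionTime p.1) p.2})ᶜ ∩
        {_p | Cadlag.const [] ∈ A} := by
    ext p
    simp only [Set.mem_preimage, Set.mem_union, Set.mem_iUnion, Set.mem_inter_iff,
      Set.mem_ofPred_eq, Set.mem_compl_iff]
    by_cases h : ∃ N, Explored N (absorptionTime p.1) p.2
    · obtain ⟨N, hN⟩ := h
      rw [treePath_eq hN]
      constructor
      · exact fun h => Or.inl ⟨N, hN, h⟩
      · rintro (⟨M, hM, h⟩ | ⟨h, -⟩)
        · rwa [explored_unique hN hM]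
        · exact absurd ⟨N, hN⟩ h
    · rw [treePath, dif_neg h]
      constructor
      · exact fun h' => Or.inr ⟨h, h'⟩
      · rintro (⟨N, hN, -⟩ | ⟨-, h'⟩)
        · exact absurd ⟨N, hN⟩ h
        · exact h'
  rw [this]
  exact (MeasurableSet.iUnion fun N => (measurableSet_explored_absorptionTime N).inter
    (measurable_tablePath_append_childPath N hA)).union
    ((MeasurableSet.iUnion measurableSet_explored_absorptionTime).compl.inter
      (MeasurableSet.const _))

theorem treeLaw_apply {A : Set (Cadlag Comp)} (hA : MeasurableSet A) :
    treeLaw ε P Q A = Q.prod (marksLaw ε P)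
      (⋃ N, {p : Cadlag ℕ × Marks | Explored N (absorptionTime p.1) p.2} ∩
        (fun p : Cadlag ℕ × Marks =>
          tablePath p.1 ++ childPath N (absorptionTime p.1) p.2) ⁻¹' A) := by
  rw [treeLaw, Measure.sum_apply _ hA, measure_iUnion]
  · refine tsum_congr fun N => ?_
    rw [Measure.map_apply (measurable_tablePath_append_childPath N) hA,
      Measure.restrict_apply (measurable_tablePath_append_childPath N hA), Set.inter_comm]
  · intro N M hNM
    rw [Function.onFun, Set.disjoint_left]
    exact fun p h1 h2 => hNM (explored_unique h1.1 h2.1)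
  · exact fun N => (measurableSet_explored_absorptionTime N).inter
      (measurable_tablePath_append_childPath N hA)

variable [IsProbabilityMeasure Q]

/-- The mass of `treeLaw` is the probability that the exploration stops after finitely many tables.
-/
theorem ae_exists_explored (h : treeLaw ε P Q Set.univ = 1) :
    ∀ᵐ p ∂Q.prod (marksLaw ε P), ∃ N, Explored N (absorptionTime p.1) p.2 := by
  rw [treeLaw_apply MeasurableSet.univ] at h
  simp only [Set.preimage_univ, Set.inter_univ] at h
  have h1 := (mem_ae_iff_prob_eq_one (MeasurableSet.iUnion measurableSet_explored_absorptionTime)).2 h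
  filter_upwards [h1] with p hp
  obtain ⟨N, hN⟩ := Set.mem_iUnion.1 hp
  exact ⟨N, hN⟩

theorem map_treePath (h : treeLaw ε P Q Set.univ = 1) :
    (Q.prod (marksLaw ε P)).map treePath = treeLaw ε P Q := by
  refine Measure.ext fun A hA => ?_
  rw [Measure.map_apply measurable_treePath hA, treeLaw_apply hA]
  refine measure_congr ?_
  filter_upwards [ae_exists_explored h] with p ⟨N, hN⟩
  refine propext ?_
  change treePath p ∈ A ↔ p ∈ (⋃ N, _)
  rw [treePath_eq hN, Set.mem_iUnion]
  refine ⟨fun h => ⟨N, hN, h⟩, ?_⟩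
  rintro ⟨M, hM, h⟩
  rwa [explored_unique hN hM]

end TreePath

/-- Independence makes all table paths and inter-arrival times a product; the initial table is split
off, as its law may differ from that of the others. -/
theorem map_eq_prod_marksLaw {Ω : Type*} [MeasurableSpace Ω] {μ : Measure Ω}
    [IsProbabilityMeasure μ] {ε : Measure ℝ≥0∞} {P : Measure (Cadlag ℕ)} [IsProbabilityMeasure ε]
    [IsProbabilityMeasure P] {Z : ℕ → Ω → Cadlag ℕ} {J : Ω → Cadlag ℕ}
    (hZm : ∀ i, Measurable (Z i)) (hJm : Measurable J) (hZ : iIndepFun Z μ)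
    (hind : IndepFun (fun ω i => Z i ω) J μ) (hP : ∀ i, μ.map (Z (i + 1)) = P)
    (hε : (μ.map J).map (fun (f : Cadlag ℕ) k => interarrival f k) =
      Measure.infinitePi fun _ : ℕ => ε) :
    μ.map (fun ω => (Z 0 ω, marksOf (J ω) fun i => Z i ω)) =
      (μ.map (Z 0)).prod (marksLaw ε P) := by
  have hEm : Measurable fun (f : Cadlag ℕ) k => interarrival f k :=
    measurable_pi_lambda _ measurable_interarrival
  have hZ' : Measurable fun ω i => Z i ω := measurable_pi_lambda _ hZm
  have hprob : ∀ i, IsProbabilityMeasure (μ.map (Z i)) := fun i =>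
    Measure.isProbabilityMeasure_map (hZm i).aemeasurable
  have hjoint : μ.map (fun ω => (fun i => Z i ω, fun k => interarrival (J ω) k)) =
      (Measure.infinitePi fun i => μ.map (Z i)).prod (Measure.infinitePi fun _ : ℕ => ε) := by
    have h := (indepFun_iff_map_prod_eq_prod_map_map hZ'.aemeasurable
      (hEm.comp hJm).aemeasurable).1 (hind.comp measurable_id hEm)
    rw [← hε, Measure.map_map hEm hJm, ← (iIndepFun_iff_map_fun_eq_infinitePi_map hZm).1 hZ]
    exact h
  have hg : Measurable fun p : (ℕ → Cadlag ℕ) × (ℕ → ℝ≥0∞) =>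
      (p.1 0, ((p.2, fun i => p.1 (i + 1)) : Marks)) := by fun_prop
  have hmap : μ.map (fun ω => (Z 0 ω, marksOf (J ω) fun i => Z i ω)) =
      (μ.map fun ω => (fun i => Z i ω, fun k => interarrival (J ω) k)).map
        fun p : (ℕ → Cadlag ℕ) × (ℕ → ℝ≥0∞) =>
          (p.1 0, ((p.2, fun i => p.1 (i + 1)) : Marks)) := by
    have hm : Measurable fun ω => (fun i => Z i ω, fun k => interarrival (J ω) k) :=
      hZ'.prodMk (hEm.comp hJm)
    rw [Measure.map_map hg hm]
    rfl
  rw [hmap, hjoint]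
  refine measure_eq_of_lintegral_le_one fun F hF _ => ?_
  rw [lintegral_map hF hg, lintegral_prod _ (by fun_prop), lintegral_prod _ hF.aemeasurable]
  have h1 := lintegral_infinitePi_eq (fun i => μ.map (Z i)) (F := fun z z' =>
    ∫⁻ e, F (z, ((e, z') : Marks)) ∂Measure.infinitePi fun _ : ℕ => ε) (by fun_prop)
  refine h1.trans (lintegral_congr fun z => ?_)
  simp only [hP]
  rw [marksLaw, lintegral_prod_symm _ (by fun_prop)]

end Skewer

end

/-! ### The main theorem -/

theorem mainTheorem1 {Ω : Type*} [MeasurableSpace Ω] (μ : MeasureTheory.Measure Ω)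
    [MeasureTheory.IsProbabilityMeasure μ]
    (α : ℝ) (hα0 : 0 ≤ α) (hα1 : α ≤ 1) (n₀ : ℕ+)
    (Z : ℕ → ℝ≥0 → Ω → ℕ) (J : ℝ≥0 → Ω → ℕ)
    (hZmeas : ∀ i t, Measurable (Z i t)) (hJmeas : ∀ t, Measurable (J t))
    (hZ0 : Skewer.IsTableChain α n₀ (Z 0) μ)
    (hZ : ∀ i, 1 ≤ i → Skewer.IsTableChain α 1 (Z i) μ)
    (hJ : Skewer.IsPoissonProcess α J μ)
    (hZindep : ProbabilityTheory.iIndepFun (fun i ω t => Z i t ω) μ)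
    (hJindep : ProbabilityTheory.IndepFun (fun ω i t => Z i t ω) (fun ω t => J t ω) μ) :
    (∀ᵐ ω ∂μ, ∀ i, ∃ s, Z i s ω = 0) ∧
    (∀ᵐ ω ∂μ, ∃ t, Skewer.contour (fun s => J s ω) (fun i s => Z i s ω) t = 0) ∧
    Skewer.IsUpDownOCRP α 0 [n₀]
      (fun y ω => Skewer.skewerProcess (fun s => J s ω) (fun i s => Z i s ω) y) μ := by
  open Skewer in
  have hprob := isProbabilityMeasure_tableLaw hα0 hα1
  have hrate := isRate_tableRate hα1
  have hfam := isChainFamily_tableLaw hα0 hα1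
  have hcad : ∀ i, ∀ᵐ ω ∂μ, IsCadlagPath fun t => Z i t ω := fun i => by
    rcases i with _ | i
    exacts [hZ0.cadlag, (hZ (i + 1) (by lia)).cadlag]
  choose Z' hZm hZeq using fun i => exists_cadlag_modification 0
    (fun t x => hZmeas i t (measurableSet_singleton x)) (hcad i)
  obtain ⟨J', hJm, hJeq⟩ := exists_cadlag_modification 0
    (fun t x => hJmeas t (measurableSet_singleton x)) hJ.cadlag
  have hlaw0 : μ.map (Z' 0) = tableLaw α n₀ := hZ0.map_eq hrate hfam (hZm 0) (hZeq 0)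
  have hlaw : ∀ i, μ.map (Z' (i + 1)) = tableLaw α 1 := fun i =>
    (hZ (i + 1) (by lia)).map_eq hrate hfam (hZm _) (hZeq _)
  have hν : IsPoissonLaw α (μ.map J') := hJ.measure_jumpEvent hJm hJeq
  have := Measure.isProbabilityMeasure_map (μ := μ) hJm.aemeasurable
  have := Measure.isProbabilityMeasure_map (μ := μ.map J') (measurable_interarrival 0).aemeasurable
  have hε := hν.isInterarrivalLaw
  set ε := (μ.map J').map fun f : Cadlag ℕ => interarrival f 0
  have hjoint := map_eq_prod_marksLaw hZm hJm (iIndepFun_cadlag hZeq hZindep)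
    (indepFun_cadlag hZeq hJeq hJindep) hlaw hν.map_interarrival
  rw [hlaw0] at hjoint
  have hm : Measurable fun ω => (Z' 0 ω, marksOf (J' ω) fun i => Z' i ω) :=
    (hZm 0).prodMk ((measurable_pi_lambda _ fun k => (measurable_interarrival k).comp hJm).prodMk
      (measurable_pi_lambda _ fun i => hZm (i + 1)))
  have htree := treeLaw_univ hα0 hα1 hε n₀
  have habs : ∀ᵐ ω ∂μ, ∀ i, IsAbsorbed (Z' i ω) := by
    refine ae_all_iff.2 fun i => ae_of_ae_map (hZm i).aemeasurable ?_
    rcases i with _ | i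
    · rw [hlaw0]
      exact ae_isAbsorbed α _
    · rw [hlaw]
      exact ae_isAbsorbed α _
  -- Total mass one of the tree law means here that the contour almost surely reaches `0`.
  have hexp : ∀ᵐ ω ∂μ, ∃ N, Explored N (absorptionTime (Z' 0 ω)) (marksOf (J' ω) fun i => Z' i ω) := by
    have h := ae_exists_explored htree
    rw [← hjoint] at h
    exact ae_of_ae_map hm.aemeasurable h
  have hstate := ae_of_ae_map hJm.aemeasurable hν.ae_jumpState
  have hZall : ∀ᵐ ω ∂μ, ∀ i, (Z' i ω).toFun = fun t => Z i t ω := ae_all_iff.2 hZeq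
  refine ⟨?_, ?_, ?_⟩
  · filter_upwards [habs, hZall] with ω h1 h2 i
    refine ⟨absorptionTime (Z' i ω), ?_⟩
    exact (congrFun (h2 i) _).symm.trans (((h1 i).eq_zero_iff _).2 le_rfl)
  · filter_upwards [hexp, hstate, hZall, hJeq] with ω ⟨N, hN⟩ h1 h2 h3
    have h := (isLeast_hittingTime (z := fun i => Z' i ω) h1 hN).1
    rw [h3, show (fun i => (Z' i ω).toFun) = fun i s => Z i s ω from funext h2] at h
    exact ⟨_, h⟩
  · refine isMarkovChain_of_map_eq (isRate_ocrpRate hα0 hα1)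
      (isChainFamily_forestLaw (ε := ε) hα0 hα1 hε) (measurable_treePath.comp hm) ?_ ?_
    · filter_upwards [hexp, hstate, hZall, hJeq, habs] with ω ⟨N, hN⟩ h1 h2 h3 h4
      have h := skewerProcess_eq (z := fun i => Z' i ω) h1 h4 hN
      rw [h3, show (fun i => (Z' i ω).toFun) = fun i s => Z i s ω from funext h2] at h
      rw [Function.comp_apply, treePath_eq hN]
      exact h.symm
    -- The forest of the one-table composition is a single tree followed by the empty path.
    · rw [← Measure.map_map measurable_treePath hm, hjoint, map_treePath htree, forestLaw, forestLaw,
        concatLaw_dirac_nil]
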